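/- Let $\mathbb R^{2n}\cong\mathbb C^n$, with coordinates $(q,p)=q+ip$, carry the symplectic form $\omega((q,p),(q',p'))=-\langle q,p'\rangle+\langle p,q'\rangle$. Let $\Lambda(n)$ be the Lagrangian Grassmannian, that is, the set of real $n$-dimensional subspaces on which $\omega$ vanishes, regarded as an embedded submanifold of the Grassmannian of $n$-planes in $\mathbb R^{2n}$. Let $\mathrm{Det}^2:\Lambda(n)=\mathrm U(n)/\mathrm O(n)\to S^1$ be the map $U(\mathbb R^n\times\{0\})\mapsto(\det U)^2$, and for a closed curve $\gamma:S^1=\mathbb R/\mathbb Z\to\Lambda(n)$ (a continuous map) let $\alpha(\gamma)=\deg(\mathrm{Det}^2\circ\gamma)\in\mathbb Z$ be its Maslov class. Let $\sigma=\{0\}\times\mathbb R^n$, $\Lambda^k(\sigma)=\{\lambda\in\Lambda(n):\dim(\lambda\cap\sigma)=k\}$ and $\Lambda^{\ge1}(\sigma)=\bigcup_{k\ge1}\Lambda^k(\sigma)$. The codimension-one stratum $\Lambda^1(\sigma)$ is co-oriented by the velocity field of the flow $\lambda\mapsto e^{it}\lambda$, which is transverse to it. A smooth closed curve $\delta$ is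 called transverse to $\Lambda^{\ge1}(\sigma)$ if it meets $\Lambda^{\ge1}(\sigma)$ only in points of $\Lambda^1(\sigma)$, and there transversally to $\Lambda^1(\sigma)$; each such crossing has the sign $+1$ or $-1$ according to whether the velocity of $\delta$ points to the positive or the negative side. The intersection index $\mathrm{Ind}(\gamma)$ of a closed curve $\gamma$ with $\Lambda^{\ge1}(\sigma)$ is the sum of the signs of the crossings of any smooth closed curve $\delta$ that is transverse to $\Lambda^{\ge1}(\sigma)$ and homotopic to $\gamma$ through closed curves. **Proposition.** For every closed curve $\gamma$ in $\Lambda(n)$ the index $\mathrm{Ind}(\gamma)$ is well defined (such a curve $\delta$ exists, every such $\delta$ has finitely many crossings, and the sum of their signs does not depend on $\delta$), and $$\mathrm{Ind}(\gamma)=\alpha(\gamma).$$ -/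

import Mathlib

open scoped Topology ContDiff

noncomputable section

namespace LagrangianGr

/-- The space `ℝ²ⁿ ≅ ℂⁿ`, with coordinates `(q, p) = q + i p`. -/
abbrev Cn (n : ℕ) : Type := EuclideanSpace ℂ (Fin n)

/-- The standard symplectic form `ω((q, p), (q', p')) = -⟨q, p'⟩ + ⟨p, q'⟩`. -/
def omega {n : ℕ} (z w : Cn n) : ℝ :=
  ∑ j, (-((z j).re * (w j).im) + (z j).im * (w j).re)

/-- A Lagrangian subspace: a real subspace of dimension `n` on which `ω` vanishes. -/
def IsLagrangian {n : ℕ} (L : Submodule ℝ (Cn n)) : Prop :=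
  Module.finrank ℝ L = n ∧ ∀ z ∈ L, ∀ w ∈ L, omega z w = 0

/-- The Lagrangian Grassmannian `Λ(n)`. -/
structure Lambda (n : ℕ) : Type where
  carrier : Submodule ℝ (Cn n)
  isLagrangian : IsLagrangian carrier

/-- The orthogonal projection of `ℝ²ⁿ` onto a Lagrangian subspace.  This is the standard embedding
of the Grassmannian of `n`-planes as a submanifold of the space of endomorphisms. -/
def proj {n : ℕ} (l : Lambda n) : Cn n →L[ℝ] Cn n := l.1.starProjection

/-- `Λ(n)` has the topology of the Grassmannian of `n`-planes. -/
instance (n : ℕ) : TopologicalSpace (Lambda n) := TopologicalSpace.induced proj inferInstance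

/-! ### The unitary group and the map `Det²` -/

/-- A unitary matrix as a real linear map of `ℂⁿ`. -/
def unitaryMap {n : ℕ} (U : Matrix.unitaryGroup (Fin n) ℂ) : Cn n →ₗ[ℝ] Cn n :=
  (Matrix.toEuclideanLin (U : Matrix (Fin n) (Fin n) ℂ)).restrictScalars ℝ

theorem omega_eq_im_inner {n : ℕ} (z w : Cn n) : omega z w = (inner ℂ w z).im := by
  simp [omega, PiLp.inner_apply, Complex.mul_im]

theorem inner_unitaryMap {n : ℕ} (U : Matrix.unitaryGroup (Fin n) ℂ) (z w : Cn n) :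
    inner ℂ (unitaryMap U z) (unitaryMap U w) = inner ℂ z w := by
  have h : (star (U : Matrix (Fin n) (Fin n) ℂ)) * U = 1 := Matrix.UnitaryGroup.star_mul_self U
  rw [EuclideanSpace.inner_eq_star_dotProduct, EuclideanSpace.inner_eq_star_dotProduct]
  simp only [unitaryMap, LinearMap.coe_restrictScalars, Matrix.ofLp_toLpLin,
    Matrix.toLin'_apply]
  rw [Matrix.star_mulVec, dotProduct_comm, ← Matrix.dotProduct_mulVec, Matrix.mulVec_mulVec,
    ← Matrix.star_eq_conjTranspose, h, Matrix.one_mulVec, dotProduct_comm]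

theorem unitaryMap_injective {n : ℕ} (U : Matrix.unitaryGroup (Fin n) ℂ) :
    Function.Injective (unitaryMap U) := by
  rw [← LinearMap.ker_eq_bot, LinearMap.ker_eq_bot']
  intro z hz
  have h := inner_unitaryMap U z z
  rw [hz, inner_zero_left] at h
  exact inner_self_eq_zero.mp h.symm

/-- The action of the unitary group on `Λ(n)`. -/
def unitaryAct {n : ℕ} (U : Matrix.unitaryGroup (Fin n) ℂ) (l : Lambda n) : Lambda n :=
  ⟨l.1.map (unitaryMap U), by
    refine ⟨?_, ?_⟩
    · rw [← (Submodule.equivMapOfInjective (unitaryMap U) (unitaryMap_injective U) l.1).finrank_eq]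
      exact l.2.1
    · rintro _ ⟨z, hz, rfl⟩ _ ⟨w, hw, rfl⟩
      rw [omega_eq_im_inner, inner_unitaryMap, ← omega_eq_im_inner]
      exact l.2.2 z hz w hw⟩

/-- The subspace `ℝⁿ × {0}`. -/
def realSpace (n : ℕ) : Submodule ℝ (Cn n) where
  carrier := {z | ∀ j, (z j).im = 0}
  add_mem' := fun ha hb j => by simp [ha j, hb j]
  zero_mem' := fun j => by simp
  smul_mem' := fun c z hz j => by simp [hz j]

/-- The fixed Lagrangian subspace `σ = {0} × ℝⁿ`. -/
def sigma (n : ℕ) : Submodule ℝ (Cn n) where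
  carrier := {z | ∀ j, (z j).re = 0}
  add_mem' := fun ha hb j => by simp [ha j, hb j]
  zero_mem' := fun j => by simp
  smul_mem' := fun c z hz j => by simp [hz j]

theorem exists_unitary {n : ℕ} (l : Lambda n) :
    ∃ U : Matrix.unitaryGroup (Fin n) ℂ, (realSpace n).map (unitaryMap U) = l.1 := by
  obtain ⟨L, hL, hω⟩ := l
  let b : OrthonormalBasis (Fin n) ℝ L := (stdOrthonormalBasis ℝ L).reindex (finCongr hL)
  let A : Matrix (Fin n) (Fin n) ℂ := Matrix.of fun i j => (b j : Cn n) i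
  have hA : star A * A = 1 := by
    ext i j
    have h1 : inner ℝ (b i : Cn n) (b j : Cn n) = if i = j then (1 : ℝ) else 0 := by
      rw [← Submodule.coe_inner]
      exact orthonormal_iff_ite.mp b.orthonormal i j
    have h2 : omega (b j : Cn n) (b i : Cn n) = 0 := hω _ (b j).2 _ (b i).2
    have h3 : (star A * A) i j = inner ℂ (b i : Cn n) (b j : Cn n) := by
      simp [Matrix.mul_apply, Matrix.star_apply, A, PiLp.inner_apply, mul_comm]
    have h4 : (inner ℂ (b i : Cn n) (b j : Cn n)).re = inner ℝ (b i : Cn n) (b j : Cn n) := by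
      simp [PiLp.inner_apply]
    rw [omega_eq_im_inner] at h2
    rw [h3, Matrix.one_apply]
    apply Complex.ext
    · rw [h4, h1]; split_ifs <;> simp
    · rw [h2]; split_ifs <;> simp
  have key : ∀ (U : Matrix.unitaryGroup (Fin n) ℂ), (U : Matrix (Fin n) (Fin n) ℂ) = A →
      ∀ c : Fin n → ℝ, unitaryMap U (WithLp.toLp 2 fun j => (c j : ℂ)) =
        ((∑ j, c j • b j : L) : Cn n) := by
    intro U hU c
    ext i
    simp [unitaryMap, hU, Matrix.mulVec, dotProduct, A, mul_comm]
  refine ⟨⟨A, Matrix.mem_unitaryGroup_iff'.mpr hA⟩, le_antisymm ?_ ?_⟩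
  · rintro _ ⟨x, hx, rfl⟩
    have hx' : x = WithLp.toLp 2 fun j => (((x j).re : ℝ) : ℂ) := by
      ext j
      exact Complex.ext (by simp) (by simpa using hx j)
    rw [hx', key _ rfl]
    exact Subtype.property _
  · intro z hz
    refine ⟨WithLp.toLp 2 fun j => ((b.repr ⟨z, hz⟩ j : ℝ) : ℂ), fun j => by simp, ?_⟩
    rw [key _ rfl, b.sum_repr]

theorem proj_eq_of_map {n : ℕ} (l : Lambda n) (U : Matrix.unitaryGroup (Fin n) ℂ)
    (hU : (realSpace n).map (unitaryMap U) = l.1) (j i : Fin n) :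
    2 * proj l (EuclideanSpace.single j 1) i - (1 : Matrix (Fin n) (Fin n) ℂ) i j =
      ((U : Matrix (Fin n) (Fin n) ℂ) * (U : Matrix (Fin n) (Fin n) ℂ).transpose) i j := by
  have hUU : (U : Matrix (Fin n) (Fin n) ℂ) * star (U : Matrix (Fin n) (Fin n) ℂ) = 1 :=
    Unitary.coe_mul_star_self U
  let x : Cn n := WithLp.toLp 2 fun k => (((U : Matrix (Fin n) (Fin n) ℂ) j k).re : ℂ)
  let y : Cn n := WithLp.toLp 2 fun k => -Complex.I * (((U : Matrix (Fin n) (Fin n) ℂ) j k).im : ℂ)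
  have hxy : EuclideanSpace.single j 1 = unitaryMap U x + unitaryMap U y := by
    rw [← map_add]
    ext k
    have : (x + y : Cn n) = WithLp.toLp 2 fun k => star ((U : Matrix (Fin n) (Fin n) ℂ) j k) := by
      ext k
      apply Complex.ext <;> simp [x, y]
    rw [this]
    have h := congrFun (congrFun hUU k) j
    simp only [Matrix.mul_apply, Matrix.star_apply] at h
    simp only [unitaryMap, LinearMap.coe_restrictScalars, Matrix.ofLp_toLpLin, Matrix.toLin'_apply,
      Matrix.mulVec, dotProduct]
    rw [h]
    simp [Matrix.one_apply]
  have hp : proj l (EuclideanSpace.single j 1) = unitaryMap U x := by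
    apply Submodule.eq_starProjection_of_mem_of_inner_eq_zero
    · rw [← hU]
      exact ⟨x, fun k => by simp [x], rfl⟩
    · intro w hw
      rw [← hU] at hw
      obtain ⟨v, hv, rfl⟩ := hw
      have h4 : ∀ a c : Cn n, inner ℝ a c = (inner ℂ a c).re := fun a c => by
        simp [PiLp.inner_apply]
      rw [hxy, add_sub_cancel_left, h4, inner_unitaryMap]
      have hv' : ∀ k, (v k).im = 0 := hv
      simp [PiLp.inner_apply, y, hv']
  have h := congrFun (congrFun hUU i) j
  simp only [Matrix.mul_apply, Matrix.star_apply] at h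
  rw [hp, ← h]
  simp only [unitaryMap, LinearMap.coe_restrictScalars, Matrix.ofLp_toLpLin, Matrix.toLin'_apply,
    Matrix.mulVec, dotProduct, Matrix.mul_apply, Matrix.transpose_apply]
  rw [Finset.mul_sum, ← Finset.sum_sub_distrib]
  refine Finset.sum_congr rfl fun k _ => ?_
  have : star ((U : Matrix (Fin n) (Fin n) ℂ) j k) =
      2 * (((U : Matrix (Fin n) (Fin n) ℂ) j k).re : ℂ) - (U : Matrix (Fin n) (Fin n) ℂ) j k := by
    apply Complex.ext <;> simp; ring
  rw [this]
  simp only [x]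
  ring

/-- `det² U` depends only on the Lagrangian subspace `U(ℝⁿ × {0})`. -/
theorem detSq_eq_of_map {n : ℕ} (l : Lambda n) (U : Matrix.unitaryGroup (Fin n) ℂ)
    (hU : (realSpace n).map (unitaryMap U) = l.1) :
    (U : Matrix (Fin n) (Fin n) ℂ).det ^ 2 = (Matrix.of fun i j =>
      2 * proj l (EuclideanSpace.single j 1) i - (1 : Matrix (Fin n) (Fin n) ℂ) i j).det := by
  have : (Matrix.of fun i j => 2 * proj l (EuclideanSpace.single j 1) i -
      (1 : Matrix (Fin n) (Fin n) ℂ) i j) =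
      (U : Matrix (Fin n) (Fin n) ℂ) * (U : Matrix (Fin n) (Fin n) ℂ).transpose := by
    ext i j
    exact proj_eq_of_map l U hU j i
  rw [this, Matrix.det_mul, Matrix.det_transpose, sq]

theorem continuous_proj {n : ℕ} : Continuous (proj : Lambda n → Cn n →L[ℝ] Cn n) :=
  continuous_induced_dom

theorem norm_det_unitary {n : ℕ} (U : Matrix.unitaryGroup (Fin n) ℂ) :
    ‖(U : Matrix (Fin n) (Fin n) ℂ).det‖ = 1 :=
  CStarRing.norm_of_mem_unitary (Matrix.det_of_mem_unitary U.2)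

theorem continuous_det_sq (n : ℕ) : Continuous fun l : Lambda n =>
    ((exists_unitary l).choose : Matrix (Fin n) (Fin n) ℂ).det ^ 2 := by
  have : (fun l : Lambda n => ((exists_unitary l).choose : Matrix (Fin n) (Fin n) ℂ).det ^ 2) =
      fun l => (Matrix.of fun i j => 2 * proj l (EuclideanSpace.single j 1) i -
        (1 : Matrix (Fin n) (Fin n) ℂ) i j).det := by
    funext l
    exact detSq_eq_of_map l _ (exists_unitary l).choose_spec
  rw [this]
  refine Continuous.matrix_det (continuous_matrix fun i j => ?_)
  have h : Continuous fun l : Lambda n => proj l (EuclideanSpace.single j 1) :=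
    continuous_proj.clm_apply continuous_const
  simp only [Matrix.of_apply]
  fun_prop

/-- The map `Det² : Λ(n) → S¹` induced by `det² : U(n) → S¹` on `Λ(n) = U(n)/O(n)`: its value at `l`
is `(det U)²` for any unitary `U` taking `ℝⁿ × {0}` to `l`. -/
def DetSq (n : ℕ) : C(Lambda n, Circle) where
  toFun l := ⟨((exists_unitary l).choose : Matrix (Fin n) (Fin n) ℂ).det ^ 2, by
    simp [Submonoid.unitSphere, norm_det_unitary]⟩
  continuous_toFun := continuous_induced_rng.mpr (continuous_det_sq n)

theorem DetSq_eq {n : ℕ} (l : Lambda n) (U : Matrix.unitaryGroup (Fin n) ℂ)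
    (hU : (realSpace n).map (unitaryMap U) = l.1) :
    (DetSq n l : ℂ) = (U : Matrix (Fin n) (Fin n) ℂ).det ^ 2 := by
  rw [detSq_eq_of_map l U hU]
  exact detSq_eq_of_map l _ (exists_unitary l).choose_spec

/-! ### The degree of a closed curve in the circle and the Maslov class -/

theorem existsUnique_degree (f : C(UnitAddCircle, Circle)) :
    ∃! d : ℤ, ∃ θ : C(ℝ, ℝ), (∀ t : ℝ, Circle.exp (θ t) = f (t : UnitAddCircle)) ∧
      θ 1 - θ 0 = 2 * Real.pi * d := by
  let g : C(ℝ, Circle) := ⟨fun t => f (t : UnitAddCircle), by fun_prop⟩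
  obtain ⟨e, he⟩ : ∃ e, Circle.exp e = g 0 := ⟨_, Circle.exp_arg (g 0)⟩
  obtain ⟨θ, ⟨h0, hθ⟩, -⟩ :=
    Circle.isCoveringMap_exp.existsUnique_continuousMap_lifts g 0 e he
  have hθ' : ∀ t, Circle.exp (θ t) = f (t : UnitAddCircle) := fun t => congrFun hθ t
  have h10 : ((1 : ℝ) : UnitAddCircle) = ((0 : ℝ) : UnitAddCircle) := by simp
  obtain ⟨d, hd⟩ := Circle.exp_eq_exp.mp ((hθ' 1).trans ((congrArg f h10).trans (hθ' 0).symm))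
  refine ⟨d, ⟨θ, hθ', by rw [hd]; ring⟩, ?_⟩
  rintro d' ⟨η, hη, hd'⟩
  obtain ⟨m, hm⟩ := Circle.exp_eq_exp.mp ((hθ' 0).trans (hη 0).symm)
  have heq : (fun t => θ t) = fun t => η t + m * (2 * Real.pi) := by
    refine Circle.isCoveringMap_exp.eq_of_comp_eq (by fun_prop) (by fun_prop) ?_ 0 hm
    funext t
    exact (hθ' t).trans ((hη t).symm.trans (Circle.exp_eq_exp.mpr ⟨-m, by push_cast; ring⟩))
  have h1 := congrFun heq 1
  have : (2 * Real.pi) * (d' : ℝ) = (2 * Real.pi) * (d : ℝ) := by linarith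
  exact_mod_cast mul_left_cancel₀ (by positivity) this

/-- The degree of a continuous map `S¹ → S¹`, where the source is `ℝ/ℤ`: the integer `d` such that
any continuous angle function `θ` of `f` increases by `2πd` over a period. -/
def degree (f : C(UnitAddCircle, Circle)) : ℤ := (existsUnique_degree f).choose

/-- The Maslov class `α(γ) = deg(Det² ∘ γ)`. -/
def maslov {n : ℕ} (γ : C(UnitAddCircle, Lambda n)) : ℤ := degree ((DetSq n).comp γ)

/-! ### The intersection index with `Λ^{≥1}(σ)` -/

/-- The stratum `Λᵏ(σ)` of Lagrangian subspaces with `dim (l ∩ σ) = k`. -/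
def stratum (n k : ℕ) : Set (Lambda n) := {l | Module.finrank ℝ ↥(l.1 ⊓ sigma n) = k}

/-- The cycle `Λ^{≥1}(σ)`, the union of the strata `Λᵏ(σ)` with `k ≥ 1`. -/
def maslovCycle (n : ℕ) : Set (Lambda n) := ⋃ k ≥ 1, stratum n k

/-- The vectors tangent at `l` to a subset `M` of `Λ(n)`: the velocities at time `0` of the curves
in `M` that pass through `l` at time `0`. -/
def tangentVectors {n : ℕ} (M : Set (Lambda n)) (l : Lambda n) : Set (Cn n →L[ℝ] Cn n) :=
  {w | ∃ c : ℝ → Lambda n, c 0 = l ∧ (∀ᶠ s in 𝓝 (0 : ℝ), c s ∈ M) ∧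
    HasDerivAt (fun s => proj (c s)) w 0}

/-- Multiplication by `e^{it}` as an element of the unitary group. -/
def phase (n : ℕ) (t : ℝ) : Matrix.unitaryGroup (Fin n) ℂ :=
  ⟨Matrix.scalar (Fin n) (Circle.exp t : ℂ), by
    rw [Matrix.mem_unitaryGroup_iff, Matrix.scalar_apply, Matrix.star_eq_conjTranspose,
      Matrix.diagonal_conjTranspose, Matrix.diagonal_mul_diagonal, ← Matrix.diagonal_one]
    congr 1
    funext i
    simp [← Complex.exp_conj, ← Complex.exp_add]⟩

/-- The infinitesimal generator at `l` of the flow `l ↦ e^{it} l` on `Λ(n)`.  Along `Λ¹(σ)` this is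
the transverse vector field that defines the positive side. -/
def flowField {n : ℕ} (l : Lambda n) : Cn n →L[ℝ] Cn n :=
  deriv (fun t => proj (unitaryAct (phase n t) l)) 0

/-- A smooth closed curve in `Λ(n)`. -/
def IsSmoothLoop {n : ℕ} (δ : C(UnitAddCircle, Lambda n)) : Prop :=
  ContDiff ℝ ∞ fun s : ℝ => proj (δ (s : UnitAddCircle))

/-- The velocity of a closed curve at the time `θ`. -/
def velocity {n : ℕ} (δ : C(UnitAddCircle, Lambda n)) (θ : UnitAddCircle) : Cn n →L[ℝ] Cn n :=
  deriv (fun s : ℝ => proj (δ (θ + (s : UnitAddCircle)))) 0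

/-- The times at which a closed curve meets `Λ^{≥1}(σ)`. -/
def crossings {n : ℕ} (δ : C(UnitAddCircle, Lambda n)) : Set UnitAddCircle :=
  {θ | δ θ ∈ maslovCycle n}

/-- A closed curve is transverse to `Λ^{≥1}(σ)` if it meets it only at points `l` of the principal
stratum `Λ¹(σ)`, and its velocity together with the tangent space of `Λ¹(σ)` spans that of `Λ(n)`
there. -/
def IsTransverse {n : ℕ} (δ : C(UnitAddCircle, Lambda n)) : Prop :=
  ∀ θ ∈ crossings δ, δ θ ∈ stratum n 1 ∧
    ∀ u ∈ tangentVectors Set.univ (δ θ), ∃ a : ℝ, ∃ w ∈ tangentVectors (stratum n 1) (δ θ),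
      u = a • velocity δ θ + w

open Classical in
/-- The sign of a crossing: `+1` if, modulo the tangent space of `Λ¹(σ)`, the velocity is a positive
multiple of the generator of the flow `l ↦ e^{it} l`, and `-1` if it is a negative multiple. -/
def crossingSign {n : ℕ} (δ : C(UnitAddCircle, Lambda n)) (θ : UnitAddCircle) : ℤ :=
  if ∃ a : ℝ, 0 < a ∧ ∃ w ∈ tangentVectors (stratum n 1) (δ θ),
      velocity δ θ = a • flowField (δ θ) + w then 1
  else if ∃ a : ℝ, a < 0 ∧ ∃ w ∈ tangentVectors (stratum n 1) (δ θ),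
      velocity δ θ = a • flowField (δ θ) + w then -1
  else 0

/-- The number of crossings of a closed curve with `Λ^{≥1}(σ)`, counted with signs. -/
def signedCount {n : ℕ} (δ : C(UnitAddCircle, Lambda n)) : ℤ :=
  ∑ᶠ θ ∈ crossings δ, crossingSign δ θ

/-- A transverse representative of a closed curve: a smooth closed curve transverse to `Λ^{≥1}(σ)`
and homotopic to the given one through closed curves. -/
def IsTransverseRep {n : ℕ} (γ δ : C(UnitAddCircle, Lambda n)) : Prop :=
  γ.Homotopic δ ∧ IsSmoothLoop δ ∧ IsTransverse δ

open Classical in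
/-- The intersection index `Ind(γ)` of a closed curve with `Λ^{≥1}(σ)`: the signed number of
crossings of a transverse representative. -/
def Ind {n : ℕ} (γ : C(UnitAddCircle, Lambda n)) : ℤ :=
  if h : ∃ δ, IsTransverseRep γ δ then signedCount h.choose else 0

end LagrangianGr

end

noncomputable section

namespace LagrangianGr

/-! ### The degree of closed curves in the circle -/

/-! A Lagrangian subspace l = Uℝⁿ is encoded by the symmetric unitary matrix S = UUᵀ (`souriau`): z
lies in l iff z = S z̄. Then det S = Det²(l), l meets σ iff det(1 + S) = 0, and the flow e^{it}
multiplies S by e^{2it}. The claim becomes that the degree of det S counts the signed passages of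
eigenvalues of S through -1.

Local theory. Charts by real symmetric matrices M turn l ∩ σ into ker M. At a kernel line spanned by
a real unit vector x, the tangent space of the principal stratum is given by x·Dx = 0.
`crossingForm` expresses this through the velocity of S, independently of the chart, and takes the
value 2 on the flow generator. Transversality therefore means that the form of the velocity is
nonzero, and the crossing sign is its sign. By `fderiv_det_apply` the derivative of det(1 + S) is a
nonzero multiple of the form, so crossings are isolated and finite in number.

The count (`IsTransverse.signedCount_eq_maslov`). No eigenvalue is followed. The disc automorphism
φ_s(z) = (s + z)/(1 + sz) is applied to S instead: for 0 ≤ s < 1, det φ_s(S) is a loop in the circle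
whose degree does not depend on s and is that of det S at s = 0. As s → 1, φ_s pushes everything
except -1 towards 1, so the loop concentrates at the crossings. It is compared with the product,
over the crossings θ of sign ε, of φ_s applied to the scalar loops -e^{2πiε(t-θ)}, each of degree ε.
For s close to 1 the two loops are never antipodal: near a crossing the first-order expansions
combine to a definite quadratic form, because the two crossing speeds have the same sign
(`eventually_mul_add_mul_ne_zero`). Hence their degrees agree.

Existence (`exists_isTransverseRep`). A rotation makes the curve avoid the cycle at all rational
times. It is cut at such times into pieces lying in single charts. There both end matrices are moved
into the convex cone of positive definite matrices, with eigenvalues crossing zero one at a time,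
and a chart is a vector space, so the new piece is homotopic to the old one.

Every transverse representative thus has count α, and α is a homotopy invariant; this gives both the
independence of the representative and the formula. -/

theorem degree_spec (f : C(UnitAddCircle, Circle)) :
    ∃ θ : C(ℝ, ℝ), (∀ t : ℝ, Circle.exp (θ t) = f (t : UnitAddCircle)) ∧
      θ 1 - θ 0 = 2 * Real.pi * degree f :=
  (existsUnique_degree f).choose_spec.1

theorem degree_eq_of_lift (f : C(UnitAddCircle, Circle)) (d : ℤ) (θ : C(ℝ, ℝ))
    (hθ : ∀ t : ℝ, Circle.exp (θ t) = f (t : UnitAddCircle))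
    (hd : θ 1 - θ 0 = 2 * Real.pi * d) : degree f = d :=
  ((existsUnique_degree f).choose_spec.2 d ⟨θ, hθ, hd⟩).symm

theorem degree_mul (f g : C(UnitAddCircle, Circle)) : degree (f * g) = degree f + degree g := by
  obtain ⟨θ, hθ, hd⟩ := degree_spec f
  obtain ⟨η, hη, he⟩ := degree_spec g
  refine degree_eq_of_lift _ _ (θ + η) (fun t => ?_) ?_
  · rw [ContinuousMap.add_apply, Circle.exp_add, hθ, hη, ContinuousMap.mul_apply]
  · push_cast
    rw [Pi.add_apply, Pi.add_apply]
    linarith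

theorem degree_one : degree (1 : C(UnitAddCircle, Circle)) = 0 :=
  degree_eq_of_lift _ _ 0 (fun t => by simp) (by simp)

theorem degree_prod {ι : Type*} (s : Finset ι) (f : ι → C(UnitAddCircle, Circle)) :
    degree (∏ i ∈ s, f i) = ∑ i ∈ s, degree (f i) := by
  classical
  induction s using Finset.induction_on with
  | empty => simpa using degree_one
  | insert a s ha ih => rw [Finset.prod_insert ha, Finset.sum_insert ha, degree_mul, ih]

/-- Two closed curves in the circle that are never antipodal have the same degree. -/
theorem degree_eq_of_forall_ne_neg (f g : C(UnitAddCircle, Circle)) (h : ∀ t, f t ≠ -g t) :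
    degree f = degree g := by
  obtain ⟨η, hη, he⟩ := degree_spec g
  -- The quotient f/g misses -1, so its principal argument is continuous and periodic; adding it to
  -- an angle function of g gives one of f with the same increase.
  have hs : ∀ t, ((f t / g t : Circle) : ℂ) ∈ Complex.slitPlane := by
    intro t
    rw [Complex.mem_slitPlane_iff_arg]
    refine ⟨fun ha => h t ?_, Circle.coe_ne_zero _⟩
    have h1 : Circle.exp (Complex.arg (f t / g t : Circle)) = f t / g t := Circle.exp_arg _
    have h2 : Circle.exp Real.pi = -1 := by ext; simp
    rw [ha, h2] at h1
    rw [← div_mul_cancel (f t) (g t), ← h1, neg_mul, one_mul]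
  have hc : Continuous fun t : ℝ =>
      Complex.arg ((f (t : UnitAddCircle) / g (t : UnitAddCircle) : Circle) : ℂ) := by
    rw [continuous_iff_continuousAt]
    intro t
    refine (Complex.continuousAt_arg (hs t)).comp (f := fun t : ℝ =>
      ((f (t : UnitAddCircle) / g (t : UnitAddCircle) : Circle) : ℂ)) ?_
    have : Continuous fun t : ℝ => f (t : UnitAddCircle) / g (t : UnitAddCircle) := by fun_prop
    exact (continuous_subtype_val.comp this).continuousAt
  refine degree_eq_of_lift _ _ (η + ⟨_, hc⟩) (fun t => ?_) ?_
  · simp only [ContinuousMap.add_apply, ContinuousMap.coe_mk, Circle.exp_add, hη, Circle.exp_arg]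
    simp
  · have h10 : ((1 : ℝ) : UnitAddCircle) = ((0 : ℝ) : UnitAddCircle) := by simp
    simp only [ContinuousMap.add_apply, ContinuousMap.coe_mk, h10]
    linarith

/-- Antipodal points are at distance 2, so loops at uniform distance less than 1 have equal degree,
and the degree is locally constant. -/
theorem degree_eq_of_continuous_family {X : Type*} [TopologicalSpace X] [PreconnectedSpace X]
    (F : X → C(UnitAddCircle, Circle)) (hF : Continuous F) (x y : X) :
    degree (F x) = degree (F y) := by
  have hl : IsLocallyConstant fun x => degree (F x) := by
    rw [IsLocallyConstant.iff_eventually_eq]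
    intro x
    have : ∀ᶠ y in 𝓝 x, dist (F y) (F x) < 1 :=
      hF.continuousAt.eventually (Metric.ball_mem_nhds _ one_pos)
    filter_upwards [this] with y hy
    refine degree_eq_of_forall_ne_neg _ _ fun t ht => ?_
    have h1 := (ContinuousMap.dist_apply_le_dist (f := F y) (g := F x) t).trans_lt hy
    rw [ht] at h1
    change dist ((-(F x) t : Circle) : ℂ) ((F x) t : ℂ) < 1 at h1
    rw [dist_eq_norm] at h1
    have h2 : ((-(F x) t : Circle) : ℂ) - (F x t : ℂ) = -2 * (F x t : ℂ) := by simp; ring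
    rw [h2, norm_mul, Circle.norm_coe] at h1
    norm_num at h1
  exact hl.apply_eq_of_isPreconnected isPreconnected_univ trivial trivial

theorem degree_eq_of_homotopic {f g : C(UnitAddCircle, Circle)} (h : f.Homotopic g) :
    degree f = degree g := by
  obtain ⟨H⟩ := h
  have := degree_eq_of_continuous_family (fun s => H.curry s) H.curry.continuous 0 1
  have h0 : H.curry 0 = f := by ext t; simp
  have h1 : H.curry 1 = g := by ext t; simp
  rwa [h0, h1] at this

theorem maslov_eq_of_homotopic {n : ℕ} {γ δ : C(UnitAddCircle, Lambda n)} (h : γ.Homotopic δ) :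
    maslov γ = maslov δ :=
  degree_eq_of_homotopic (ContinuousMap.Homotopic.comp (ContinuousMap.Homotopic.refl _) h)

/-! ### The symmetric unitary matrix of a Lagrangian subspace -/

open Matrix in
/-- The symmetric unitary matrix `S = U Uᵀ` of the Lagrangian subspace `U ℝⁿ`; the reflection in
the subspace is `z ↦ S z̄`. -/
def souriau {n : ℕ} (l : Lambda n) : Matrix (Fin n) (Fin n) ℂ :=
  Matrix.of fun i j => 2 * proj l (EuclideanSpace.single j 1) i - (1 : Matrix (Fin n) (Fin n) ℂ) i j

section

open Matrix

attribute [local instance] Matrix.linftyOpNormedRing Matrix.linftyOpNormedAlgebra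

variable {n : ℕ}

theorem souriau_eq_of_map (l : Lambda n) (U : Matrix.unitaryGroup (Fin n) ℂ)
    (hU : (realSpace n).map (unitaryMap U) = l.1) :
    souriau l = (U : Matrix (Fin n) (Fin n) ℂ) * (U : Matrix (Fin n) (Fin n) ℂ)ᵀ := by
  ext i j
  exact proj_eq_of_map l U hU j i

theorem souriau_transpose (l : Lambda n) : (souriau l)ᵀ = souriau l := by
  obtain ⟨U, hU⟩ := exists_unitary l
  rw [souriau_eq_of_map l U hU, transpose_mul, transpose_transpose]

theorem souriau_mem_unitary (l : Lambda n) : souriau l ∈ Matrix.unitaryGroup (Fin n) ℂ := by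
  obtain ⟨U, hU⟩ := exists_unitary l
  rw [souriau_eq_of_map l U hU]
  refine mul_mem U.2 ?_
  have h : star (U : Matrix (Fin n) (Fin n) ℂ) * U = 1 := Matrix.UnitaryGroup.star_mul_self U
  rw [Matrix.mem_unitaryGroup_iff]
  have := congrArg Matrix.transpose h
  rw [transpose_mul, transpose_one] at this
  exact this

theorem det_souriau (l : Lambda n) : (souriau l).det = DetSq n l := by
  obtain ⟨U, hU⟩ := exists_unitary l
  rw [DetSq_eq l U hU, detSq_eq_of_map l U hU]
  rfl

theorem unitaryMap_apply (U : Matrix.unitaryGroup (Fin n) ℂ) (z : Cn n) :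
    unitaryMap U z = WithLp.toLp 2 ((U : Matrix (Fin n) (Fin n) ℂ) *ᵥ z.ofLp) := rfl

/-- In the coordinates y = U*z the subspace is ℝⁿ with real orthogonal complement iℝⁿ, so the
projection is (y + ȳ)/2; and Uȳ = UUᵀ z̄. -/
theorem proj_apply (l : Lambda n) (z : Cn n) :
    proj l z = (1 / 2 : ℝ) • (z + WithLp.toLp 2 (souriau l *ᵥ star z.ofLp)) := by
  obtain ⟨U, hU⟩ := exists_unitary l
  set V : Matrix (Fin n) (Fin n) ℂ := (U : Matrix (Fin n) (Fin n) ℂ) with hV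
  have hVV : V * star V = 1 := Unitary.coe_mul_star_self U
  set y : Fin n → ℂ := star V *ᵥ z.ofLp with hy
  let x : Cn n := WithLp.toLp 2 fun k => ((y k).re : ℂ)
  let v : Cn n := WithLp.toLp 2 fun k => Complex.I * ((y k).im : ℂ)
  have hxv : z = unitaryMap U x + unitaryMap U v := by
    rw [← map_add, unitaryMap_apply]
    have : (x + v).ofLp = y := by
      ext k
      apply Complex.ext <;> simp [x, v]
    rw [this, hy, ← hV, mulVec_mulVec, hVV, one_mulVec]
  have hp : proj l z = unitaryMap U x := by
    apply Submodule.eq_starProjection_of_mem_of_inner_eq_zero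
    · rw [← hU]
      exact ⟨x, fun k => by simp [x], rfl⟩
    · intro w hw
      rw [← hU] at hw
      obtain ⟨u, hu, rfl⟩ := hw
      have h4 : ∀ a c : Cn n, inner ℝ a c = (inner ℂ a c).re := fun a c => by
        simp [PiLp.inner_apply]
      rw [hxv, add_sub_cancel_left, h4, inner_unitaryMap]
      have hu' : ∀ k, (u k).im = 0 := hu
      simp [PiLp.inner_apply, v, hu']
  have hs : souriau l *ᵥ star z.ofLp = V *ᵥ star y := by
    rw [souriau_eq_of_map l U hU, hy, star_mulVec, ← mulVec_mulVec, mulVec_transpose,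
      star_eq_conjTranspose, conjTranspose_conjTranspose]
  rw [hp, hs]
  have hz : z.ofLp = V *ᵥ y := by rw [hy, mulVec_mulVec, hVV, one_mulVec]
  ext k
  have : x.ofLp = (1 / 2 : ℝ) • (y + star y) := by
    ext k
    apply Complex.ext <;> simp [x]
    ring
  rw [unitaryMap_apply, ← hV, this, mulVec_smul, mulVec_add, ← hz]
  simp

theorem mem_iff_souriau (l : Lambda n) (z : Cn n) :
    z ∈ l.1 ↔ souriau l *ᵥ star z.ofLp = z.ofLp := by
  have h : z ∈ l.1 ↔ proj l z = z := Submodule.starProjection_eq_self_iff.symm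
  rw [h, proj_apply]
  constructor
  · intro h
    have h2 := congrArg (fun v : Cn n => (2 : ℝ) • v) h
    simp only [smul_smul] at h2
    norm_num [two_smul] at h2
    exact congrArg WithLp.ofLp h2
  · intro h
    rw [h, WithLp.toLp_ofLp, ← two_smul ℝ z, smul_smul]
    norm_num

theorem souriau_injective : Function.Injective (souriau : Lambda n → Matrix (Fin n) (Fin n) ℂ) := by
  intro l m h
  have : l.1 = m.1 := by
    ext z
    rw [mem_iff_souriau, mem_iff_souriau, h]
  cases l; cases m; simpa using this

/-- The vectors U e_j lie in l, and their conjugates form a complex basis, on which T is prescribed.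
-/
theorem souriau_eq_of_forall_mem (l : Lambda n) (T : Matrix (Fin n) (Fin n) ℂ)
    (hT : ∀ z ∈ l.1, T *ᵥ star z.ofLp = z.ofLp) : souriau l = T := by
  obtain ⟨U, hU⟩ := exists_unitary l
  set V : Matrix (Fin n) (Fin n) ℂ := (U : Matrix (Fin n) (Fin n) ℂ) with hV
  have hVV : V * star V = 1 := Unitary.coe_mul_star_self U
  have h1 : ∀ A : Matrix (Fin n) (Fin n) ℂ, (∀ z ∈ l.1, A *ᵥ star z.ofLp = z.ofLp) →
      A * Vᴴᵀ = V := by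
    intro A hA
    ext i j
    have hz : (WithLp.toLp 2 (V *ᵥ Pi.single j 1) : Cn n) ∈ l.1 := by
      rw [← hU]
      refine ⟨EuclideanSpace.single j 1, fun k => ?_, rfl⟩
      by_cases hk : k = j <;> simp [hk]
    have h2 := congrFun (hA _ hz) i
    rw [WithLp.ofLp_toLp, star_mulVec] at h2
    have h3 : star (Pi.single j (1 : ℂ) : Fin n → ℂ) = Pi.single j 1 := by
      ext k
      by_cases hk : k = j
      · subst hk; simp
      · simp [hk]
    rw [h3, ← mulVec_transpose, mulVec_mulVec] at h2
    simpa using h2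
  have h2 : Vᴴᵀ * Vᵀ = 1 := by
    rw [← transpose_mul, ← star_eq_conjTranspose, hVV, transpose_one]
  have h3 := (h1 (souriau l) fun z hz => (mem_iff_souriau l z).1 hz).trans (h1 T hT).symm
  calc souriau l = souriau l * Vᴴᵀ * Vᵀ := by rw [mul_assoc, h2, mul_one]
    _ = T * Vᴴᵀ * Vᵀ := by rw [h3]
    _ = T := by rw [mul_assoc, h2, mul_one]

/-! ### Passing between projections and symmetric unitary matrices -/

/-- The real linear operator `z ↦ T z̄`. -/
def antilinear (n : ℕ) : Matrix (Fin n) (Fin n) ℂ →L[ℝ] Cn n →L[ℝ] Cn n :=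
  LinearMap.toContinuousLinearMap
    { toFun := fun T => LinearMap.toContinuousLinearMap
        { toFun := fun z => WithLp.toLp 2 (T *ᵥ star z.ofLp)
          map_add' := fun z w => by simp [mulVec_add]
          map_smul' := fun c z => by
            ext i
            simp [mulVec, dotProduct, Finset.mul_sum, mul_left_comm] }
      map_add' := fun T T' => by ext z i; simp [add_mulVec]
      map_smul' := fun c T => by ext z i; simp [smul_mulVec] }

theorem antilinear_apply (T : Matrix (Fin n) (Fin n) ℂ) (z : Cn n) :
    antilinear n T z = WithLp.toLp 2 (T *ᵥ star z.ofLp) := rfl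

/-- The matrix of the complex values of a real linear operator on the standard basis. -/
def toMatrix (n : ℕ) : (Cn n →L[ℝ] Cn n) →L[ℝ] Matrix (Fin n) (Fin n) ℂ :=
  LinearMap.toContinuousLinearMap
    { toFun := fun P => Matrix.of fun i j => P (EuclideanSpace.single j 1) i
      map_add' := fun P Q => by ext i j; simp
      map_smul' := fun c P => by ext i j; simp }

theorem toMatrix_apply (P : Cn n →L[ℝ] Cn n) (i j : Fin n) :
    toMatrix n P i j = P (EuclideanSpace.single j 1) i := rfl

theorem toMatrix_antilinear (T : Matrix (Fin n) (Fin n) ℂ) : toMatrix n (antilinear n T) = T := by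
  ext i j
  have h3 : star (Pi.single j (1 : ℂ) : Fin n → ℂ) = Pi.single j 1 := by
    ext k
    by_cases hk : k = j
    · subst hk; simp
    · simp [hk]
  simp [toMatrix_apply, antilinear_apply, h3]

theorem souriau_eq_toMatrix (l : Lambda n) : souriau l = (2 : ℝ) • toMatrix n (proj l) - 1 := by
  ext i j
  simp [souriau, toMatrix_apply]

/-- Together with `souriau_eq_toMatrix` this makes `proj` and `souriau` affine functions of each
other, so continuity, smoothness and velocities can be computed on S. -/
theorem proj_eq_antilinear (l : Lambda n) : proj l =
    (1 / 2 : ℝ) • (ContinuousLinearMap.id ℝ (Cn n) + antilinear n (souriau l)) := by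
  ext1 z
  rw [proj_apply]
  rfl

theorem continuous_souriau : Continuous (souriau : Lambda n → Matrix (Fin n) (Fin n) ℂ) := by
  simp only [funext souriau_eq_toMatrix]
  have := continuous_proj (n := n)
  fun_prop

theorem continuous_of_souriau {X : Type*} [TopologicalSpace X] {f : X → Lambda n}
    (h : Continuous fun x => souriau (f x)) : Continuous f := by
  refine continuous_induced_rng.2 ?_
  simp only [Function.comp_def, proj_eq_antilinear]
  fun_prop

theorem contDiffAt_proj_iff {m : WithTop ℕ∞} {c : ℝ → Lambda n} {s : ℝ} :
    ContDiffAt ℝ m (fun s => proj (c s)) s ↔ ContDiffAt ℝ m (fun s => souriau (c s)) s := by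
  constructor <;> intro h
  · simp only [souriau_eq_toMatrix]
    fun_prop
  · simp only [proj_eq_antilinear]
    fun_prop

theorem hasDerivAt_souriau {c : ℝ → Lambda n} {s : ℝ} {w : Cn n →L[ℝ] Cn n}
    (h : HasDerivAt (fun s => proj (c s)) w s) :
    HasDerivAt (fun s => souriau (c s)) ((2 : ℝ) • toMatrix n w) s := by
  simp only [souriau_eq_toMatrix]
  exact (((toMatrix n).hasFDerivAt.comp_hasDerivAt s h).const_smul (2 : ℝ)).sub_const 1

theorem hasDerivAt_proj {c : ℝ → Lambda n} {s : ℝ} {W : Matrix (Fin n) (Fin n) ℂ}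
    (h : HasDerivAt (fun s => souriau (c s)) W s) :
    HasDerivAt (fun s => proj (c s)) ((1 / 2 : ℝ) • antilinear n W) s := by
  simp only [proj_eq_antilinear]
  exact (((antilinear n).hasFDerivAt.comp_hasDerivAt s h).const_add _).const_smul (1 / 2 : ℝ)

theorem souriau_unitaryAct (U : Matrix.unitaryGroup (Fin n) ℂ) (l : Lambda n) :
    souriau (unitaryAct U l) =
      (U : Matrix (Fin n) (Fin n) ℂ) * souriau l * (U : Matrix (Fin n) (Fin n) ℂ)ᵀ := by
  refine souriau_eq_of_forall_mem _ _ ?_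
  rintro _ ⟨z, hz, rfl⟩
  have hUU : star (U : Matrix (Fin n) (Fin n) ℂ) * U = 1 := Matrix.UnitaryGroup.star_mul_self U
  have h2 : (U : Matrix (Fin n) (Fin n) ℂ)ᵀ * (U : Matrix (Fin n) (Fin n) ℂ)ᴴᵀ = 1 := by
    rw [← transpose_mul, ← star_eq_conjTranspose, hUU, transpose_one]
  rw [unitaryMap_apply, WithLp.ofLp_toLp, star_mulVec, ← mulVec_transpose, mulVec_mulVec, mul_assoc,
    h2, mul_one, ← mulVec_mulVec, (mem_iff_souriau l z).1 hz]

theorem souriau_phase (t : ℝ) (l : Lambda n) :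
    souriau (unitaryAct (phase n t) l) = Complex.exp (2 * t * Complex.I) • souriau l := by
  have : ((phase n t : Matrix.unitaryGroup (Fin n) ℂ) : Matrix (Fin n) (Fin n) ℂ) =
      (Circle.exp t : ℂ) • 1 := by
    simp only [phase, scalar_apply, smul_one_eq_diagonal]
  rw [souriau_unitaryAct, this]
  simp only [transpose_smul, transpose_one, smul_mul_assoc, one_mul, mul_smul_comm, mul_one,
    smul_smul, Circle.coe_exp]
  rw [← Complex.exp_add]
  congr 2
  ring

end

/-! ### Charts by real symmetric matrices -/

section

open Matrix

attribute [local instance] Matrix.linftyOpNormedRing Matrix.linftyOpNormedAlgebra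

/-- The space of real symmetric matrices. -/
def symmMatrix (n : ℕ) : Submodule ℝ (Matrix (Fin n) (Fin n) ℝ) where
  carrier := {M | M.IsSymm}
  add_mem' := fun ha hb => ha.add hb
  zero_mem' := Matrix.isSymm_zero
  smul_mem' := fun c _ hM => hM.smul c

/-- A real matrix as a complex matrix. -/
def complexify (n : ℕ) : Matrix (Fin n) (Fin n) ℝ →L[ℝ] Matrix (Fin n) (Fin n) ℂ :=
  LinearMap.toContinuousLinearMap
    { toFun := fun M => M.map Complex.ofReal
      map_add' := fun M N => by ext i j; simp
      map_smul' := fun c M => by ext i j; simp }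

/-- The entrywise real part of a complex matrix. -/
def realPart (n : ℕ) : Matrix (Fin n) (Fin n) ℂ →L[ℝ] Matrix (Fin n) (Fin n) ℝ :=
  LinearMap.toContinuousLinearMap
    { toFun := fun M => M.map Complex.re
      map_add' := fun M N => by ext i j; simp
      map_smul' := fun c M => by ext i j; simp }

variable {n : ℕ}

theorem complexify_apply (M : Matrix (Fin n) (Fin n) ℝ) (i j : Fin n) :
    complexify n M i j = (M i j : ℂ) := rfl

theorem realPart_apply (M : Matrix (Fin n) (Fin n) ℂ) (i j : Fin n) :
    realPart n M i j = (M i j).re := rfl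

theorem realPart_complexify (M : Matrix (Fin n) (Fin n) ℝ) : realPart n (complexify n M) = M := by
  ext i j
  simp [realPart_apply, complexify_apply]

theorem det_complexify (M : Matrix (Fin n) (Fin n) ℝ) : (complexify n M).det = (M.det : ℂ) := by
  exact (RingHom.map_det Complex.ofRealHom M).symm

theorem complexify_mulVec (M : Matrix (Fin n) (Fin n) ℝ) (x : Fin n → ℝ) :
    complexify n M *ᵥ (fun i => (x i : ℂ)) = fun i => ((M *ᵥ x) i : ℂ) := by
  ext i
  simp [complexify_apply, mulVec, dotProduct]

/-- The non-real parameter `a + i` of a chart. -/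
def param (a : ℝ) : ℂ := a + Complex.I

theorem param_sub_star (a : ℝ) : param a - star (param a) = 2 * Complex.I := by
  apply Complex.ext <;> simp [param]
  norm_num

/-- The parametrization `x ↦ M x + i (x - a M x)` of a Lagrangian subspace. -/
def chartMap (a : ℝ) (M : Matrix (Fin n) (Fin n) ℝ) : (Fin n → ℝ) →ₗ[ℝ] Cn n where
  toFun x := WithLp.toLp 2 fun i => ⟨(M *ᵥ x) i, x i - a * (M *ᵥ x) i⟩
  map_add' x y := by
    ext i
    apply Complex.ext <;> simp [mulVec_add]
    ring
  map_smul' c x := by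
    ext i
    apply Complex.ext <;> simp [mulVec_smul]
    ring

theorem chartMap_re (a : ℝ) (M : Matrix (Fin n) (Fin n) ℝ) (x : Fin n → ℝ) (i : Fin n) :
    (chartMap a M x i).re = (M *ᵥ x) i := rfl

theorem chartMap_im (a : ℝ) (M : Matrix (Fin n) (Fin n) ℝ) (x : Fin n → ℝ) (i : Fin n) :
    (chartMap a M x i).im = x i - a * (M *ᵥ x) i := rfl

theorem chartMap_injective (a : ℝ) (M : Matrix (Fin n) (Fin n) ℝ) :
    Function.Injective (chartMap a M) := by
  rw [← LinearMap.ker_eq_bot, LinearMap.ker_eq_bot']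
  intro x hx
  ext i
  have h1 := chartMap_re a M x i
  have h2 := chartMap_im a M x i
  rw [hx] at h1 h2
  simp only [PiLp.zero_apply, Complex.zero_re, Complex.zero_im] at h1 h2
  rw [← h1] at h2
  simpa using h2.symm

/-- The Lagrangian subspace with coordinate `M` in the chart with parameter `a`. -/
def chart (a : ℝ) (M : symmMatrix n) : Lambda n :=
  ⟨LinearMap.range (chartMap a M.1), by
    refine ⟨?_, ?_⟩
    · rw [LinearMap.finrank_range_of_inj (chartMap_injective a M.1)]
      simp
    · rintro _ ⟨x, rfl⟩ _ ⟨y, rfl⟩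
      have h1 : omega (chartMap a M.1 x) (chartMap a M.1 y) = x ⬝ᵥ (M.1 *ᵥ y) - (M.1 *ᵥ x) ⬝ᵥ y := by
        simp only [omega, chartMap_re, chartMap_im, dotProduct, ← Finset.sum_sub_distrib]
        refine Finset.sum_congr rfl fun j _ => ?_
        ring
      have h2 : (M.1)ᵀ = M.1 := M.2
      rw [h1, dotProduct_mulVec, ← mulVec_transpose, h2, sub_self]⟩

/-- With w = `param a`, the vectors of the subspace are i(1 - wM)x for real x, with conjugates -i(1
- w̄M)x. The relation z = S z̄ then says that S is a Cayley transform of M. -/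
theorem souriau_chart_mul (a : ℝ) (M : symmMatrix n) :
    souriau (chart a M) * (1 - star (param a) • complexify n M.1) =
      -(1 - param a • complexify n M.1) := by
  have key : ∀ x : Fin n → ℝ, (chartMap a M.1 x).ofLp =
      (Complex.I • (1 - param a • complexify n M.1)) *ᵥ (fun i => (x i : ℂ)) := by
    intro x
    rw [smul_mulVec, sub_mulVec, smul_mulVec, complexify_mulVec, one_mulVec]
    ext i
    apply Complex.ext <;> simp [chartMap_re, chartMap_im, param]
  have key2 : ∀ x : Fin n → ℝ, star (chartMap a M.1 x).ofLp =
      (-Complex.I • (1 - star (param a) • complexify n M.1)) *ᵥ (fun i => (x i : ℂ)) := by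
    intro x
    rw [smul_mulVec, sub_mulVec, smul_mulVec, complexify_mulVec, one_mulVec]
    ext i
    apply Complex.ext <;> simp [chartMap_re, chartMap_im, param]
  ext i j
  have h := (mem_iff_souriau (chart a M) _).1 ⟨Pi.single j 1, rfl⟩
  have h3 : (fun i => ((Pi.single j (1 : ℝ) : Fin n → ℝ) i : ℂ)) = Pi.single j 1 := by
    ext k
    by_cases hk : k = j
    · subst hk; simp
    · simp [hk]
  rw [key2, key, h3, smul_mulVec, mulVec_smul, smul_mulVec, mulVec_mulVec] at h
  have h4 := congrFun h i
  simp only [mulVec_single_one, Pi.smul_apply, smul_eq_mul, col_apply] at h4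
  have h5 := mul_left_cancel₀ Complex.I_ne_zero
    ((neg_mul Complex.I _).symm.trans h4 |> fun h => (mul_neg _ _).trans h)
  rw [neg_apply, ← h5, neg_neg]

theorem chart_mul_eq (a : ℝ) (M : symmMatrix n) :
    (param a • 1 + star (param a) • souriau (chart a M)) *
      (1 - star (param a) • complexify n M.1) = (2 * Complex.I) • 1 := by
  rw [add_mul, smul_mul_assoc, smul_mul_assoc, souriau_chart_mul, one_mul, ← param_sub_star a]
  simp only [smul_sub, smul_neg, smul_smul, sub_smul, mul_comm (param a)]
  abel

theorem mul_chart_eq (a : ℝ) (M : symmMatrix n) :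
    (1 - star (param a) • complexify n M.1) *
      (param a • 1 + star (param a) • souriau (chart a M)) = (2 * Complex.I) • 1 := by
  have h2 : (2 * Complex.I : ℂ) ≠ 0 := by simp
  have h : ((2 * Complex.I)⁻¹ • (param a • 1 + star (param a) • souriau (chart a M))) *
      (1 - star (param a) • complexify n M.1) = 1 := by
    rw [smul_mul_assoc, chart_mul_eq, smul_smul, inv_mul_cancel₀ h2, one_smul]
  have h' := mul_eq_one_comm.1 h
  rw [mul_smul_comm] at h'
  have h3 := congrArg ((2 * Complex.I : ℂ) • ·) h'
  simpa only [smul_smul, mul_inv_cancel₀ h2, one_smul] using h3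

theorem isUnit_chart_denom (a : ℝ) (M : symmMatrix n) :
    IsUnit (1 - star (param a) • complexify n M.1) := by
  have h2 : (2 * Complex.I : ℂ) ≠ 0 := by simp
  refine IsUnit.of_mul_eq_one ((2 * Complex.I)⁻¹ • (param a • 1 +
    star (param a) • souriau (chart a M))) ?_
  rw [mul_smul_comm, mul_chart_eq, smul_smul, inv_mul_cancel₀ h2, one_smul]

/-- The Cayley transform solved for M. Its left factor is invertible on the chart, so 1 + S and M
have the same kernel there. -/
theorem chart_domain_mul (a : ℝ) (M : symmMatrix n) :
    (param a • 1 + star (param a) • souriau (chart a M)) * complexify n M.1 =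
      1 + souriau (chart a M) := by
  have h := souriau_chart_mul a M
  rw [mul_sub, mul_one, mul_smul_comm, neg_sub] at h
  rw [add_mul, smul_mul_assoc, smul_mul_assoc, one_mul, ← sub_eq_zero]
  rw [← sub_eq_zero] at h
  rw [← neg_eq_zero, ← h]
  abel

theorem det_chart_domain_ne_zero (a : ℝ) (M : symmMatrix n) :
    (param a • 1 + star (param a) • souriau (chart a M)).det ≠ 0 := by
  intro h
  have h1 := congrArg det (chart_mul_eq a M)
  rw [det_mul, h, zero_mul, det_smul, det_one, mul_one] at h1
  exact pow_ne_zero _ (by simp) h1.symm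

/-- A chart contains every Lagrangian subspace with `a + i + (a - i) S` invertible. -/
theorem exists_eq_chart (a : ℝ) (l : Lambda n)
    (h : (param a • 1 + star (param a) • souriau l).det ≠ 0) :
    ∃ h : (realPart n ((param a • 1 + star (param a) • souriau l)⁻¹ * (1 + souriau l))) ∈
        symmMatrix n, l = chart a ⟨_, h⟩ := by
  set S := souriau l with hS
  set w := param a
  set B := w • (1 : Matrix (Fin n) (Fin n) ℂ) + star w • S with hB
  have hu : IsUnit B.det := isUnit_iff_ne_zero.2 h
  have hST : Sᵀ = S := souriau_transpose l
  have hcomm : Commute B (1 + S) :=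
    ((Commute.one_left _).smul_left w).add_left
      (((Commute.one_right S).add_right (Commute.refl S)).smul_left _)
  set M := B⁻¹ * (1 + S) with hM
  have hBM : B * M = 1 + S := mul_nonsing_inv_cancel_left _ _ hu
  have hMT : Mᵀ = M := by
    have hBT : Bᵀ = B := by rw [hB]; simp [hST]
    rw [hM, transpose_mul, transpose_nonsing_inv, hBT, transpose_add, transpose_one, hST]
    calc (1 + S) * B⁻¹ = B⁻¹ * (B * (1 + S)) * B⁻¹ := by
          rw [nonsing_inv_mul_cancel_left _ _ hu]
      _ = B⁻¹ * (1 + S) := by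
          rw [hcomm.eq, ← mul_assoc, mul_assoc, mul_nonsing_inv _ hu, mul_one]
  have hSS : S * star S = 1 := (Matrix.mem_unitaryGroup_iff).1 (souriau_mem_unitary l)
  -- Since S* = S⁻¹, the adjoint of the equation BM = 1 + S shows that M is Hermitian. Being
  -- symmetric as well, M is real.
  have hMc : star M = M := by
    have h1 : star M * star B = 1 + star S := by rw [← star_mul, hBM, star_add, star_one]
    have h2 : star B * S = B := by
      have := mul_eq_one_comm.1 hSS
      rw [hB, star_add, star_smul, star_smul, star_star, star_one, add_mul, smul_mul_assoc,
        smul_mul_assoc, this, one_mul, add_comm]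
    have h3 : star M * B = 1 + S := by
      have := mul_eq_one_comm.1 hSS
      rw [← h2, ← mul_assoc, h1, add_mul, this, one_mul, add_comm]
    have h4 : M * B = 1 + S := by
      have := congrArg transpose hBM
      have hBT : Bᵀ = B := by rw [hB]; simp [hST]
      rwa [transpose_mul, hMT, hBT, transpose_add, transpose_one, hST] at this
    exact mul_left_injective_of_inv B B⁻¹ (mul_nonsing_inv _ hu) (h3.trans h4.symm)
  have hMr : complexify n (realPart n M) = M := by
    ext i j
    have h1 := congrFun (congrFun hMc i) j
    have h2 := congrFun (congrFun hMT i) j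
    rw [star_apply] at h1
    rw [transpose_apply] at h2
    rw [h2] at h1
    exact Complex.conj_eq_iff_re.1 h1
  have hsymm : realPart n M ∈ symmMatrix n := by
    ext i j
    have h2 := congrFun (congrFun hMT i) j
    rw [transpose_apply] at h2 ⊢
    rw [realPart_apply, realPart_apply, h2]
  refine ⟨hsymm, souriau_injective ?_⟩
  have h1 := souriau_chart_mul a ⟨_, hsymm⟩
  have h2 : S * (1 - star (param a) • complexify n (realPart n M)) =
      -(1 - param a • complexify n (realPart n M)) := by
    rw [hMr, mul_sub, mul_one, mul_smul_comm, neg_sub]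
    have h3 := hBM
    rw [hB, add_mul, smul_mul_assoc, smul_mul_assoc, one_mul, ← sub_eq_zero] at h3
    rw [← sub_eq_zero, ← neg_eq_zero, ← h3]
    abel
  exact (isUnit_chart_denom a ⟨_, hsymm⟩).mul_left_injective (h2.trans h1.symm)

/-- The matrix is a(1 + S) + i(1 - S). Its determinant is a polynomial in a, nonzero because at the
complex value a = i it is det(2i), so only finitely many real a fail. -/
theorem exists_det_chart_domain_ne_zero (l : Lambda n) :
    ∃ a : ℝ, (param a • 1 + star (param a) • souriau l).det ≠ 0 := by
  set S := souriau l
  let p : Polynomial ℂ := ((Polynomial.X : Polynomial ℂ) • (1 + S).map Polynomial.C +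
    (Complex.I • (1 - S)).map Polynomial.C).det
  have hp : ∀ z : ℂ, p.eval z = (z • (1 + S) + Complex.I • (1 - S)).det := by
    intro z
    rw [← Polynomial.coe_evalRingHom, RingHom.map_det]
    congr 1
    ext i j
    simp
    ring
  have hne : p ≠ 0 := by
    intro h0
    have := hp Complex.I
    rw [h0, Polynomial.eval_zero] at this
    have h1 : Complex.I • (1 + S) + Complex.I • (1 - S) = (2 * Complex.I) • 1 := by
      rw [mul_comm, mul_smul, two_smul, ← smul_add]
      congr 1
      abel
    rw [h1, det_smul, det_one, mul_one] at this
    exact pow_ne_zero _ (by simp) this.symm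
  have hfin : {z : ℂ | Polynomial.IsRoot p z}.Finite := Polynomial.finite_setOfPred_isRoot hne
  obtain ⟨a, ha⟩ := (hfin.preimage (f := Complex.ofReal)
    Complex.ofReal_injective.injOn).infinite_compl.nonempty
  refine ⟨a, fun h => ha ?_⟩
  simp only [Set.mem_preimage, Set.mem_ofPred_eq, Polynomial.IsRoot.def, hp]
  rw [← h]
  congr 1
  have : star (param a) = a - Complex.I := by
    apply Complex.ext <;> simp [param]
  rw [this, param]
  simp only [smul_add, smul_sub, add_smul, sub_smul]
  abel

theorem exists_chart (l : Lambda n) : ∃ (a : ℝ) (M : symmMatrix n), l = chart a M := by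
  obtain ⟨a, ha⟩ := exists_det_chart_domain_ne_zero l
  obtain ⟨h, h'⟩ := exists_eq_chart a l ha
  exact ⟨a, _, h'⟩

/-- The real part of the vector with parameter x is Mx for every a, so all charts describe the
strata by the corank of M. -/
theorem chart_inf_sigma (a : ℝ) (M : symmMatrix n) :
    (chart a M).1 ⊓ sigma n = (LinearMap.ker M.1.mulVecLin).map (chartMap a M.1) := by
  ext z
  constructor
  · rintro ⟨⟨x, rfl⟩, hx⟩
    refine ⟨x, ?_, rfl⟩
    rw [SetLike.mem_coe, LinearMap.mem_ker, mulVecLin_apply]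
    ext i
    exact hx i
  · rintro ⟨x, hx, rfl⟩
    refine ⟨⟨x, rfl⟩, fun i => ?_⟩
    rw [SetLike.mem_coe, LinearMap.mem_ker, mulVecLin_apply] at hx
    rw [chartMap_re, hx, Pi.zero_apply]

theorem chart_mem_stratum_iff (a : ℝ) (M : symmMatrix n) (k : ℕ) :
    chart a M ∈ stratum n k ↔ Module.finrank ℝ (LinearMap.ker M.1.mulVecLin) = k := by
  rw [stratum, Set.mem_ofPred_eq, chart_inf_sigma]
  rw [← (Submodule.equivMapOfInjective _ (chartMap_injective a M.1) _).finrank_eq]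

theorem mem_maslovCycle_iff (l : Lambda n) : l ∈ maslovCycle n ↔ (1 + souriau l).det = 0 := by
  obtain ⟨a, M, rfl⟩ := exists_chart l
  rw [← chart_domain_mul, det_mul, mul_eq_zero, or_iff_right (det_chart_domain_ne_zero a M),
    det_complexify, Complex.ofReal_eq_zero, ← exists_mulVec_eq_zero_iff]
  simp only [maslovCycle, Set.mem_iUnion, chart_mem_stratum_iff, exists_prop, ge_iff_le,
    exists_eq_right']
  rw [Nat.one_le_iff_ne_zero, ne_eq, Submodule.finrank_eq_zero, ← ne_eq, Submodule.ne_bot_iff]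
  simp only [LinearMap.mem_ker, mulVecLin_apply]
  exact ⟨fun ⟨x, h1, h2⟩ => ⟨x, h2, h1⟩, fun ⟨x, h1, h2⟩ => ⟨x, h2, h1⟩⟩

theorem chart_mem_maslovCycle_iff (a : ℝ) (M : symmMatrix n) :
    chart a M ∈ maslovCycle n ↔ M.1.det = 0 := by
  rw [mem_maslovCycle_iff, ← chart_domain_mul, det_mul, mul_eq_zero,
    or_iff_right (det_chart_domain_ne_zero a M), det_complexify, Complex.ofReal_eq_zero]

theorem souriau_chart (a : ℝ) (M : symmMatrix n) :
    souriau (chart a M) = -((1 - param a • complexify n M.1) *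
      (1 - star (param a) • complexify n M.1)⁻¹) := by
  have hu := (isUnit_iff_isUnit_det _).1 (isUnit_chart_denom a M)
  rw [← neg_mul, ← souriau_chart_mul, mul_nonsing_inv_cancel_right _ _ hu]

theorem contDiffAt_matrix_inv {A : Matrix (Fin n) (Fin n) ℂ} (hA : A.det ≠ 0)
    {m : WithTop ℕ∞} :
    ContDiffAt ℝ m (fun B : Matrix (Fin n) (Fin n) ℂ => B⁻¹) A := by
  have hu : IsUnit A := (isUnit_iff_isUnit_det _).2 (isUnit_iff_ne_zero.2 hA)
  obtain ⟨u, rfl⟩ := hu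
  simp only [nonsing_inv_eq_ringInverse]
  exact contDiffAt_ringInverse ℝ u

theorem contDiffAt_chart_formula (a : ℝ) (M : symmMatrix n) {m : WithTop ℕ∞} :
    ContDiffAt ℝ m (fun A : Matrix (Fin n) (Fin n) ℝ => -((1 - param a • complexify n A) *
      (1 - star (param a) • complexify n A)⁻¹)) M.1 := by
  have hu := (isUnit_iff_isUnit_det _).1 (isUnit_chart_denom a M)
  have h1 : ContDiffAt ℝ m (fun A => complexify n A) M.1 := (complexify n).contDiff.contDiffAt
  refine ((contDiffAt_const.sub (h1.const_smul (param a))).mul ?_).neg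
  exact (contDiffAt_matrix_inv hu.ne_zero).comp M.1
    (contDiffAt_const.sub (h1.const_smul (star (param a))))

theorem contDiffAt_souriau_chart (a : ℝ) {E : Type*} [NormedAddCommGroup E] [NormedSpace ℝ E]
    {m : WithTop ℕ∞} {f : E → symmMatrix n}
    {x : E} (hf : ContDiffAt ℝ m (fun y => (f y).1) x) :
    ContDiffAt ℝ m (fun y => souriau (chart a (f y))) x := by
  simp only [souriau_chart]
  exact ContDiffAt.comp (f := fun y => (f y).1) x (contDiffAt_chart_formula a (f x)) hf

theorem continuous_chart (a : ℝ) : Continuous (chart a : symmMatrix n → Lambda n) := by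
  refine continuous_of_souriau (continuous_iff_continuousAt.2 fun M => ?_)
  exact (contDiffAt_souriau_chart a (m := 0) (f := id)
    (symmMatrix n).subtypeL.contDiff.contDiffAt).continuousAt

end

/-! ### The derivative of the determinant at a matrix of corank one -/

section

open Matrix

attribute [local instance] Matrix.linftyOpNormedRing Matrix.linftyOpNormedAlgebra

variable {n : ℕ}

theorem contDiff_det {m : WithTop ℕ∞} :
    ContDiff ℝ m (fun A : Matrix (Fin n) (Fin n) ℂ => A.det) := by
  simp only [det_apply]
  refine ContDiff.sum fun σ _ => ContDiff.const_smul _ (contDiff_prod fun i _ => ?_)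
  exact (LinearMap.toContinuousLinearMap (Matrix.entryLinearMap ℝ ℂ (σ i) i)).contDiff

theorem det_sub_vecMulVec {B : Matrix (Fin n) (Fin n) ℂ} (hB : IsUnit B.det) (x : Fin n → ℂ) :
    (B - vecMulVec x x).det = B.det * (1 - x ⬝ᵥ (B⁻¹ *ᵥ x)) := by
  have h := det_add_replicateCol_mul_replicateRow (ι := Unit) hB (-x) x
  have h1 : replicateCol Unit (-x) * replicateRow Unit x = -vecMulVec x x := by
    ext i j
    simp [mul_apply, vecMulVec_apply]
  rw [h1, ← sub_eq_add_neg] at h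
  have h2 : replicateRow Unit x * B⁻¹ * replicateCol Unit (-x) =
      Matrix.of fun _ _ => -(x ⬝ᵥ (B⁻¹ *ᵥ x)) := by
    ext i j
    rw [← replicateRow_vecMul, replicateRow_mul_replicateCol_apply, dotProduct_neg,
      ← dotProduct_mulVec, of_apply]
  rw [h, h2, det_unique (n := Unit)]
  simp [sub_eq_add_neg]

/-- The derivative of the determinant at a matrix with one-dimensional kernel. -/
theorem fderiv_det_apply {N : Matrix (Fin n) (Fin n) ℂ} {x : Fin n → ℂ} (hNx : N *ᵥ x = 0)
    (hxN : x ᵥ* N = 0) (hx : x ⬝ᵥ x = 1) (hdet : (N + vecMulVec x x).det ≠ 0)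
    (E : Matrix (Fin n) (Fin n) ℂ) :
    fderiv ℝ (fun A : Matrix (Fin n) (Fin n) ℂ => A.det) N E =
      (N + vecMulVec x x).det * (x ⬝ᵥ (E *ᵥ x)) := by
  set P := vecMulVec x x with hP
  set N' := N + P with hN'
  have hu : IsUnit N'.det := isUnit_iff_ne_zero.2 hdet
  set G := N'⁻¹ * E with hG
  have hN'P : N' * P = P := by
    rw [hN', add_mul, hP, mul_vecMulVec, hNx, vecMulVec_mul_vecMulVec, hx]
    simp
  have hxN' : x ᵥ* N' = x := by
    rw [hN', vecMul_add, hxN, hP, vecMul_vecMulVec, hx, zero_add, one_smul]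
  have hline : HasDerivAt (fun t : ℝ => N + t • E) E 0 := by
    simpa only [id_eq, one_smul] using! ((hasDerivAt_id (0 : ℝ)).smul_const E).const_add N
  have h1 : HasDerivAt (fun t : ℝ => (N + t • E).det)
      (fderiv ℝ (fun A : Matrix (Fin n) (Fin n) ℂ => A.det) N E) 0 := by
    have hd : HasFDerivAt (fun A : Matrix (Fin n) (Fin n) ℂ => A.det)
        (fderiv ℝ (fun A : Matrix (Fin n) (Fin n) ℂ => A.det) N) (N + (0 : ℝ) • E) := by
      rw [zero_smul, add_zero]
      exact ((contDiff_det (m := 1)).differentiable one_ne_zero N).hasFDerivAt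
    exact hd.comp_hasDerivAt (0 : ℝ) hline
  have hB : HasDerivAt (fun t : ℝ => 1 + t • G) G 0 := by
    simpa only [id_eq, one_smul] using! ((hasDerivAt_id (0 : ℝ)).smul_const G).const_add 1
  have hB0 : (1 + (0 : ℝ) • G : Matrix (Fin n) (Fin n) ℂ) = 1 := by rw [zero_smul, add_zero]
  have hinv : HasDerivAt (fun t : ℝ => (1 + t • G)⁻¹) (-G) 0 := by
    have h := hasFDerivAt_ringInverse (𝕜 := ℝ) (1 : (Matrix (Fin n) (Fin n) ℂ)ˣ)
    have h' : HasFDerivAt (Ring.inverse : Matrix (Fin n) (Fin n) ℂ → _)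
        (-ContinuousLinearMap.mulLeftRight ℝ (Matrix (Fin n) (Fin n) ℂ)
          ↑(1 : (Matrix (Fin n) (Fin n) ℂ)ˣ)⁻¹ ↑(1 : (Matrix (Fin n) (Fin n) ℂ)ˣ)⁻¹)
        (1 + (0 : ℝ) • G) := by
      rw [hB0]; exact h
    simp only [nonsing_inv_eq_ringInverse]
    simpa using! h'.comp_hasDerivAt (0 : ℝ) hB
  have hdB : DifferentiableAt ℝ (fun t : ℝ => (1 + t • G).det) 0 :=
    ((contDiff_det (m := 1)).differentiable one_ne_zero _).comp (0 : ℝ) hB.differentiableAt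
  have hev : ∀ᶠ t : ℝ in 𝓝 0, (1 + t • G).det ≠ 0 := by
    refine hdB.continuousAt.eventually_ne ?_
    rw [hB0, det_one]
    exact one_ne_zero
  have hform : HasDerivAt (fun t : ℝ => 1 - x ⬝ᵥ ((1 + t • G)⁻¹ *ᵥ x)) (x ⬝ᵥ (G *ᵥ x)) 0 := by
    let ℓ : Matrix (Fin n) (Fin n) ℂ →L[ℝ] ℂ := LinearMap.toContinuousLinearMap
      { toFun := fun A => x ⬝ᵥ (A *ᵥ x)
        map_add' := fun A B => by rw [add_mulVec, dotProduct_add]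
        map_smul' := fun c A => by rw [smul_mulVec, dotProduct_smul, RingHom.id_apply] }
    have := (ℓ.hasFDerivAt.comp_hasDerivAt (0 : ℝ) hinv).const_sub 1
    have e : -ℓ (-G) = ℓ G := by rw [ℓ.map_neg G, neg_neg]
    exact this.congr_deriv e
  -- The factor 1 - x·(1 + tG)⁻¹x vanishes at t = 0 because x·x = 1, so only its derivative x·Gx
  -- survives in the product rule.
  have h2 := (hdB.hasDerivAt.mul hform).const_mul N'.det
  have heq : (fun t : ℝ => (N + t • E).det) =ᶠ[𝓝 0]
      fun t => N'.det * ((1 + t • G).det * (1 - x ⬝ᵥ ((1 + t • G)⁻¹ *ᵥ x))) := by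
    filter_upwards [hev] with t ht
    -- From N'P = P follows N = N'(1 - P), so the degeneration is split off as a rank-one change of
    -- the invertible matrix 1 + tG.
    have : N + t • E = N' * (1 + t • G - P) := by
      rw [mul_sub, mul_add, mul_one, mul_smul_comm, hN'P, hG, mul_nonsing_inv_cancel_left _ _ hu]
      rw [hN']
      abel
    rw [this, det_mul, det_sub_vecMulVec (isUnit_iff_ne_zero.2 ht)]
  have h3 := h1.unique (h2.congr_of_eventuallyEq heq)
  rw [h3]
  simp only [zero_smul, add_zero, inv_one, one_mulVec, hx, sub_self, mul_zero, det_one, one_mul,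
    zero_add]
  congr 1
  -- Here x·Gx = x·Ex, because x is fixed by N' from the left and hence by its inverse.
  rw [dotProduct_mulVec, dotProduct_mulVec, hG, ← vecMul_vecMul]
  congr 2
  conv_lhs => rw [← hxN']
  rw [vecMul_vecMul, mul_nonsing_inv _ hu, vecMul_one]

end

/-! ### Tangent vectors and the crossing form -/

section

open Matrix

attribute [local instance] Matrix.linftyOpNormedRing Matrix.linftyOpNormedAlgebra

variable {n : ℕ}

/-- A real vector as a complex vector. -/
def cvec (x : Fin n → ℝ) : Fin n → ℂ := fun i => (x i : ℂ)

theorem complexify_mulVec_cvec (M : Matrix (Fin n) (Fin n) ℝ) (x : Fin n → ℝ) :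
    complexify n M *ᵥ cvec x = cvec (M *ᵥ x) := complexify_mulVec M x

theorem cvec_dotProduct (x y : Fin n → ℝ) : cvec x ⬝ᵥ cvec y = ((x ⬝ᵥ y : ℝ) : ℂ) := by
  simp [cvec, dotProduct]

theorem complexify_vecMulVec (x y : Fin n → ℝ) :
    complexify n (vecMulVec x y) = vecMulVec (cvec x) (cvec y) := by
  ext i j
  simp [complexify_apply, vecMulVec_apply, cvec]

/-- A unit vector spanning the kernel of a real symmetric matrix. -/
structure IsKernelVector (M : Matrix (Fin n) (Fin n) ℝ) (x : Fin n → ℝ) : Prop where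
  mulVec_eq : M *ᵥ x = 0
  dotProduct_eq : x ⬝ᵥ x = 1
  det_ne : (M + vecMulVec x x).det ≠ 0

/-- Corank one is recorded as invertibility of M + xxᵀ, the form that the derivative of the
determinant uses. Pairing (M + xxᵀ)v = 0 with x gives x·v = 0, hence Mv = 0, and v is a multiple of
x orthogonal to x. -/
theorem exists_isKernelVector {M : Matrix (Fin n) (Fin n) ℝ} (hM : M.IsSymm)
    (h : Module.finrank ℝ (LinearMap.ker M.mulVecLin) = 1) : ∃ x, IsKernelVector M x := by
  obtain ⟨⟨y, hy⟩, hy0, hspan⟩ := finrank_eq_one_iff'.1 h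
  have hMy : M *ᵥ y = 0 := hy
  have hyn : y ≠ 0 := fun h0 => hy0 (by simpa using h0)
  have hpos : 0 < y ⬝ᵥ y := by
    have h1 : y ⬝ᵥ y ≠ 0 := fun h0 => hyn (dotProduct_self_eq_zero.1 h0)
    exact lt_of_le_of_ne (Finset.sum_nonneg fun i _ => mul_self_nonneg _) h1.symm
  set r := Real.sqrt (y ⬝ᵥ y)
  have hr : r ≠ 0 := (Real.sqrt_pos.2 hpos).ne'
  have hrr : r * r = y ⬝ᵥ y := Real.mul_self_sqrt hpos.le
  have hx1 : (r⁻¹ • y) ⬝ᵥ (r⁻¹ • y) = 1 := by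
    rw [smul_dotProduct, dotProduct_smul, ← hrr]
    simp [hr]
  have hMx : M *ᵥ (r⁻¹ • y) = 0 := by rw [mulVec_smul, hMy, smul_zero]
  refine ⟨r⁻¹ • y, hMx, hx1, fun h0 => ?_⟩
  obtain ⟨v, hv, hv0⟩ := exists_mulVec_eq_zero_iff.2 h0
  set x := r⁻¹ • y with hx
  have h1 : x ⬝ᵥ v = 0 := by
    have h2 := congrArg (fun z => x ⬝ᵥ z) hv0
    have h3 : x ᵥ* M = 0 := by rw [← mulVec_transpose, hM.eq, hMx]
    simp only [dotProduct_mulVec, vecMul_add, h3, vecMul_vecMulVec, hx1, zero_add, one_smul,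
      dotProduct_zero] at h2
    exact h2
  have h2 : M *ᵥ v = 0 := by
    rw [add_mulVec, vecMulVec_mulVec, h1] at hv0
    simpa using hv0
  obtain ⟨c, hc⟩ := hspan ⟨v, h2⟩
  have hc' : c • y = v := congrArg Subtype.val hc
  apply hv
  rw [← hc'] at h1 ⊢
  rw [hx, smul_dotProduct, dotProduct_smul] at h1
  have : c = 0 := by
    simpa [hr, hpos.ne'] using h1
  rw [this, zero_smul]

theorem IsKernelVector.finrank_ker {M : Matrix (Fin n) (Fin n) ℝ} {x : Fin n → ℝ}
    (h : IsKernelVector M x) :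
    Module.finrank ℝ (LinearMap.ker M.mulVecLin) = 1 := by
  have hx0 : x ≠ 0 := fun h0 => by simpa [h0] using h.dotProduct_eq
  refine finrank_eq_one_iff'.2 ⟨⟨x, h.mulVec_eq⟩, fun h0 => hx0 (congrArg Subtype.val h0), ?_⟩
  rintro ⟨v, hv⟩
  have hv' : M *ᵥ v = 0 := hv
  refine ⟨x ⬝ᵥ v, Subtype.ext ?_⟩
  have h1 : (M + vecMulVec x x) *ᵥ ((x ⬝ᵥ v) • x - v) = 0 := by
    rw [mulVec_sub, mulVec_smul, add_mulVec, add_mulVec, h.mulVec_eq, hv', vecMulVec_mulVec,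
      vecMulVec_mulVec, h.dotProduct_eq]
    simp
  by_contra hne
  exact h.det_ne (exists_mulVec_eq_zero_iff.1 ⟨_, sub_ne_zero.2 hne, h1⟩)

/-- The quadratic form of a tangent vector at a real vector `x`; at a point of the principal
stratum, with `x` a unit kernel vector, it measures the velocity of the crossing. -/
def crossingForm (x : Fin n → ℝ) : (Cn n →L[ℝ] Cn n) →ₗ[ℝ] ℝ where
  toFun w := -(cvec x ⬝ᵥ (((2 : ℝ) • toMatrix n w) *ᵥ cvec x)).im
  map_add' v w := by
    rw [map_add, smul_add, add_mulVec, dotProduct_add, Complex.add_im]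
    ring
  map_smul' c w := by
    rw [map_smul, smul_comm, smul_mulVec, dotProduct_smul, Complex.smul_im]
    simp

/-- The differential of the chart. -/
def chartTangent (a : ℝ) (M : symmMatrix n) (D : Matrix (Fin n) (Fin n) ℝ) : Cn n →L[ℝ] Cn n :=
  (1 / 2 : ℝ) • antilinear n ((param a • 1 + star (param a) • souriau (chart a M)) *
    complexify n D * (1 - star (param a) • complexify n M.1)⁻¹)

theorem two_smul_toMatrix_chartTangent (a : ℝ) (M : symmMatrix n) (D : Matrix (Fin n) (Fin n) ℝ) :
    (2 : ℝ) • toMatrix n (chartTangent a M D) =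
      (param a • 1 + star (param a) • souriau (chart a M)) *
        complexify n D * (1 - star (param a) • complexify n M.1)⁻¹ := by
  rw [chartTangent, map_smul, toMatrix_antilinear, smul_smul]
  norm_num

theorem chartTangent_sub_smul (a : ℝ) (M : symmMatrix n) (D E : Matrix (Fin n) (Fin n) ℝ) (c : ℝ) :
    chartTangent a M D - c • chartTangent a M E = chartTangent a M (D - c • E) := by
  simp only [chartTangent]
  rw [(complexify n).map_sub, (complexify n).map_smul, mul_sub, sub_mul, mul_smul_comm,
    smul_mul_assoc, (antilinear n).map_sub, (antilinear n).map_smul]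
  module

/-- Differentiating S(1 - w̄M) = -(1 - wM) gives S'(1 - w̄M) = (w + w̄S)D. -/
theorem hasDerivAt_chart (a : ℝ) {f : ℝ → symmMatrix n} {D : Matrix (Fin n) (Fin n) ℝ} {s : ℝ}
    (hf : HasDerivAt (fun s => (f s).1) D s) :
    HasDerivAt (fun s => proj (chart a (f s))) (chartTangent a (f s) D) s := by
  have hd : DifferentiableAt ℝ (fun s => souriau (chart a (f s))) s := by
    have := (contDiffAt_chart_formula a (f s) (m := 1)).differentiableAt one_ne_zero
    have := DifferentiableAt.comp (f := fun s => (f s).1) s this hf.differentiableAt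
    simp only [souriau_chart]
    exact this
  obtain ⟨W, hW⟩ : ∃ W, HasDerivAt (fun s => souriau (chart a (f s))) W s := ⟨_, hd.hasDerivAt⟩
  have hc : HasDerivAt (fun s => complexify n (f s).1) (complexify n D) s :=
    (complexify n).hasFDerivAt.comp_hasDerivAt s hf
  have h1 := hW.mul ((hc.const_smul (star (param a))).const_sub 1)
  have h2 := ((hc.const_smul (param a)).const_sub 1).neg
  have h3 := (h1.congr_of_eventuallyEq
    (Filter.Eventually.of_forall fun s => (souriau_chart_mul a (f s)).symm)).unique h2
  have hu := (isUnit_iff_isUnit_det _).1 (isUnit_chart_denom a (f s))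
  have h4 : W * (1 - star (param a) • complexify n (f s).1) =
      (param a • 1 + star (param a) • souriau (chart a (f s))) * complexify n D := by
    rw [mul_neg, neg_neg, mul_smul_comm, ← sub_eq_add_neg, sub_eq_iff_eq_add] at h3
    refine h3.trans ?_
    rw [ add_mul, smul_mul_assoc, smul_mul_assoc, one_mul]
  have h5 : W = (param a • 1 + star (param a) • souriau (chart a (f s))) *
      complexify n D * (1 - star (param a) • complexify n (f s).1)⁻¹ := by
    rw [← h4, mul_nonsing_inv_cancel_right _ _ hu]
  rw [chartTangent, ← h5]
  exact hasDerivAt_proj hW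

open Classical in
/-- The coordinate of a Lagrangian subspace in the chart with parameter `a`, and a default value
outside of the domain of the chart. -/
def coord (a : ℝ) (l : Lambda n) : symmMatrix n :=
  if h : (param a • 1 + star (param a) • souriau l).det ≠ 0 then
    ⟨_, (exists_eq_chart a l h).choose⟩ else 0

theorem coord_val (a : ℝ) {l : Lambda n}
    (h : (param a • 1 + star (param a) • souriau l).det ≠ 0) :
    (coord a l).1 =
      realPart n ((param a • 1 + star (param a) • souriau l)⁻¹ * (1 + souriau l)) := by
  rw [coord, dif_pos h]

theorem chart_coord (a : ℝ) {l : Lambda n}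
    (h : (param a • 1 + star (param a) • souriau l).det ≠ 0) : chart a (coord a l) = l := by
  rw [coord, dif_pos h]
  exact (exists_eq_chart a l h).choose_spec.symm

theorem coord_chart (a : ℝ) (M : symmMatrix n) : coord a (chart a M) = M := by
  apply Subtype.ext
  rw [coord_val a (det_chart_domain_ne_zero a M), ← chart_domain_mul,
    nonsing_inv_mul_cancel_left _ _ (isUnit_iff_ne_zero.2 (det_chart_domain_ne_zero a M)),
    realPart_complexify]

theorem continuousAt_coord (a : ℝ) {l : Lambda n}
    (h : (param a • 1 + star (param a) • souriau l).det ≠ 0) : ContinuousAt (coord a) l := by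
  have hs := continuous_souriau (n := n)
  have hB : Continuous fun m : Lambda n => param a • 1 + star (param a) • souriau m := by fun_prop
  have hev : ∀ᶠ m in 𝓝 l, (param a • 1 + star (param a) • souriau m).det ≠ 0 :=
    (hB.matrix_det.continuousAt).eventually_ne h
  rw [Topology.IsInducing.subtypeVal.continuousAt_iff]
  have h1 : ContinuousAt (fun m : Lambda n =>
      realPart n ((param a • 1 + star (param a) • souriau m)⁻¹ * (1 + souriau m))) l := by
    refine (realPart n).continuous.continuousAt.comp (ContinuousAt.mul ?_ (by fun_prop))
    exact ContinuousAt.comp (f := fun m : Lambda n => param a • 1 + star (param a) • souriau m)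
      (contDiffAt_matrix_inv (m := 0) h).continuousAt hB.continuousAt
  refine h1.congr ?_
  filter_upwards [hev] with m hm using (coord_val a hm).symm

theorem exists_hasDerivAt_coord (a : ℝ) {c : ℝ → Lambda n} {w : Cn n →L[ℝ] Cn n} {s : ℝ}
    (hc : HasDerivAt (fun s => proj (c s)) w s)
    (h : (param a • 1 + star (param a) • souriau (c s)).det ≠ 0) :
    (∀ᶠ t in 𝓝 s, chart a (coord a (c t)) = c t) ∧
      ∃ D : symmMatrix n, HasDerivAt (fun t => (coord a (c t)).1) D.1 s := by
  have hS := hasDerivAt_souriau hc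
  have hB : HasDerivAt (fun t => param a • 1 + star (param a) • souriau (c t)) _ s :=
    (hS.const_smul (star (param a))).const_add (param a • 1)
  have hev : ∀ᶠ t in 𝓝 s, (param a • 1 + star (param a) • souriau (c t)).det ≠ 0 :=
    (((contDiff_det (m := 0)).continuous.continuousAt).comp hB.continuousAt).eventually_ne h
  refine ⟨hev.mono fun t ht => chart_coord a ht, ?_⟩
  have hdiff : DifferentiableAt ℝ (fun t => realPart n
      ((param a • 1 + star (param a) • souriau (c t))⁻¹ * (1 + souriau (c t)))) s := by
    have hinv := ((contDiffAt_matrix_inv (m := 1) h).differentiableAt one_ne_zero).comp s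
      hB.differentiableAt
    exact (realPart n).differentiableAt.comp s
      (hinv.mul (hS.differentiableAt.const_add 1))
  have hd : HasDerivAt (fun t => (coord a (c t)).1) _ s :=
    hdiff.hasDerivAt.congr_of_eventuallyEq (hev.mono fun t ht => coord_val a ht)
  refine ⟨⟨_, ?_⟩, hd⟩
  -- The coordinate matrices equal their transposes, hence so does the derivative.
  have hT : HasDerivAt (fun t => ((coord a (c t)).1)ᵀ) _ s :=
    (LinearMap.toContinuousLinearMap
      (Matrix.transposeLinearEquiv (Fin n) (Fin n) ℝ ℝ).toLinearMap).hasFDerivAt.comp_hasDerivAt s hd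
  have heq : (fun t => ((coord a (c t)).1)ᵀ) = fun t => (coord a (c t)).1 :=
    funext fun t => (coord a (c t)).2
  rw [heq] at hT
  exact hT.unique hd

/-- Tangent vectors are defined by curves that are differentiable at one time only. Reading such
curves in a chart, and using the lines M + sD conversely, shows that they form a vector space. -/
theorem mem_tangentVectors_univ_iff (a : ℝ) (M : symmMatrix n) (w : Cn n →L[ℝ] Cn n) :
    w ∈ tangentVectors Set.univ (chart a M) ↔ ∃ D : symmMatrix n, w = chartTangent a M D.1 := by
  constructor
  · rintro ⟨c, hc0, -, hc⟩
    obtain ⟨hev, D, hD⟩ := exists_hasDerivAt_coord a hc (by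
      rw [hc0]; exact det_chart_domain_ne_zero a M)
    refine ⟨D, ?_⟩
    have h1 := hasDerivAt_chart a hD
    rw [hc0, coord_chart] at h1
    exact hc.unique (h1.congr_of_eventuallyEq (hev.mono fun t ht => by simp only [ht]))
  · rintro ⟨D, rfl⟩
    refine ⟨fun s => chart a (M + s • D), by simp, by simp, ?_⟩
    have hf : HasDerivAt (fun s : ℝ => (M + s • D : symmMatrix n).1) D.1 0 := by
      simpa only [id_eq, one_smul] using! ((hasDerivAt_id (0 : ℝ)).smul_const D.1).const_add M.1
    simpa using hasDerivAt_chart a hf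

theorem finrank_ker_congruence {M Q : Matrix (Fin n) (Fin n) ℝ} (hQ : Q.det ≠ 0) :
    Module.finrank ℝ (LinearMap.ker (Qᵀ * M * Q).mulVecLin) =
      Module.finrank ℝ (LinearMap.ker M.mulVecLin) := by
  have h1 := LinearMap.finrank_range_add_finrank_ker (Qᵀ * M * Q).mulVecLin
  have h2 := LinearMap.finrank_range_add_finrank_ker M.mulVecLin
  have h3 : (Qᵀ * M * Q).rank = M.rank := by
    rw [rank_mul_eq_left_of_isUnit_det _ _ (isUnit_iff_ne_zero.2 hQ),
      rank_mul_eq_right_of_isUnit_det _ _ (isUnit_iff_ne_zero.2 (by rwa [det_transpose]))]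
  rw [Matrix.rank, Matrix.rank] at h3
  omega

/-- Congruence by invertible Q preserves the corank. So it suffices to write D = KᵀM + MK and to
move along QᵀMQ with Q = 1 + sK, which stays in the stratum for small s. -/
theorem chartTangent_mem_tangentVectors_stratum (a : ℝ) (M : symmMatrix n) {x : Fin n → ℝ}
    (hx : IsKernelVector M.1 x) (D : symmMatrix n) (hD : x ⬝ᵥ (D.1 *ᵥ x) = 0) :
    chartTangent a M D.1 ∈ tangentVectors (stratum n 1) (chart a M) := by
  set R := vecMulVec x x with hR
  have hu : IsUnit (M.1 + R).det := isUnit_iff_ne_zero.2 hx.det_ne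
  set G := (M.1 + R)⁻¹ with hG
  have hMT : M.1ᵀ = M.1 := M.2
  have hDT : D.1ᵀ = D.1 := D.2
  have hRT : Rᵀ = R := by rw [hR, transpose_vecMulVec]
  have hRM : R * (M.1 + R) = R := by
    have h1 : x ᵥ* M.1 = 0 := by rw [← mulVec_transpose, hMT, hx.mulVec_eq]
    rw [mul_add, hR, vecMulVec_mul, h1, vecMulVec_mul_vecMulVec, hx.dotProduct_eq]
    simp
  have hRG : R * G = R := by
    conv_lhs => rw [← hRM]
    rw [mul_assoc, hG, mul_nonsing_inv _ hu, mul_one]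
  have hMG : M.1 * G = 1 - R := by
    have := mul_nonsing_inv _ hu
    rw [← hG, add_mul, hRG] at this
    rw [← this, add_sub_cancel_right]
  have hRDR : R * D.1 * R = 0 := by
    rw [hR, vecMulVec_mul, vecMulVec_mul_vecMulVec, ← dotProduct_mulVec, hD]
    simp
  -- As MG = 1 - R, this choice gives MK + (MK)ᵀ = D - RDR, and RDR = (x·Dx)R = 0.
  set K := (1 / 2 : ℝ) • (G * D.1 * (1 + R)) with hK
  have hMK : M.1 * K = (1 / 2 : ℝ) • ((1 - R) * D.1 * (1 + R)) := by
    rw [hK, mul_smul_comm, ← mul_assoc, ← mul_assoc, hMG]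
  have hKM : Kᵀ * M.1 = (1 / 2 : ℝ) • ((1 + R) * D.1 * (1 - R)) := by
    have h1 : Kᵀ * M.1 = (M.1 * K)ᵀ := by rw [transpose_mul, hMT]
    rw [h1, hMK]
    simp only [transpose_smul, transpose_mul, transpose_add, transpose_sub, transpose_one, hRT,
      hDT, mul_assoc]
  have hsum : Kᵀ * M.1 + M.1 * K = D.1 := by
    rw [hMK, hKM, ← smul_add]
    have : (1 + R) * D.1 * (1 - R) + (1 - R) * D.1 * (1 + R) =
        (2 : ℝ) • D.1 - (2 : ℝ) • (R * D.1 * R) := by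
      rw [two_smul, two_smul]
      noncomm_ring
    rw [this, hRDR, smul_zero, sub_zero, smul_smul]
    norm_num
  have hsymm : ∀ Q : Matrix (Fin n) (Fin n) ℝ, Qᵀ * M.1 * Q ∈ symmMatrix n := by
    intro Q
    change (Qᵀ * M.1 * Q)ᵀ = _
    rw [transpose_mul, transpose_mul, transpose_transpose, hMT, mul_assoc]
  let f : ℝ → symmMatrix n := fun s => ⟨_, hsymm (1 + s • K)⟩
  have hf0 : f 0 = M := by
    apply Subtype.ext
    simp [f]
  have hQ : HasDerivAt (fun s : ℝ => 1 + s • K) K 0 := by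
    simpa only [id_eq, one_smul] using! ((hasDerivAt_id (0 : ℝ)).smul_const K).const_add 1
  have hQT : HasDerivAt (fun s : ℝ => (1 + s • K)ᵀ) Kᵀ 0 := by
    simp only [transpose_add, transpose_one, transpose_smul]
    simpa only [id_eq, one_smul] using! ((hasDerivAt_id (0 : ℝ)).smul_const Kᵀ).const_add 1
  have hf : HasDerivAt (fun s => (f s).1) D.1 0 := by
    have := (hQT.mul_const M.1).mul hQ
    refine this.congr_deriv ?_
    rw [zero_smul, add_zero, transpose_one, one_mul, mul_one, hsum]
  refine ⟨fun s => chart a (f s), congrArg (chart a) hf0, ?_, ?_⟩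
  · have hdet : ∀ᶠ s : ℝ in 𝓝 0, (1 + s • K).det ≠ 0 := by
      have hcont : Continuous fun s : ℝ => (1 + s • K).det := by fun_prop
      refine hcont.continuousAt.eventually_ne ?_
      simp
    filter_upwards [hdet] with s hs
    rw [chart_mem_stratum_iff]
    exact (finrank_ker_congruence hs).trans (hx.finrank_ker)
  · have := hasDerivAt_chart a hf
    rwa [hf0] at this

end

/-! ### Transversality and signs in terms of the crossing form -/

section

open Matrix

attribute [local instance] Matrix.linftyOpNormedRing Matrix.linftyOpNormedAlgebra

variable {n : ℕ}

theorem tangentVectors_subset_univ (M : Set (Lambda n)) (l : Lambda n) :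
    tangentVectors M l ⊆ tangentVectors Set.univ l :=
  fun _ ⟨c, h0, _, hd⟩ => ⟨c, h0, by simp, hd⟩

theorem sub_smul_mem_tangentVectors {l : Lambda n} {u v : Cn n →L[ℝ] Cn n}
    (hu : u ∈ tangentVectors Set.univ l) (hv : v ∈ tangentVectors Set.univ l) (a : ℝ) :
    u - a • v ∈ tangentVectors Set.univ l := by
  obtain ⟨b, M, rfl⟩ := exists_chart l
  rw [mem_tangentVectors_univ_iff] at *
  obtain ⟨D, rfl⟩ := hu
  obtain ⟨E, rfl⟩ := hv
  exact ⟨D - a • E, chartTangent_sub_smul b M D.1 E.1 a⟩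

theorem hasDerivAt_souriau_phase (l : Lambda n) :
    HasDerivAt (fun t => souriau (unitaryAct (phase n t) l)) ((2 * Complex.I) • souriau l) 0 := by
  simp only [souriau_phase]
  have h1 : HasDerivAt (fun t : ℝ => (2 * t * Complex.I : ℂ)) (2 * Complex.I) 0 := by
    have := ((Complex.ofRealCLM.hasDerivAt (x := 0)).const_mul 2).mul_const Complex.I
    simpa using! this
  have h2 := h1.cexp
  simp only [Complex.ofReal_zero, mul_zero, zero_mul, Complex.exp_zero, one_mul] at h2
  exact h2.smul_const (souriau l)

theorem flowField_eq (l : Lambda n) :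
    flowField l = (1 / 2 : ℝ) • antilinear n ((2 * Complex.I) • souriau l) :=
  (hasDerivAt_proj (hasDerivAt_souriau_phase l)).deriv

theorem unitaryAct_phase_zero (l : Lambda n) : unitaryAct (phase n 0) l = l :=
  souriau_injective (by rw [souriau_phase]; simp)

theorem flowField_mem (l : Lambda n) : flowField l ∈ tangentVectors Set.univ l := by
  refine ⟨fun t => unitaryAct (phase n t) l, unitaryAct_phase_zero l, by simp, ?_⟩
  rw [flowField_eq]
  exact hasDerivAt_proj (hasDerivAt_souriau_phase l)

/-- A real unit vector `x` spanning the kernel of `1 + S` at a point of the principal stratum. -/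
structure IsCrossingVector (l : Lambda n) (x : Fin n → ℝ) : Prop where
  mulVec_eq : (1 + souriau l) *ᵥ cvec x = 0
  dotProduct_eq : cvec x ⬝ᵥ cvec x = 1
  det_ne : (1 + souriau l + vecMulVec (cvec x) (cvec x)).det ≠ 0
  form_eq : ∀ w ∈ tangentVectors Set.univ l,
    cvec x ⬝ᵥ (((2 : ℝ) • toMatrix n w) *ᵥ cvec x) = -Complex.I * crossingForm x w
  mem_of_form_eq_zero : ∀ w ∈ tangentVectors Set.univ l, crossingForm x w = 0 →
    w ∈ tangentVectors (stratum n 1) l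

theorem IsCrossingVector.vecMul_eq {l : Lambda n} {x : Fin n → ℝ} (h : IsCrossingVector l x) :
    cvec x ᵥ* (1 + souriau l) = 0 := by
  rw [← mulVec_transpose, transpose_add, transpose_one, souriau_transpose, h.mulVec_eq]

/-- On the kernel of M the denominator 1 - w̄M acts as the identity and S as -1, so only the scalar
w - w̄ = 2i remains, the same for all charts. -/
theorem form_chartTangent (a : ℝ) (M : symmMatrix n) {x : Fin n → ℝ} (hx : M.1 *ᵥ x = 0)
    (D : Matrix (Fin n) (Fin n) ℝ) :
    cvec x ⬝ᵥ (((2 : ℝ) • toMatrix n (chartTangent a M D)) *ᵥ cvec x) =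
      2 * Complex.I * ((x ⬝ᵥ (D *ᵥ x) : ℝ) : ℂ) := by
  have hMx : complexify n M.1 *ᵥ cvec x = 0 := by
    rw [complexify_mulVec_cvec, hx]
    ext i
    simp [cvec]
  have hu := (isUnit_iff_isUnit_det _).1 (isUnit_chart_denom a M)
  have h1 : (1 - star (param a) • complexify n M.1)⁻¹ *ᵥ cvec x = cvec x := by
    have : (1 - star (param a) • complexify n M.1) *ᵥ cvec x = cvec x := by
      rw [sub_mulVec, smul_mulVec, hMx, one_mulVec, smul_zero, sub_zero]
    conv_lhs => rw [← this]
    rw [mulVec_mulVec, nonsing_inv_mul _ hu, one_mulVec]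
  have h2 : souriau (chart a M) *ᵥ cvec x = -cvec x := by
    have h3 : (1 + souriau (chart a M)) *ᵥ cvec x = 0 := by
      rw [← chart_domain_mul, ← mulVec_mulVec, hMx, mulVec_zero]
    rw [add_mulVec, one_mulVec] at h3
    exact (neg_eq_of_add_eq_zero_right h3).symm
  have h3 : cvec x ᵥ* (param a • 1 + star (param a) • souriau (chart a M)) =
      (2 * Complex.I) • cvec x := by
    rw [← mulVec_transpose, transpose_add, transpose_smul, transpose_smul, transpose_one,
      souriau_transpose, add_mulVec, smul_mulVec, smul_mulVec, one_mulVec, h2,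
      ← param_sub_star a, sub_smul, smul_neg, sub_eq_add_neg]
  rw [two_smul_toMatrix_chartTangent, ← mulVec_mulVec, h1, ← mulVec_mulVec, dotProduct_mulVec, h3,
    complexify_mulVec_cvec, smul_dotProduct, cvec_dotProduct, smul_eq_mul]

theorem crossingForm_chartTangent (a : ℝ) (M : symmMatrix n) {x : Fin n → ℝ} (hx : M.1 *ᵥ x = 0)
    (D : Matrix (Fin n) (Fin n) ℝ) :
    crossingForm x (chartTangent a M D) = -2 * (x ⬝ᵥ (D *ᵥ x)) := by
  change -(cvec x ⬝ᵥ (((2 : ℝ) • toMatrix n (chartTangent a M D)) *ᵥ cvec x)).im = _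
  rw [form_chartTangent a M hx]
  simp

theorem IsKernelVector.isCrossingVector (a : ℝ) (M : symmMatrix n) {x : Fin n → ℝ}
    (hx : IsKernelVector M.1 x) : IsCrossingVector (chart a M) x := by
  have hMx : complexify n M.1 *ᵥ cvec x = 0 := by
    rw [complexify_mulVec_cvec, hx.mulVec_eq]
    ext i
    simp [cvec]
  have hNx : (1 + souriau (chart a M)) *ᵥ cvec x = 0 := by
    rw [← chart_domain_mul, ← mulVec_mulVec, hMx, mulVec_zero]
  have hxN : cvec x ᵥ* (1 + souriau (chart a M)) = 0 := by
    rw [← mulVec_transpose, transpose_add, transpose_one, souriau_transpose, hNx]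
  have hxx : cvec x ⬝ᵥ cvec x = 1 := by rw [cvec_dotProduct, hx.dotProduct_eq, Complex.ofReal_one]
  refine ⟨hNx, hxx, fun h0 => ?_, ?_, ?_⟩
  · obtain ⟨v, hv, hv0⟩ := exists_mulVec_eq_zero_iff.2 h0
    have h1 : cvec x ⬝ᵥ v = 0 := by
      have h2 := congrArg (fun z => cvec x ⬝ᵥ z) hv0
      simp only [dotProduct_mulVec, vecMul_add, hxN, vecMul_vecMulVec, hxx, zero_add, one_smul,
        dotProduct_zero] at h2
      exact h2
    rw [add_mulVec, vecMulVec_mulVec, h1] at hv0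
    simp only [MulOpposite.op_zero, zero_smul, add_zero] at hv0
    rw [← chart_domain_mul, ← mulVec_mulVec] at hv0
    have h2 : complexify n M.1 *ᵥ v = 0 := by
      by_contra hne
      exact det_chart_domain_ne_zero a M (exists_mulVec_eq_zero_iff.1 ⟨_, hne, hv0⟩)
    have h3 : complexify n (M.1 + vecMulVec x x) *ᵥ v = 0 := by
      rw [map_add, add_mulVec, h2, complexify_vecMulVec, vecMulVec_mulVec, h1]
      simp
    have h4 := exists_mulVec_eq_zero_iff.1 ⟨v, hv, h3⟩
    rw [det_complexify, Complex.ofReal_eq_zero] at h4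
    exact hx.det_ne h4
  · intro w hw
    obtain ⟨D, rfl⟩ := (mem_tangentVectors_univ_iff a M w).1 hw
    rw [form_chartTangent a M hx.mulVec_eq, crossingForm_chartTangent a M hx.mulVec_eq]
    push_cast
    ring
  · intro w hw h0
    obtain ⟨D, rfl⟩ := (mem_tangentVectors_univ_iff a M w).1 hw
    rw [crossingForm_chartTangent a M hx.mulVec_eq] at h0
    exact chartTangent_mem_tangentVectors_stratum a M hx D (by linarith)

theorem exists_isCrossingVector {l : Lambda n} (hl : l ∈ stratum n 1) :
    ∃ x, IsCrossingVector l x := by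
  obtain ⟨a, M, rfl⟩ := exists_chart l
  obtain ⟨x, hx⟩ := exists_isKernelVector M.2 ((chart_mem_stratum_iff a M 1).1 hl)
  exact ⟨x, hx.isCrossingVector a M⟩

theorem stratum_one_subset : stratum n 1 ⊆ maslovCycle n :=
  fun _ hl => Set.mem_iUnion₂.2 ⟨1, le_rfl, hl⟩

/-- Along a curve in the stratum det(1 + S) vanishes identically, and its derivative is a nonzero
multiple of the form. -/
theorem IsCrossingVector.form_eq_zero {l : Lambda n} {x : Fin n → ℝ} (h : IsCrossingVector l x)
    {w : Cn n →L[ℝ] Cn n} (hw : w ∈ tangentVectors (stratum n 1) l) : crossingForm x w = 0 := by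
  have hw' := hw
  obtain ⟨c, hc0, hev, hd⟩ := hw
  have hS := (hasDerivAt_souriau hd).const_add (1 : Matrix (Fin n) (Fin n) ℂ)
  have hdet : HasFDerivAt (fun A : Matrix (Fin n) (Fin n) ℂ => A.det)
      (fderiv ℝ (fun A : Matrix (Fin n) (Fin n) ℂ => A.det) (1 + souriau l))
      (1 + souriau (c 0)) := by
    rw [hc0]
    exact ((contDiff_det (m := 1)).differentiable one_ne_zero _).hasFDerivAt
  have h1 := hdet.comp_hasDerivAt (0 : ℝ) hS
  have h2 : HasDerivAt (fun _ : ℝ => (0 : ℂ)) 0 0 := hasDerivAt_const _ _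
  have h3 := h1.unique (h2.congr_of_eventuallyEq (hev.mono fun t ht =>
    (mem_maslovCycle_iff (c t)).1 (stratum_one_subset ht)))
  have h4 := (fderiv_det_apply h.mulVec_eq h.vecMul_eq h.dotProduct_eq h.det_ne
    ((2 : ℝ) • toMatrix n w)).symm.trans h3
  rw [h.form_eq w (tangentVectors_subset_univ _ _ hw')] at h4
  simpa [h.det_ne] using h4

/-- The generator moves S with velocity 2iS and Sx = -x. The minus sign in `crossingForm` thus makes
the positive side of the stratum the side of positive form. -/
theorem IsCrossingVector.form_flowField {l : Lambda n} {x : Fin n → ℝ}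
    (h : IsCrossingVector l x) : crossingForm x (flowField l) = 2 := by
  change -(cvec x ⬝ᵥ (((2 : ℝ) • toMatrix n (flowField l)) *ᵥ cvec x)).im = _
  have h2 : souriau l *ᵥ cvec x = -cvec x := by
    have h3 := h.mulVec_eq
    rw [add_mulVec, one_mulVec] at h3
    exact (neg_eq_of_add_eq_zero_right h3).symm
  rw [flowField_eq, map_smul, toMatrix_antilinear, smul_smul, smul_mulVec, smul_mulVec, h2,
    dotProduct_smul, dotProduct_smul, dotProduct_neg, h.dotProduct_eq]
  norm_num

/-- Transversality to the principal stratum of a tangent vector. -/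
theorem IsCrossingVector.transverse_iff {l : Lambda n} {x : Fin n → ℝ} (h : IsCrossingVector l x)
    {v : Cn n →L[ℝ] Cn n} (hv : v ∈ tangentVectors Set.univ l) :
    (∀ u ∈ tangentVectors Set.univ l, ∃ a : ℝ, ∃ w ∈ tangentVectors (stratum n 1) l,
      u = a • v + w) ↔ crossingForm x v ≠ 0 := by
  constructor
  · intro H h0
    obtain ⟨a, w, hw, hu⟩ := H _ (flowField_mem l)
    have := h.form_flowField
    rw [hu, map_add, map_smul, h0, h.form_eq_zero hw] at this
    norm_num at this
  · intro h0 u hu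
    refine ⟨crossingForm x u / crossingForm x v, _, h.mem_of_form_eq_zero _
      (sub_smul_mem_tangentVectors hu hv (crossingForm x u / crossingForm x v)) ?_, ?_⟩
    · rw [map_sub, map_smul, smul_eq_mul, div_mul_cancel₀ _ h0, sub_self]
    · rw [add_sub_cancel]

theorem hasDerivAt_velocity {δ : C(UnitAddCircle, Lambda n)} (hδ : IsSmoothLoop δ) (t : ℝ) :
    HasDerivAt (fun s : ℝ => proj (δ (s : UnitAddCircle))) (velocity δ t) t ∧
    velocity δ t ∈ tangentVectors Set.univ (δ t) := by
  have hd : HasDerivAt (fun s : ℝ => proj (δ (s : UnitAddCircle))) _ t :=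
    (hδ.differentiable (by simp) t).hasDerivAt
  have hd' : HasDerivAt (fun s : ℝ => proj (δ ((t : UnitAddCircle) + (s : UnitAddCircle))))
      (deriv (fun s : ℝ => proj (δ (s : UnitAddCircle))) t) 0 := by
    have : HasDerivAt (fun s : ℝ => proj (δ (s : UnitAddCircle)))
        (deriv (fun s : ℝ => proj (δ (s : UnitAddCircle))) t) (t + 0) := by
      rw [add_zero]; exact hd
    have := this.comp_const_add t 0
    simpa only [AddCircle.coe_add] using this
  have hv : velocity δ t = deriv (fun s : ℝ => proj (δ (s : UnitAddCircle))) t := hd'.deriv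
  rw [hv]
  exact ⟨hd, fun s => δ ((t : UnitAddCircle) + (s : UnitAddCircle)), by simp, by simp, hd'⟩

theorem IsCrossingVector.crossingSign_eq {δ : C(UnitAddCircle, Lambda n)} (hδ : IsSmoothLoop δ)
    {t : ℝ} {x : Fin n → ℝ} (h : IsCrossingVector (δ t) x) :
    crossingSign δ t = SignType.sign (crossingForm x (velocity δ t)) := by
  have hv := (hasDerivAt_velocity hδ t).2
  -- Modulo vectors tangent to the stratum, the form is a linear coordinate on the tangent space,
  -- with value 2 on the generator.
  have key : ∀ a : ℝ, (∃ w ∈ tangentVectors (stratum n 1) (δ t),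
      velocity δ t = a • flowField (δ t) + w) ↔ crossingForm x (velocity δ t) = 2 * a := by
    intro a
    constructor
    · rintro ⟨w, hw, h1⟩
      rw [h1, map_add, map_smul, h.form_flowField, h.form_eq_zero hw, smul_eq_mul]
      ring
    · intro h1
      refine ⟨_, h.mem_of_form_eq_zero _ (sub_smul_mem_tangentVectors hv (flowField_mem _) a) ?_,
        (add_sub_cancel _ _).symm⟩
      rw [map_sub, map_smul, h.form_flowField, h1, smul_eq_mul]
      ring
  rcases lt_trichotomy (crossingForm x (velocity δ t)) 0 with hq | hq | hq
  · rw [crossingSign, if_neg, if_pos, sign_neg hq]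
    · rfl
    · exact ⟨crossingForm x (velocity δ t) / 2, by linarith, (key _).2 (by ring)⟩
    · rintro ⟨a, ha, h1⟩
      linarith [(key a).1 h1]
  · rw [crossingSign, if_neg, if_neg, hq, sign_zero]
    · rfl
    · rintro ⟨a, ha, h1⟩
      linarith [(key a).1 h1]
    · rintro ⟨a, ha, h1⟩
      linarith [(key a).1 h1]
  · rw [crossingSign, if_pos, sign_pos hq]
    · rfl
    · exact ⟨crossingForm x (velocity δ t) / 2, by linarith, (key _).2 (by ring)⟩

end

/-! ### The index formula -/

section

open Matrix Asymptotics

attribute [local instance] Matrix.linftyOpNormedRing Matrix.linftyOpNormedAlgebra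

variable {n : ℕ}

theorem isLittleO_mul_sub_mul_fderiv {F k : ℝ × ℝ → ℂ} {F' k' : ℝ × ℝ →L[ℝ] ℂ} {p : ℝ × ℝ}
    (hF : HasFDerivAt F F' p) (hk : HasFDerivAt k k' p) (hF0 : F p = 0) (hk0 : k p = 0) :
    (fun y => F y * k y - F' (y - p) * k' (y - p)) =o[𝓝 p] fun y => ‖y - p‖ * ‖y - p‖ := by
  have h1 := hF.isLittleO
  have h2 := hk.isLittleO
  simp only [hF0, hk0, sub_zero] at h1 h2
  have h3 : k =O[𝓝 p] fun y => y - p := by simpa [hk0] using hk.isBigO_sub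
  have h4 : (fun y => F' (y - p)) =O[𝓝 p] fun y => y - p := F'.isBigO_sub _ _
  have h5 := (h1.norm_right.mul_isBigO h3.norm_right).add (h4.norm_right.mul_isLittleO h2.norm_right)
  refine h5.congr_left fun y => ?_
  ring

/-- The mixed terms cancel: to second order the sum is -2cm(h₁² + qr h₂²), which is definite because
q and r have the same sign, and so dominates the error. In the application F/K and f/k are the two
loops in the variables (s, t). -/
theorem eventually_mul_add_mul_ne_zero {F K f k : ℝ × ℝ → ℂ} {F' K' f' k' : ℝ × ℝ →L[ℝ] ℂ}
    {p : ℝ × ℝ} (hF : HasFDerivAt F F' p) (hK : HasFDerivAt K K' p) (hf : HasFDerivAt f f' p)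
    (hk : HasFDerivAt k k' p) (hF0 : F p = 0) (hK0 : K p = 0) (hf0 : f p = 0) (hk0 : k p = 0)
    {c m : ℂ} (hc : c ≠ 0) (hm : m ≠ 0) {q r : ℝ} (hqr : 0 < q * r)
    (hF' : ∀ h, F' h = c * (h.1 - Complex.I * q * h.2))
    (hK' : ∀ h, K' h = c * (-h.1 - Complex.I * q * h.2))
    (hf' : ∀ h, f' h = m * (h.1 - Complex.I * r * h.2))
    (hk' : ∀ h, k' h = m * (-h.1 - Complex.I * r * h.2)) :
    ∀ᶠ y in 𝓝 p, y ≠ p → F y * k y + K y * f y ≠ 0 := by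
  have h1 := (isLittleO_mul_sub_mul_fderiv hF hk hF0 hk0).add
    (isLittleO_mul_sub_mul_fderiv hK hf hK0 hf0)
  -- Chosen so that ‖h‖² ≤ C(h₁² + qr h₂²); an error of at most |c||m|‖h‖²/C is then at most half of
  -- the main term.
  set C : ℝ := max 1 (q * r)⁻¹ with hC
  have hCpos : 0 < C := lt_of_lt_of_le one_pos (le_max_left _ _)
  have hmain : ∀ h : ℝ × ℝ, F' h * k' h + K' h * f' h =
      -(2 * c * m) * ((h.1 ^ 2 + q * r * h.2 ^ 2 : ℝ) : ℂ) := by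
    intro h
    rw [hF', hK', hf', hk']
    push_cast
    linear_combination (2 * c * m * q * r * (h.2 : ℂ) ^ 2) * Complex.I_sq
  have hbound : ∀ h : ℝ × ℝ, ‖h‖ * ‖h‖ ≤ C * (h.1 ^ 2 + q * r * h.2 ^ 2) := by
    intro h
    have e1 : h.1 ^ 2 ≤ C * h.1 ^ 2 := by
      nlinarith [sq_nonneg h.1, le_max_left 1 (q * r)⁻¹]
    have e2 : h.2 ^ 2 ≤ C * (q * r * h.2 ^ 2) := by
      have : 1 ≤ C * (q * r) := by
        calc (1 : ℝ) = (q * r)⁻¹ * (q * r) := (inv_mul_cancel₀ hqr.ne').symm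
          _ ≤ C * (q * r) := mul_le_mul_of_nonneg_right (le_max_right _ _) hqr.le
      nlinarith [sq_nonneg h.2]
    have e3 : ‖h‖ * ‖h‖ ≤ h.1 ^ 2 + h.2 ^ 2 := by
      rw [Prod.norm_def]
      rcases max_cases ‖h.1‖ ‖h.2‖ with ⟨e, -⟩ | ⟨e, -⟩ <;> rw [e, Real.norm_eq_abs, abs_mul_abs_self]
      · nlinarith [sq_nonneg h.2]
      · nlinarith [sq_nonneg h.1]
    linarith
  have hcm : 0 < ‖c‖ * ‖m‖ := mul_pos (norm_pos_iff.2 hc) (norm_pos_iff.2 hm)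
  filter_upwards [h1.bound (div_pos hcm hCpos)] with y hy hne h0
  set h := y - p with hh
  have hh0 : h ≠ 0 := sub_ne_zero.2 hne
  have hpos : 0 < ‖h‖ * ‖h‖ := mul_pos (norm_pos_iff.2 hh0) (norm_pos_iff.2 hh0)
  have e1 : F y * k y - F' h * k' h + (K y * f y - K' h * f' h) =
      (2 * c * m) * ((h.1 ^ 2 + q * r * h.2 ^ 2 : ℝ) : ℂ) := by
    linear_combination h0 - hmain h
  have hQ : 0 ≤ h.1 ^ 2 + q * r * h.2 ^ 2 := by
    have := mul_nonneg hqr.le (sq_nonneg h.2)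
    nlinarith [sq_nonneg h.1]
  rw [e1, norm_mul, norm_mul, norm_mul, Complex.norm_real, Real.norm_of_nonneg hQ,
    Real.norm_of_nonneg hpos.le] at hy
  have e2 := hbound h
  have e3 : ‖c‖ * ‖m‖ / C * (‖h‖ * ‖h‖) ≤ ‖c‖ * ‖m‖ * (h.1 ^ 2 + q * r * h.2 ^ 2) := by
    rw [div_mul_eq_mul_div, div_le_iff₀ hCpos]
    nlinarith
  have e4 : 0 < h.1 ^ 2 + q * r * h.2 ^ 2 := by
    by_contra hle
    nlinarith
  have e5 := mul_pos hcm e4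
  norm_num at hy
  nlinarith

/-! #### Deformation of a unitary loop by disc automorphisms -/

-- A kernel vector would satisfy v = -sSv, hence ‖v‖ = s‖v‖ because S is isometric.
open scoped ComplexOrder in
theorem det_one_add_smul_ne_zero {S : Matrix (Fin n) (Fin n) ℂ} (hS : S ∈ unitaryGroup (Fin n) ℂ)
    {s : ℝ} (h0 : 0 ≤ s) (h1 : s < 1) : (1 + s • S).det ≠ 0 := by
  intro h
  obtain ⟨v, hv, hv0⟩ := exists_mulVec_eq_zero_iff.2 h
  have hSS : star S * S = 1 := Matrix.mem_unitaryGroup_iff'.1 hS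
  rw [add_mulVec, one_mulVec, smul_mulVec] at hv0
  have e1 : v = -(s • (S *ᵥ v)) := eq_neg_of_add_eq_zero_left hv0
  have e2 : star (S *ᵥ v) ⬝ᵥ (S *ᵥ v) = star v ⬝ᵥ v := by
    rw [star_mulVec, ← dotProduct_mulVec, mulVec_mulVec, ← star_eq_conjTranspose, hSS, one_mulVec]
  have e3 : star v ⬝ᵥ v = ((s * s : ℝ) : ℂ) * (star v ⬝ᵥ v) := by
    conv_lhs => rw [e1]
    rw [star_neg, neg_dotProduct, dotProduct_neg, neg_neg, star_smul, smul_dotProduct,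
      dotProduct_smul, e2, smul_smul, star_trivial, Complex.real_smul]
  have e4 : (1 - ((s * s : ℝ) : ℂ)) * (star v ⬝ᵥ v) = 0 := by linear_combination e3
  rcases mul_eq_zero.1 e4 with e | e
  · have : ((1 - s * s : ℝ) : ℂ) = 0 := by push_cast at e ⊢; exact e
    have := Complex.ofReal_eq_zero.1 this
    nlinarith
  · exact hv (dotProduct_star_self_eq_zero.1 e)

/-- Unitarity gives s + S = S(1 + sS)*, and det S has modulus 1. This puts det φ_s(S) on the unit
circle. -/
theorem norm_det_smul_add {S : Matrix (Fin n) (Fin n) ℂ} (hS : S ∈ unitaryGroup (Fin n) ℂ)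
    (s : ℝ) : ‖(s • 1 + S).det‖ = ‖(1 + s • S).det‖ := by
  have hSS : S * star S = 1 := Matrix.mem_unitaryGroup_iff.1 hS
  have h1 : s • 1 + S = S * star (1 + s • S) := by
    rw [star_add, star_smul, star_one, mul_add, mul_one, mul_smul_comm, hSS, star_trivial, add_comm]
  rw [h1, det_mul, norm_mul, norm_det_unitary ⟨S, hS⟩, one_mul, star_eq_conjTranspose,
    det_conjTranspose, norm_star]

/-- The loop `det ((s + S) (1 + s S)⁻¹)` in the circle, for a loop `S` of unitary matrices. -/
def blaschkeLoop (S : C(UnitAddCircle, unitaryGroup (Fin n) ℂ)) :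
    C(Set.Ico (0 : ℝ) 1, C(UnitAddCircle, Circle)) :=
  ContinuousMap.curry
    ⟨fun p => ⟨(p.1.1 • 1 + (S p.2 : Matrix (Fin n) (Fin n) ℂ)).det /
        (1 + p.1.1 • (S p.2 : Matrix (Fin n) (Fin n) ℂ)).det, by
          refine mem_sphere_zero_iff_norm.2 ?_
          rw [norm_div, norm_det_smul_add (S p.2).2]
          exact div_self (norm_ne_zero_iff.2
            (det_one_add_smul_ne_zero (S p.2).2 p.1.2.1 p.1.2.2))⟩, by
      refine continuous_induced_rng.2 ?_
      have hS : Continuous fun p : Set.Ico (0 : ℝ) 1 × UnitAddCircle =>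
          (S p.2 : Matrix (Fin n) (Fin n) ℂ) :=
        continuous_subtype_val.comp (S.continuous.comp continuous_snd)
      have hs : Continuous fun p : Set.Ico (0 : ℝ) 1 × UnitAddCircle => p.1.1 :=
        continuous_subtype_val.comp continuous_fst
      refine Continuous.div (Continuous.matrix_det ?_) (Continuous.matrix_det ?_) fun p =>
        det_one_add_smul_ne_zero (S p.2).2 p.1.2.1 p.1.2.2
      · exact (hs.smul continuous_const).add hS
      · exact continuous_const.add (hs.smul hS)⟩

theorem blaschkeLoop_apply (S : C(UnitAddCircle, unitaryGroup (Fin n) ℂ)) (s : Set.Ico (0 : ℝ) 1)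
    (t : UnitAddCircle) : (blaschkeLoop S s t : ℂ) =
      (s.1 • 1 + (S t : Matrix (Fin n) (Fin n) ℂ)).det /
        (1 + s.1 • (S t : Matrix (Fin n) (Fin n) ℂ)).det := rfl

/-- The degree is constant on the connected parameter interval, and s = 0 gives back det S. -/
theorem degree_blaschkeLoop (S : C(UnitAddCircle, unitaryGroup (Fin n) ℂ)) (s : Set.Ico (0 : ℝ) 1)
    (f : C(UnitAddCircle, Circle)) (hf : ∀ t, (f t : ℂ) = (S t : Matrix (Fin n) (Fin n) ℂ).det) :
    degree (blaschkeLoop S s) = degree f := by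
  have : PreconnectedSpace (Set.Ico (0 : ℝ) 1) :=
    isPreconnected_iff_preconnectedSpace.1 isPreconnected_Ico
  rw [degree_eq_of_continuous_family (fun s => blaschkeLoop S s) (blaschkeLoop S).continuous s
    ⟨0, le_rfl, one_pos⟩]
  congr 1
  ext t
  rw [blaschkeLoop_apply, hf]
  simp

/-- The loop `t ↦ -e^{2πi d (t - θ)}`. -/
def modelLoop (d : ℤ) (θ : UnitAddCircle) : C(UnitAddCircle, Circle) :=
  ⟨fun t => -(AddCircle.toCircle (t - θ)) ^ d, by
    have : Continuous fun t : UnitAddCircle => AddCircle.toCircle (t - θ) :=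
      AddCircle.continuous_toCircle.comp (by fun_prop)
    fun_prop⟩

theorem modelLoop_coe (d : ℤ) (τ t : ℝ) : modelLoop d (τ : UnitAddCircle) (t : UnitAddCircle) =
    Circle.exp (Real.pi + 2 * Real.pi * d * (t - τ)) := by
  have h2 : Circle.exp Real.pi = -1 := by ext; simp
  have h3 : AddCircle.toCircle ((t : UnitAddCircle) - (τ : UnitAddCircle)) =
      Circle.exp (2 * Real.pi * (t - τ)) := by
    rw [← AddCircle.coe_sub, AddCircle.toCircle_apply_mk, div_one]
  change -(AddCircle.toCircle ((t : UnitAddCircle) - (τ : UnitAddCircle))) ^ d = _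
  rw [h3, Circle.exp_add, h2, neg_one_mul, ← Circle.exp_intCast_mul]
  congr 2
  ring

theorem degree_modelLoop (d : ℤ) (θ : UnitAddCircle) : degree (modelLoop d θ) = d := by
  obtain ⟨τ, rfl⟩ := QuotientAddGroup.mk_surjective θ
  refine degree_eq_of_lift _ _ ⟨fun t => Real.pi + 2 * Real.pi * d * (t - τ), by fun_prop⟩
    (fun t => (modelLoop_coe d τ t).symm) ?_
  simp only [ContinuousMap.coe_mk]
  ring

theorem one_add_modelLoop_ne_zero {d : ℤ} (hd : d = 1 ∨ d = -1) {θ t : UnitAddCircle} (h : t ≠ θ) :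
    (1 + (modelLoop d θ t : ℂ)) ≠ 0 := by
  intro h0
  have h1 : modelLoop d θ t = -1 := by
    ext
    rw [Circle.coe_neg, Circle.coe_one]
    linear_combination h0
  have h2 : (AddCircle.toCircle (t - θ)) ^ d = 1 := neg_injective h1
  have h3 : AddCircle.toCircle (t - θ) = 1 := by
    rcases hd with rfl | rfl
    · simpa using h2
    · simpa using h2
  rw [← AddCircle.toCircle_zero, (AddCircle.injective_toCircle one_ne_zero).eq_iff] at h3
  exact h (sub_eq_zero.1 h3)

theorem hasDerivAt_modelLoop (d : ℤ) (τ t : ℝ) :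
    HasDerivAt (fun t : ℝ => (modelLoop d (τ : UnitAddCircle) (t : UnitAddCircle) : ℂ))
      (2 * Real.pi * d * Complex.I * modelLoop d (τ : UnitAddCircle) (t : UnitAddCircle)) t := by
  simp only [modelLoop_coe, Circle.coe_exp]
  have h1 : HasDerivAt (fun t : ℝ => Real.pi + 2 * Real.pi * d * (t - τ)) (2 * Real.pi * d) t := by
    simpa using (((hasDerivAt_id t).sub_const τ).const_mul (2 * Real.pi * d)).const_add Real.pi
  have h2 := (h1.ofReal_comp.mul_const Complex.I).cexp
  refine h2.congr_deriv ?_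
  push_cast
  ring

/-- The scalar loop as a loop of `1 × 1` unitary matrices. -/
def scalarUnitary (f : C(UnitAddCircle, Circle)) : C(UnitAddCircle, unitaryGroup (Fin 1) ℂ) :=
  ⟨fun t => ⟨(f t : ℂ) • 1, by
    rw [mem_unitaryGroup_iff, star_smul, star_one, smul_mul_smul_comm, one_mul]
    have : (f t : ℂ) * star (f t : ℂ) = 1 := by
      rw [Complex.star_def, Complex.mul_conj, Circle.normSq_coe, Complex.ofReal_one]
    rw [this, one_smul]⟩, by
    refine continuous_induced_rng.2 ?_
    have : Continuous fun t => (f t : ℂ) := continuous_subtype_val.comp f.continuous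
    exact this.smul continuous_const⟩

theorem blaschkeLoop_scalarUnitary (f : C(UnitAddCircle, Circle)) (s : Set.Ico (0 : ℝ) 1)
    (t : UnitAddCircle) : (blaschkeLoop (scalarUnitary f) s t : ℂ) =
      (s.1 + (f t : ℂ)) / (1 + s.1 * (f t : ℂ)) := by
  rw [blaschkeLoop_apply]
  simp [scalarUnitary]

theorem one_add_mul_circle_ne_zero (z : Circle) {s : ℝ} (h0 : 0 ≤ s) (h1 : s < 1) :
    1 + s * (z : ℂ) ≠ 0 := by
  intro h
  have h2 : (s : ℂ) * z = -1 := by linear_combination h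
  have h3 := congrArg norm h2
  rw [norm_mul, Circle.norm_coe, norm_neg, norm_one, Complex.norm_real, Real.norm_of_nonneg h0] at h3
  linarith

end

/-! ### Expansion at a crossing, finiteness and the signed count -/

section

open Matrix

attribute [local instance] Matrix.linftyOpNormedRing Matrix.linftyOpNormedAlgebra

variable {n : ℕ}

theorem hasDerivAt_souriau_loop {δ : C(UnitAddCircle, Lambda n)} (hδ : IsSmoothLoop δ) (t : ℝ) :
    HasDerivAt (fun s : ℝ => souriau (δ (s : UnitAddCircle)))
      ((2 : ℝ) • toMatrix n (velocity δ t)) t :=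
  hasDerivAt_souriau (hasDerivAt_velocity hδ t).1

theorem IsCrossingVector.souriau_form {l : Lambda n} {x : Fin n → ℝ} (h : IsCrossingVector l x) :
    cvec x ⬝ᵥ (souriau l *ᵥ cvec x) = -1 := by
  have h3 := h.mulVec_eq
  rw [add_mulVec, one_mulVec] at h3
  rw [← neg_eq_of_add_eq_zero_right h3, dotProduct_neg, h.dotProduct_eq]

/-- The derivative of det at 1 + S pairs a direction E to x·Ex: the identity contributes x·x = 1 and
the velocity of S contributes -i times its crossing form. -/
theorem exists_hasFDerivAt_det_smul_add {δ : C(UnitAddCircle, Lambda n)} (hδ : IsSmoothLoop δ)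
    {t : ℝ} {x : Fin n → ℝ} (h : IsCrossingVector (δ t) x) :
    ∃ F' : ℝ × ℝ →L[ℝ] ℂ,
      HasFDerivAt (fun p : ℝ × ℝ =>
        (p.1 • 1 + souriau (δ (p.2 : UnitAddCircle)) : Matrix (Fin n) (Fin n) ℂ).det) F' (1, t) ∧
      ∀ y, F' y = (1 + souriau (δ t) + vecMulVec (cvec x) (cvec x)).det *
        (y.1 - Complex.I * crossingForm x (velocity δ t) * y.2) := by
  set W := (2 : ℝ) • toMatrix n (velocity δ t) with hW
  have h1 : HasFDerivAt (fun p : ℝ × ℝ => souriau (δ (p.2 : UnitAddCircle))) _ (1, t) :=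
    HasFDerivAt.comp (g := fun s : ℝ => souriau (δ (s : UnitAddCircle))) (1, t)
      (hasDerivAt_souriau_loop hδ t).hasFDerivAt hasFDerivAt_snd
  have h2 : HasFDerivAt (fun p : ℝ × ℝ => p.1 • (1 : Matrix (Fin n) (Fin n) ℂ)) _ (1, t) :=
    (hasFDerivAt_fst (𝕜 := ℝ) (p := ((1 : ℝ), t))).smul_const 1
  have h3 := h2.add h1
  have hdet : HasFDerivAt (fun A : Matrix (Fin n) (Fin n) ℂ => A.det)
      (fderiv ℝ (fun A : Matrix (Fin n) (Fin n) ℂ => A.det) (1 + souriau (δ t)))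
      ((1 : ℝ) • 1 + souriau (δ t)) := by
    rw [one_smul]
    exact ((contDiff_det (m := 1)).differentiable one_ne_zero _).hasFDerivAt
  refine ⟨_, hdet.comp ((1 : ℝ), t) h3, fun y => ?_⟩
  refine (fderiv_det_apply h.mulVec_eq h.vecMul_eq h.dotProduct_eq h.det_ne
    (y.1 • 1 + y.2 • W)).trans ?_
  clear_value W
  rw [add_mulVec, dotProduct_add, smul_mulVec, smul_mulVec, one_mulVec, dotProduct_smul,
    dotProduct_smul, h.dotProduct_eq, hW, h.form_eq _ (hasDerivAt_velocity hδ t).2]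
  simp only [Complex.real_smul]
  ring

/-- Here the s-direction is S itself, and x·Sx = -1. The resulting change of sign against the
numerator is what cancels the mixed terms later. -/
theorem exists_hasFDerivAt_det_one_add_smul {δ : C(UnitAddCircle, Lambda n)}
    (hδ : IsSmoothLoop δ) {t : ℝ} {x : Fin n → ℝ} (h : IsCrossingVector (δ t) x) :
    ∃ K' : ℝ × ℝ →L[ℝ] ℂ,
      HasFDerivAt (fun p : ℝ × ℝ =>
        (1 + p.1 • souriau (δ (p.2 : UnitAddCircle)) : Matrix (Fin n) (Fin n) ℂ).det) K' (1, t) ∧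
      ∀ y, K' y = (1 + souriau (δ t) + vecMulVec (cvec x) (cvec x)).det *
        (-y.1 - Complex.I * crossingForm x (velocity δ t) * y.2) := by
  set W := (2 : ℝ) • toMatrix n (velocity δ t) with hW
  have h1 : HasFDerivAt (fun p : ℝ × ℝ => souriau (δ (p.2 : UnitAddCircle))) _ (1, t) :=
    HasFDerivAt.comp (g := fun s : ℝ => souriau (δ (s : UnitAddCircle))) (1, t)
      (hasDerivAt_souriau_loop hδ t).hasFDerivAt hasFDerivAt_snd
  have h2 : HasFDerivAt (fun p : ℝ × ℝ => p.1) _ (1, t) :=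
    hasFDerivAt_fst (𝕜 := ℝ) (p := ((1 : ℝ), t))
  have h3 := (h2.smul h1).const_add (1 : Matrix (Fin n) (Fin n) ℂ)
  have hdet : HasFDerivAt (fun A : Matrix (Fin n) (Fin n) ℂ => A.det)
      (fderiv ℝ (fun A : Matrix (Fin n) (Fin n) ℂ => A.det) (1 + souriau (δ t)))
      (1 + (1 : ℝ) • souriau (δ t)) := by
    rw [one_smul]
    exact ((contDiff_det (m := 1)).differentiable one_ne_zero _).hasFDerivAt
  refine ⟨_, hdet.comp ((1 : ℝ), t) h3, fun y => ?_⟩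
  refine (fderiv_det_apply h.mulVec_eq h.vecMul_eq h.dotProduct_eq h.det_ne
    ((1 : ℝ) • y.2 • W + y.1 • souriau (δ t))).trans ?_
  clear_value W
  rw [one_smul, add_mulVec, dotProduct_add, smul_mulVec, smul_mulVec, dotProduct_smul,
    dotProduct_smul, h.souriau_form, hW, h.form_eq _ (hasDerivAt_velocity hδ t).2]
  simp only [Complex.real_smul]
  ring

theorem IsTransverse.exists_isCrossingVector {δ : C(UnitAddCircle, Lambda n)}
    (hδ : IsSmoothLoop δ) (ht : IsTransverse δ) {t : ℝ} (h : (t : UnitAddCircle) ∈ crossings δ) :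
    ∃ x, IsCrossingVector (δ t) x ∧ crossingForm x (velocity δ t) ≠ 0 := by
  obtain ⟨h1, h2⟩ := ht t h
  obtain ⟨x, hx⟩ := LagrangianGr.exists_isCrossingVector h1
  exact ⟨x, hx, (hx.transverse_iff (hasDerivAt_velocity hδ t).2).1 h2⟩

theorem continuous_souriau_loop (δ : C(UnitAddCircle, Lambda n)) :
    Continuous fun t : ℝ => souriau (δ (t : UnitAddCircle)) :=
  continuous_souriau.comp (δ.continuous.comp (AddCircle.continuous_mk' 1))

theorem IsTransverse.finite_crossings {δ : C(UnitAddCircle, Lambda n)}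
    (hδ : IsSmoothLoop δ) (ht : IsTransverse δ) : (crossings δ).Finite := by
  -- At a transverse crossing det(1 + S) has a simple zero in t, so crossings are isolated; an
  -- infinite set of them would accumulate in [0, 1].
  have hiso : ∀ t : ℝ, ∀ᶠ s : ℝ in 𝓝[≠] t, (s : UnitAddCircle) ∉ crossings δ := by
    intro t
    by_cases h : (t : UnitAddCircle) ∈ crossings δ
    · obtain ⟨x, hx, hq⟩ := ht.exists_isCrossingVector hδ h
      obtain ⟨F', hF, hF'⟩ := exists_hasFDerivAt_det_smul_add hδ hx
      have h1 : HasDerivAt (fun s : ℝ => ((1 : ℝ), s)) ((0 : ℝ), (1 : ℝ)) t :=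
        (hasDerivAt_const t (1 : ℝ)).prodMk (hasDerivAt_id t)
      have h2 := hF.comp_hasDerivAt t h1
      have h3 : F' (0, 1) ≠ 0 := by
        rw [hF']
        simpa [hq] using hx.det_ne
      filter_upwards [h2.eventually_ne (c := 0) h3] with s hs hc
      apply hs
      have := (mem_maslovCycle_iff _).1 hc
      simpa using this
    · have hc : Continuous fun s : ℝ => (1 + souriau (δ (s : UnitAddCircle))).det :=
        (continuous_const.add (continuous_souriau_loop δ)).matrix_det
      have h1 : (1 + souriau (δ (t : UnitAddCircle))).det ≠ 0 :=
        fun h0 => h ((mem_maslovCycle_iff _).2 h0)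
      filter_upwards [nhdsWithin_le_nhds (hc.continuousAt.eventually_ne h1)] with s hs hc
      exact hs ((mem_maslovCycle_iff _).1 hc)
  set A : Set ℝ := {t ∈ Set.Icc 0 1 | (t : UnitAddCircle) ∈ crossings δ} with hA
  have hfin : A.Finite := by
    by_contra hinf
    obtain ⟨t, -, hacc⟩ := Set.Infinite.exists_accPt_of_subset_isCompact hinf isCompact_Icc
      (fun t ht => ht.1)
    obtain ⟨s, hs1, hs2⟩ := ((accPt_iff_frequently_nhdsNE.1 hacc).and_eventually (hiso t)).exists
    exact hs2 hs1.2
  refine (hfin.image fun t : ℝ => (t : UnitAddCircle)).subset fun θ hθ => ?_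
  obtain ⟨t, ht, rfl⟩ := AddCircle.coe_image_Icc_eq (1 : ℝ) 0 ▸ Set.mem_univ θ
  rw [zero_add] at ht
  exact ⟨t, ⟨ht, hθ⟩, rfl⟩

/-- The signed number of crossings of a transverse smooth loop is its Maslov class. -/
theorem IsTransverse.signedCount_eq_maslov {δ : C(UnitAddCircle, Lambda n)}
    (hδ : IsSmoothLoop δ) (ht : IsTransverse δ) : signedCount δ = maslov δ := by
  classical
  have hfin := ht.finite_crossings hδ
  set Z := hfin.toFinset with hZ
  have hmem : ∀ θ, θ ∈ Z ↔ θ ∈ crossings δ := fun θ => hfin.mem_toFinset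
  set ε := crossingSign δ with hε
  have hsign : ∀ t : ℝ, (t : UnitAddCircle) ∈ Z → ∃ x, IsCrossingVector (δ t) x ∧
      0 < crossingForm x (velocity δ t) * (ε t) ∧ (ε t = 1 ∨ ε t = -1) := by
    intro t h
    obtain ⟨x, hx, hq⟩ := ht.exists_isCrossingVector hδ ((hmem _).1 h)
    refine ⟨x, hx, ?_⟩
    rw [hε, hx.crossingSign_eq hδ]
    rcases lt_or_gt_of_ne hq with hq | hq
    · rw [sign_neg hq]
      simpa using hq
    · rw [sign_pos hq]
      simpa using hq
  let S : C(UnitAddCircle, unitaryGroup (Fin n) ℂ) :=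
    ⟨fun t => ⟨souriau (δ t), souriau_mem_unitary (δ t)⟩,
      continuous_induced_rng.2 (continuous_souriau.comp δ.continuous)⟩
  -- The loops to be compared are F/K and ∏ f/k at fixed s. They are antipodal exactly where F ∏ k +
  -- K ∏ f = 0, an expression without denominators that also makes sense at s = 1.
  let F : ℝ × ℝ → ℂ := fun p => (p.1 • 1 + souriau (δ (p.2 : UnitAddCircle))).det
  let K : ℝ × ℝ → ℂ := fun p => (1 + p.1 • souriau (δ (p.2 : UnitAddCircle))).det
  let f : UnitAddCircle → ℝ × ℝ → ℂ := fun θ p => p.1 + modelLoop (ε θ) θ (p.2 : UnitAddCircle)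
  let k : UnitAddCircle → ℝ × ℝ → ℂ := fun θ p => 1 + p.1 * modelLoop (ε θ) θ (p.2 : UnitAddCircle)
  have hfk : ∀ θ (t : ℝ), f θ (1, t) = k θ (1, t) := fun θ t => by simp [f, k]
  have hz : ∀ θ (t : ℝ), HasFDerivAt (fun p : ℝ × ℝ => (modelLoop (ε θ) θ (p.2 : UnitAddCircle) : ℂ))
      ((ContinuousLinearMap.toSpanSingleton ℝ (2 * Real.pi * (ε θ) * Complex.I *
        modelLoop (ε θ) θ (t : UnitAddCircle))).comp (ContinuousLinearMap.snd ℝ ℝ ℝ)) (1, t) := by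
    intro θ t
    obtain ⟨τ, rfl⟩ := QuotientAddGroup.mk_surjective θ
    exact HasFDerivAt.comp (g := fun s : ℝ => (modelLoop (ε (τ : UnitAddCircle)) (τ : UnitAddCircle)
      (s : UnitAddCircle) : ℂ)) (1, t) (hasDerivAt_modelLoop _ τ t).hasFDerivAt hasFDerivAt_snd
  have hs : ∀ t : ℝ, HasFDerivAt (fun p : ℝ × ℝ => (p.1 : ℂ))
      (Complex.ofRealCLM.comp (ContinuousLinearMap.fst ℝ ℝ ℝ)) (1, t) := fun t =>
    Complex.ofRealCLM.hasFDerivAt.comp (1, t) hasFDerivAt_fst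
  have hf : ∀ θ (t : ℝ), HasFDerivAt (f θ) _ (1, t) := fun θ t => (hs t).add (hz θ t)
  have hk : ∀ θ (t : ℝ), HasFDerivAt (k θ) _ (1, t) := fun θ t => ((hs t).mul (hz θ t)).const_add 1
  -- The restriction to s < 1 is needed because the expression vanishes at (1, t) when t is a
  -- crossing.
  have hlocal : ∀ t : ℝ, ∀ᶠ p in 𝓝 ((1 : ℝ), t), p.1 < 1 →
      F p * ∏ θ ∈ Z, k θ p + K p * ∏ θ ∈ Z, f θ p ≠ 0 := by
    intro t
    by_cases h : (t : UnitAddCircle) ∈ Z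
    · obtain ⟨x, hx, hq, he⟩ := hsign t h
      obtain ⟨F', hF, hF'⟩ := exists_hasFDerivAt_det_smul_add hδ hx
      obtain ⟨K', hK, hK'⟩ := exists_hasFDerivAt_det_one_add_smul hδ hx
      set θ₀ : UnitAddCircle := (t : UnitAddCircle)
      have hm1 : (modelLoop (ε θ₀) θ₀ θ₀ : ℂ) = -1 := by
        rw [modelLoop_coe]
        simp
      have hm2 : (modelLoop (ε θ₀) θ₀ (t : UnitAddCircle) : ℂ) = -1 := hm1
      have hk0 : k θ₀ (1, t) = 0 := by
        change 1 + ((1 : ℝ) : ℂ) * (modelLoop (ε θ₀) θ₀ θ₀ : ℂ) = 0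
        rw [hm1]
        simp
      have hf0 : f θ₀ (1, t) = 0 := (hfk θ₀ t).trans hk0
      have hdet : (1 + souriau (δ (t : UnitAddCircle))).det = 0 :=
        (mem_maslovCycle_iff _).1 ((hmem _).1 h)
      -- At s = 1 the numerators and denominators of the other model loops coincide, so they
      -- contribute the same nonzero constant m to both products.
      set m := ∏ θ ∈ Z.erase θ₀, k θ (1, t) with hm
      have hm' : ∏ θ ∈ Z.erase θ₀, f θ (1, t) = m := Finset.prod_congr rfl fun θ _ => hfk θ t
      have hm0 : m ≠ 0 := by
        refine Finset.prod_ne_zero_iff.2 fun θ hθ => ?_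
        obtain ⟨hne, hθZ⟩ := Finset.mem_erase.1 hθ
        obtain ⟨τ, rfl⟩ := QuotientAddGroup.mk_surjective θ
        obtain ⟨-, -, -, he'⟩ := hsign τ hθZ
        change 1 + ((1 : ℝ) : ℂ) * (modelLoop _ _ θ₀ : ℂ) ≠ 0
        rw [Complex.ofReal_one, one_mul]
        exact one_add_modelLoop_ne_zero he' hne.symm
      have hkp : DifferentiableAt ℝ (fun p => ∏ θ ∈ Z.erase θ₀, k θ p) (1, t) := by
        exact (HasFDerivAt.finsetProd (u := Z.erase θ₀) (g := k)
          fun θ _ => hk θ t).differentiableAt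
      have hfp : DifferentiableAt ℝ (fun p => ∏ θ ∈ Z.erase θ₀, f θ p) (1, t) := by
        exact (HasFDerivAt.finsetProd (u := Z.erase θ₀) (g := f)
          fun θ _ => hf θ t).differentiableAt
      have hkk := (hk θ₀ t).mul hkp.hasFDerivAt
      have hff := (hf θ₀ t).mul hfp.hasFDerivAt
      -- The model loop passes through -1 with angular speed 2πε, whose sign is by construction that
      -- of the crossing form.
      have hr : 0 < crossingForm x (velocity δ θ₀) * (2 * Real.pi * (ε θ₀)) := by
        have := mul_pos (mul_pos two_pos Real.pi_pos) hq
        linarith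
      have := eventually_mul_add_mul_ne_zero hF hK hff hkk (by simpa using hdet)
        (by simpa using hdet) (by simp [hf0]) (by simp [hk0]) hx.det_ne hm0 hr hF' hK' ?_ ?_
      · filter_upwards [this] with p hp hp1
        rw [← Finset.mul_prod_erase Z _ h, ← Finset.mul_prod_erase Z (fun θ => f θ p) h]
        exact hp fun h0 => by rw [h0] at hp1; exact lt_irrefl _ hp1
      · intro y
        simp [hf0, hm']
        rw [hm2]
        ring
      · intro y
        simp [hk0, ← hm]
        rw [hm2]
        ring
    · have hFc : Continuous F := ((continuous_fst.smul continuous_const).add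
        ((continuous_souriau_loop δ).comp continuous_snd)).matrix_det
      have hKc : Continuous K := (continuous_const.add (continuous_fst.smul
        ((continuous_souriau_loop δ).comp continuous_snd))).matrix_det
      have hkc : ContinuousAt (fun p => ∏ θ ∈ Z, k θ p) (1, t) :=
        tendsto_finsetProd _ fun θ _ => (hk θ t).continuousAt
      have hfc : ContinuousAt (fun p => ∏ θ ∈ Z, f θ p) (1, t) :=
        tendsto_finsetProd _ fun θ _ => (hf θ t).continuousAt
      -- At s = 1 one has F = K and f = k, so away from the crossings the sum is twice a product of
      -- nonzero factors.
      have hne : F (1, t) * ∏ θ ∈ Z, k θ (1, t) + K (1, t) * ∏ θ ∈ Z, f θ (1, t) ≠ 0 := by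
        have h1 : F (1, t) = K (1, t) := by simp [F, K]
        have h2 : K (1, t) ≠ 0 := by
          intro h0
          apply h
          rw [hmem]
          exact (mem_maslovCycle_iff _).2 (by simpa [K] using h0)
        have h3 : ∏ θ ∈ Z, k θ (1, t) ≠ 0 := by
          refine Finset.prod_ne_zero_iff.2 fun θ hθ => ?_
          obtain ⟨τ, rfl⟩ := QuotientAddGroup.mk_surjective θ
          obtain ⟨-, -, -, he'⟩ := hsign τ hθ
          change 1 + ((1 : ℝ) : ℂ) * (modelLoop _ _ (t : UnitAddCircle) : ℂ) ≠ 0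
          rw [Complex.ofReal_one, one_mul]
          exact one_add_modelLoop_ne_zero he' fun h0 => h (h0 ▸ hθ)
        rw [h1, Finset.prod_congr rfl fun θ _ => hfk θ t, ← two_mul]
        exact mul_ne_zero two_ne_zero (mul_ne_zero h2 h3)
      filter_upwards [((hFc.continuousAt.mul hkc).add
        (hKc.continuousAt.mul hfc)).eventually_ne hne] with p hp _
      exact hp
  -- Compactness of the time interval yields one s < 1 that works for all t.
  have hunif : ∀ᶠ s in 𝓝 (1 : ℝ), ∀ t ∈ Set.Icc (0 : ℝ) 1, s < 1 →
      F (s, t) * ∏ θ ∈ Z, k θ (s, t) + K (s, t) * ∏ θ ∈ Z, f θ (s, t) ≠ 0 :=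
    isCompact_Icc.eventually_forall_of_forall_eventually
      (P := fun s t => s < 1 → F (s, t) * ∏ θ ∈ Z, k θ (s, t) + K (s, t) * ∏ θ ∈ Z, f θ (s, t) ≠ 0)
      fun t _ => hlocal t
  obtain ⟨s, ⟨hs1, hs0⟩, hs2⟩ := ((hunif.filter_mono nhdsWithin_le_nhds).and
    (nhdsWithin_le_nhds (lt_mem_nhds (zero_lt_one' ℝ)))).and
    (self_mem_nhdsWithin : Set.Iio (1 : ℝ) ∈ 𝓝[<] (1 : ℝ)) |>.exists
  let σ : Set.Ico (0 : ℝ) 1 := ⟨s, hs0.le, hs2⟩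
  have hdeg : degree (blaschkeLoop S σ) =
      degree (∏ θ ∈ Z, blaschkeLoop (scalarUnitary (modelLoop (ε θ) θ)) σ) := by
    refine degree_eq_of_forall_ne_neg _ _ fun θ h0 => ?_
    obtain ⟨t, ht, rfl⟩ := AddCircle.coe_image_Icc_eq (1 : ℝ) 0 ▸ Set.mem_univ θ
    rw [zero_add] at ht
    refine hs1 t ht hs2 ?_
    have h1 := congrArg (fun z : Circle => (z : ℂ)) h0
    have h2 : ((∏ θ ∈ Z, blaschkeLoop (scalarUnitary (modelLoop (ε θ) θ)) σ)
        (t : UnitAddCircle) : ℂ) = ∏ θ ∈ Z, f θ (s, t) / k θ (s, t) := by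
      rw [ContinuousMap.prod_apply]
      refine (map_prod Circle.coeHom _ Z).trans ?_
      refine Finset.prod_congr rfl fun θ _ => ?_
      exact blaschkeLoop_scalarUnitary _ σ t
    have h3 : K (s, t) ≠ 0 := det_one_add_smul_ne_zero (souriau_mem_unitary _) hs0.le hs2
    have h4 : ∏ θ ∈ Z, k θ (s, t) ≠ 0 :=
      Finset.prod_ne_zero_iff.2 fun θ _ => one_add_mul_circle_ne_zero _ hs0.le hs2
    simp only [Circle.coe_neg] at h1
    rw [h2, Finset.prod_div_distrib] at h1
    have h5 : F (s, t) / K (s, t) = -((∏ θ ∈ Z, f θ (s, t)) / ∏ θ ∈ Z, k θ (s, t)) := h1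
    field_simp at h5
    linear_combination h5
  rw [degree_prod, degree_blaschkeLoop S σ ((DetSq n).comp δ) fun t => (det_souriau (δ t)).symm]
    at hdeg
  rw [maslov, hdeg, signedCount, finsum_mem_eq_finite_toFinset_sum _ hfin]
  refine Finset.sum_congr rfl fun θ _ => ?_
  rw [degree_blaschkeLoop _ σ (modelLoop (ε θ) θ), degree_modelLoop]
  intro t
  simp [scalarUnitary]

end

/-! ### Transverse paths -/

section

open Matrix

attribute [local instance] Matrix.linftyOpNormedRing Matrix.linftyOpNormedAlgebra

variable {n : ℕ}

/-- A curve meets the Maslov cycle at the time `t`, if at all, only in the principal stratum and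
transversally. -/
def TransverseAt (c : ℝ → Lambda n) (t : ℝ) : Prop :=
  c t ∈ maslovCycle n → c t ∈ stratum n 1 ∧
    ∀ u ∈ tangentVectors Set.univ (c t), ∃ a : ℝ, ∃ w ∈ tangentVectors (stratum n 1) (c t),
      u = a • deriv (fun s => proj (c s)) t + w

theorem TransverseAt.congr {c d : ℝ → Lambda n} {t : ℝ} (h : TransverseAt c t)
    (hcd : c =ᶠ[𝓝 t] d) : TransverseAt d t := by
  have h1 : (fun s => proj (c s)) =ᶠ[𝓝 t] fun s => proj (d s) :=
    hcd.mono fun s hs => by simp only [hs]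
  rw [TransverseAt, ← hcd.eq_of_nhds, ← h1.deriv_eq]
  exact h

theorem TransverseAt.comp {c : ℝ → Lambda n} {ψ : ℝ → ℝ} {ψ' t : ℝ} (h : TransverseAt c (ψ t))
    (hc : DifferentiableAt ℝ (fun s => proj (c s)) (ψ t)) (hψ : HasDerivAt ψ ψ' t) (h0 : ψ' ≠ 0) :
    TransverseAt (fun s => c (ψ s)) t := by
  intro hmem
  obtain ⟨h1, h2⟩ := h hmem
  refine ⟨h1, fun u hu => ?_⟩
  obtain ⟨a, w, hw, rfl⟩ := h2 u hu
  have h3 : deriv (fun s => proj (c (ψ s))) t = ψ' • deriv (fun s => proj (c s)) (ψ t) :=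
    (hc.hasDerivAt.scomp t hψ).deriv
  refine ⟨a / ψ', w, hw, ?_⟩
  rw [h3, smul_smul, div_mul_cancel₀ _ h0]

theorem transverseAt_of_notMem {c : ℝ → Lambda n} {t : ℝ} (h : c t ∉ maslovCycle n) :
    TransverseAt c t := fun h' => absurd h' h

theorem transverseAt_chart (a : ℝ) {f : ℝ → symmMatrix n} {D : symmMatrix n} {t : ℝ}
    (hf : HasDerivAt (fun s => (f s).1) D.1 t)
    (hx : (f t).1.det = 0 → ∃ x, IsKernelVector (f t).1 x ∧ x ⬝ᵥ (D.1 *ᵥ x) ≠ 0) :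
    TransverseAt (fun s => chart a (f s)) t := by
  intro hmem
  obtain ⟨x, hx, hD⟩ := hx ((chart_mem_maslovCycle_iff a (f t)).1 hmem)
  refine ⟨(chart_mem_stratum_iff a (f t) 1).2 hx.finrank_ker, ?_⟩
  rw [(hasDerivAt_chart a hf).deriv]
  refine ((hx.isCrossingVector a (f t)).transverse_iff
    ((mem_tangentVectors_univ_iff a (f t) _).2 ⟨D, rfl⟩)).2 ?_
  rw [crossingForm_chartTangent a (f t) hx.mulVec_eq]
  exact mul_ne_zero (by norm_num) hD

/-- A smooth path that is constant near its end points and transverse to the Maslov cycle. -/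
structure IsTransversePath {x y : Lambda n} (p : Path x y) : Prop where
  contDiff : ContDiff ℝ ∞ fun t => proj (p.extend t)
  source : ∀ᶠ t in 𝓝 (0 : ℝ), p.extend t = x
  target : ∀ᶠ t in 𝓝 (1 : ℝ), p.extend t = y
  transverseAt : ∀ t, TransverseAt p.extend t

theorem isTransversePath_refl {x : Lambda n} (hx : x ∉ maslovCycle n) :
    IsTransversePath (Path.refl x) := by
  refine ⟨?_, ?_, ?_, fun t => transverseAt_of_notMem ?_⟩ <;> simp [Path.refl_extend, hx]
  exact contDiff_const

theorem IsTransversePath.symm {x y : Lambda n} {p : Path x y} (hp : IsTransversePath p) :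
    IsTransversePath p.symm := by
  have hc : Continuous fun t : ℝ => 1 - t := by fun_prop
  refine ⟨?_, ?_, ?_, fun t => ?_⟩
  · simp only [Path.extend_symm_apply]
    exact hp.contDiff.comp (contDiff_const.sub contDiff_id)
  · simp only [Path.extend_symm_apply]
    exact (hc.tendsto' 0 1 (by simp)).eventually hp.target
  · simp only [Path.extend_symm_apply]
    exact (hc.tendsto' 1 0 (by simp)).eventually hp.source
  · rw [Path.extend_symm]
    exact (hp.transverseAt (1 - t)).comp (hp.contDiff.differentiable (by simp) _)
      ((hasDerivAt_id t).const_sub 1) (by norm_num)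

theorem IsTransversePath.trans {x y z : Lambda n} {p : Path x y} {q : Path y z}
    (hp : IsTransversePath p) (hq : IsTransversePath q) : IsTransversePath (p.trans q) := by
  have hc1 : Continuous fun t : ℝ => 2 * t := by fun_prop
  have hc2 : Continuous fun t : ℝ => 2 * t - 1 := by fun_prop
  have hd1 : ∀ t : ℝ, HasDerivAt (fun t : ℝ => 2 * t) 2 t := fun t => by
    simpa using (hasDerivAt_id t).const_mul (2 : ℝ)
  have hd2 : ∀ t : ℝ, HasDerivAt (fun t : ℝ => 2 * t - 1) 2 t := fun t => (hd1 t).sub_const 1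
  have hl : ∀ t < 1 / 2, (fun s => p.extend (2 * s)) =ᶠ[𝓝 t] (p.trans q).extend := fun t ht => by
    filter_upwards [Iio_mem_nhds ht] with s hs
    rw [Path.extend_trans_of_le_half _ _ (le_of_lt hs)]
  have hr : ∀ t > 1 / 2, (fun s => q.extend (2 * s - 1)) =ᶠ[𝓝 t] (p.trans q).extend :=
    fun t ht => by
      filter_upwards [Ioi_mem_nhds ht] with s hs
      rw [Path.extend_trans_of_half_le _ _ (le_of_lt hs)]
  have hm : (fun _ => y) =ᶠ[𝓝 (1 / 2 : ℝ)] (p.trans q).extend := by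
    filter_upwards [(hc1.tendsto' (1 / 2) 1 (by norm_num)).eventually hp.target,
      (hc2.tendsto' (1 / 2) 0 (by norm_num)).eventually hq.source] with s h1 h2
    rcases le_total s (1 / 2) with h | h
    · rw [Path.extend_trans_of_le_half _ _ h, h1]
    · rw [Path.extend_trans_of_half_le _ _ h, h2]
  have hproj : ∀ {c d : ℝ → Lambda n} {t : ℝ}, c =ᶠ[𝓝 t] d →
      (fun s => proj (d s)) =ᶠ[𝓝 t] fun s => proj (c s) :=
    fun h => h.mono fun s hs => by simp only [hs]
  refine ⟨contDiff_iff_contDiffAt.2 fun t => ?_, ?_, ?_, fun t => ?_⟩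
  · rcases lt_trichotomy t (1 / 2) with h | h | h
    · refine ContDiffAt.congr_of_eventuallyEq ?_ (hproj (hl t h))
      exact (hp.contDiff.comp (contDiff_const.mul contDiff_id)).contDiffAt
    · rw [h]
      exact contDiffAt_const.congr_of_eventuallyEq (hproj hm)
    · refine ContDiffAt.congr_of_eventuallyEq ?_ (hproj (hr t h))
      exact (hq.contDiff.comp ((contDiff_const.mul contDiff_id).sub contDiff_const)).contDiffAt
  · filter_upwards [(hc1.tendsto' 0 0 (by norm_num)).eventually hp.source,
      hl 0 (by norm_num)] with s h1 h2
    rw [← h2, h1]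
  · filter_upwards [(hc2.tendsto' 1 1 (by norm_num)).eventually hq.target,
      hr 1 (by norm_num)] with s h1 h2
    rw [← h2, h1]
  · rcases lt_trichotomy t (1 / 2) with h | h | h
    · exact ((hp.transverseAt (2 * t)).comp (hp.contDiff.differentiable (by simp) _) (hd1 t)
        two_ne_zero).congr (hl t h)
    · rw [h]
      refine TransverseAt.congr ?_ hm
      -- The glued path is constant near the junction, and for a constant path transversality does
      -- not depend on the time.
      have h1 : TransverseAt (fun _ => y) 1 := (hp.transverseAt 1).congr hp.target
      simpa [TransverseAt] using h1
    · exact (TransverseAt.comp (ψ := fun t => 2 * t - 1) (hq.transverseAt (2 * t - 1)) (hq.contDiff.differentiable (by simp) _) (hd2 t)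
        two_ne_zero).congr (hr t h)

/-! ### Smooth transverse segments in a chart -/

theorem exists_hasDerivAt_smoothTransition {x : ℝ} (h0 : 0 < x) (h1 : x < 1) :
    ∃ d ≠ 0, HasDerivAt Real.smoothTransition d x := by
  have hg : ∀ y > 0, HasDerivAt expNegInvGlue (expNegInvGlue y * (y ^ 2)⁻¹) y := by
    intro y hy
    have h1 : HasDerivAt (fun y : ℝ => Real.exp (-y⁻¹)) (Real.exp (-y⁻¹) * (y ^ 2)⁻¹) y := by
      have := ((hasDerivAt_inv hy.ne').neg).exp
      simpa using this
    have h2 : expNegInvGlue =ᶠ[𝓝 y] fun y : ℝ => Real.exp (-y⁻¹) := by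
      filter_upwards [lt_mem_nhds hy] with z hz
      simp [expNegInvGlue, not_le.2 hz]
    have := h1.congr_of_eventuallyEq h2
    rwa [← h2.eq_of_nhds] at this
  have hy : 0 < 1 - x := by linarith
  have e1 := hg x h0
  have e2 : HasDerivAt (fun x => expNegInvGlue (1 - x))
      (-(expNegInvGlue (1 - x) * ((1 - x) ^ 2)⁻¹)) x := by
    simpa using (hg (1 - x) hy).comp_const_sub 1 x
  have hpos := Real.smoothTransition.pos_denom x
  refine ⟨_, ?_, e1.div (e1.add e2) hpos.ne'⟩
  have p1 := expNegInvGlue.pos_of_pos h0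
  have p2 := expNegInvGlue.pos_of_pos hy
  have p3 : 0 < (x ^ 2)⁻¹ := by positivity
  have p4 : 0 < ((1 - x) ^ 2)⁻¹ := by positivity
  refine (div_pos ?_ (pow_pos hpos 2)).ne'
  -- With g = `expNegInvGlue`, the numerator of the quotient rule is g(x)g(1 - x)(x⁻² + (1 - x)⁻²).
  have := mul_pos (mul_pos p1 p2) (add_pos p3 p4)
  change 0 < _ * (expNegInvGlue x + expNegInvGlue (1 - x)) - _
  nlinarith

/-- A reparametrization that is constant near the end points. -/
def plateau (t : ℝ) : ℝ := Real.smoothTransition (3 * t - 1)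

theorem plateau_of_le {t : ℝ} (h : t ≤ 1 / 3) : plateau t = 0 :=
  Real.smoothTransition.zero_of_nonpos (by linarith)

theorem plateau_of_ge {t : ℝ} (h : 2 / 3 ≤ t) : plateau t = 1 :=
  Real.smoothTransition.one_of_one_le (by linarith)

theorem contDiff_plateau : ContDiff ℝ ∞ plateau :=
  Real.smoothTransition.contDiff.comp ((contDiff_const.mul contDiff_id).sub contDiff_const)

/-- The segment from `A` to `A + C`, constant near its end points. -/
def segmentPath (A C : symmMatrix n) : Path A (A + C) where
  toFun t := A + plateau t • C
  continuous_toFun := by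
    have := contDiff_plateau.continuous
    fun_prop
  source' := by simp [plateau_of_le]
  target' := by
    rw [Set.Icc.coe_one, plateau_of_ge (by norm_num), one_smul]

/-- For t ≤ 1/3 and t ≥ 2/3 the path rests at an end point off the cycle. In between the
reparametrization has nonzero derivative, so a crossing is transverse when C is nonzero on the
kernel vector. -/
theorem isTransversePath_segmentPath (a : ℝ) (A C : symmMatrix n) (hA : A.1.det ≠ 0)
    (hAC : (A + C).1.det ≠ 0) (h : ∀ s ∈ Set.Icc (0 : ℝ) 1, (A + s • C).1.det = 0 →
      ∃ x, IsKernelVector (A + s • C).1 x ∧ x ⬝ᵥ (C.1 *ᵥ x) ≠ 0) :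
    IsTransversePath ((segmentPath A C).map (continuous_chart a)) := by
  have hext : ∀ t, ((segmentPath A C).map (continuous_chart a)).extend t =
      chart a (A + plateau t • C) := by
    intro t
    rcases lt_or_ge t 0 with h0 | h0
    · rw [Path.extend_of_le_zero _ h0.le, plateau_of_le (by linarith), zero_smul, add_zero]
    rcases lt_or_ge 1 t with h1 | h1
    · rw [Path.extend_of_one_le _ h1.le, plateau_of_ge (by linarith), one_smul]
    · rw [Path.extend_apply _ ⟨h0, h1⟩]
      rfl
  have hext' := funext hext
  have hf : ∀ t d, HasDerivAt plateau d t →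
      HasDerivAt (fun s => (A + plateau s • C).1) (d • C).1 t :=
    fun t d hd => (hd.smul_const C.1).const_add A.1
  refine ⟨?_, ?_, ?_, fun t => ?_⟩
  · simp only [hext]
    refine contDiff_iff_contDiffAt.2 fun t => ?_
    refine contDiffAt_proj_iff.2 (contDiffAt_souriau_chart a ?_)
    exact (contDiff_const.add (contDiff_plateau.smul contDiff_const)).contDiffAt
  · filter_upwards [Iio_mem_nhds (show (0 : ℝ) < 1 / 3 by norm_num)] with t ht
    rw [hext, plateau_of_le (le_of_lt ht), zero_smul, add_zero]
  · filter_upwards [Ioi_mem_nhds (show (2 / 3 : ℝ) < 1 by norm_num)] with t ht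
    rw [hext, plateau_of_ge (le_of_lt ht), one_smul]
  · rw [hext']
    rcases le_or_gt t (1 / 3) with h0 | h0
    · refine transverseAt_of_notMem ?_
      rw [plateau_of_le h0, zero_smul, add_zero, chart_mem_maslovCycle_iff]
      exact hA
    rcases le_or_gt (2 / 3) t with h1 | h1
    · refine transverseAt_of_notMem ?_
      rw [plateau_of_ge h1, one_smul, chart_mem_maslovCycle_iff]
      exact hAC
    · obtain ⟨d, hd0, hd⟩ := exists_hasDerivAt_smoothTransition (x := 3 * t - 1)
        (by linarith) (by linarith)
      have hp : HasDerivAt plateau (d * 3) t := by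
        have h3 : HasDerivAt (fun t : ℝ => 3 * t - 1) 3 t := by
          simpa using ((hasDerivAt_id t).const_mul (3 : ℝ)).sub_const 1
        exact hd.comp t h3
      refine transverseAt_chart a (hf t _ hp) fun hdet => ?_
      obtain ⟨x, hx, hC⟩ := h (plateau t)
        ⟨Real.smoothTransition.nonneg _, Real.smoothTransition.le_one _⟩ hdet
      refine ⟨x, hx, ?_⟩
      rw [Submodule.coe_smul, smul_mulVec, dotProduct_smul, smul_eq_mul]
      exact mul_ne_zero (mul_ne_zero hd0 three_ne_zero) hC

/-- A direction in which an invertible symmetric matrix becomes positive definite, its eigenvalues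
crossing zero one at a time. -/
theorem exists_posDef_direction (A : symmMatrix n) (hA : A.1.det ≠ 0) :
    ∃ C : symmMatrix n, (A + C).1.PosDef ∧ ∀ s ∈ Set.Icc (0 : ℝ) 1, (A + s • C).1.det = 0 →
      ∃ x, IsKernelVector (A + s • C).1 x ∧ x ⬝ᵥ (C.1 *ᵥ x) ≠ 0 := by
  have hH : A.1.IsHermitian := by
    change star A.1 = A.1
    rw [star_eq_conjTranspose, conjTranspose_eq_transpose_of_trivial]
    exact A.2
  set μ := hH.eigenvalues with hμ
  set U : Matrix (Fin n) (Fin n) ℝ := (hH.eigenvectorUnitary : Matrix (Fin n) (Fin n) ℝ) with hU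
  have hU1 : Uᵀ * U = 1 := by
    have := Matrix.UnitaryGroup.star_mul_self hH.eigenvectorUnitary
    rwa [star_eq_conjTranspose, conjTranspose_eq_transpose_of_trivial] at this
  have hU2 : U * Uᵀ = 1 := mul_eq_one_comm.1 hU1
  have hspec : A.1 = U * diagonal μ * Uᵀ := by
    have := hH.spectral_theorem
    rw [Unitary.conjStarAlgAut_apply, star_eq_conjTranspose,
      conjTranspose_eq_transpose_of_trivial] at this
    exact this
  have hdet : ∀ d : Fin n → ℝ, (U * diagonal d * Uᵀ).det = ∏ i, d i := by
    intro d
    rw [det_mul, det_mul, mul_right_comm, ← det_mul, hU2, det_one, one_mul, det_diagonal]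
  have hμ0 : ∀ i, μ i ≠ 0 := by
    rw [hspec, hdet] at hA
    exact fun i => Finset.prod_ne_zero_iff.1 hA i (Finset.mem_univ i)
  -- A negative eigenvalue becomes μᵢ(1 - s(i + 2)), which vanishes at s = 1/(i + 2). These times
  -- are distinct, so each kernel is a line; with i + 2 rather than i + 1 the final value -(i + 1)μᵢ
  -- is positive for i = 0 too.
  let c : Fin n → ℝ := fun i => if μ i < 0 then -μ i * ((i : ℕ) + 2) else 0
  have hCsymm : U * diagonal c * Uᵀ ∈ symmMatrix n := by
    change (U * diagonal c * Uᵀ)ᵀ = _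
    rw [transpose_mul, transpose_mul, transpose_transpose, diagonal_transpose, mul_assoc]
  have hsum : ∀ s : ℝ, A.1 + s • (U * diagonal c * Uᵀ) =
      U * diagonal (fun i => μ i + s * c i) * Uᵀ := by
    intro s
    rw [hspec, ← smul_mul_assoc, ← mul_smul_comm, ← add_mul, ← mul_add, ← diagonal_smul,
      diagonal_add]
    rfl
  have hzero : ∀ (s : ℝ) (i : Fin n), μ i + s * c i = 0 → μ i < 0 ∧ s * ((i : ℕ) + 2) = 1 := by
    intro s i h
    by_cases hi : μ i < 0
    · simp only [c, if_pos hi] at h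
      refine ⟨hi, ?_⟩
      have : μ i * (1 - s * ((i : ℕ) + 2)) = 0 := by linear_combination h
      rcases mul_eq_zero.1 this with h' | h'
      · exact absurd h' (hμ0 i)
      · linarith
    · simp only [c, if_neg hi, mul_zero, add_zero] at h
      exact absurd h (hμ0 i)
  refine ⟨⟨_, hCsymm⟩, ?_, ?_⟩
  · have h1 : (A + ⟨_, hCsymm⟩ : symmMatrix n).1 = U * diagonal (fun i => μ i + c i) * Uᵀ := by
      have := hsum 1
      simp only [one_smul, one_mul] at this
      exact this
    rw [h1]
    have h2 : (diagonal (fun i => μ i + c i)).PosDef := by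
      refine posDef_diagonal_iff.2 fun i => ?_
      by_cases hi : μ i < 0
      · simp only [c, if_pos hi]
        have : (0 : ℝ) ≤ (i : ℕ) := Nat.cast_nonneg _
        nlinarith
      · simp only [c, if_neg hi, add_zero]
        exact lt_of_le_of_ne (not_lt.1 hi) (hμ0 i).symm
    have h3 := h2.conjTranspose_mul_mul_same (B := Uᵀ) (mulVec_injective_of_isUnit
      (IsUnit.of_mul_eq_one _ hU1))
    rwa [conjTranspose_eq_transpose_of_trivial, transpose_transpose] at h3
  · intro s _ hs
    have h1 : (A + s • ⟨_, hCsymm⟩ : symmMatrix n).1 =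
      U * diagonal (fun i => μ i + s * c i) * Uᵀ := hsum s
    rw [h1] at hs ⊢
    rw [hdet, Finset.prod_eq_zero_iff] at hs
    obtain ⟨i, -, hi⟩ := hs
    obtain ⟨hneg, hsi⟩ := hzero s i hi
    set e : Fin n → ℝ := Pi.single i 1
    have hUe : Uᵀ *ᵥ (U *ᵥ e) = e := by rw [mulVec_mulVec, hU1, one_mulVec]
    have hdot : ∀ v, (U *ᵥ e) ⬝ᵥ (U *ᵥ v) = e ⬝ᵥ v := by
      intro v
      rw [dotProduct_mulVec, ← mulVec_transpose, hUe]
    refine ⟨U *ᵥ e, ⟨?_, ?_, ?_⟩, ?_⟩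
    · rw [← mulVec_mulVec, hUe, ← mulVec_mulVec]
      have : diagonal (fun i => μ i + s * c i) *ᵥ e = 0 := by
        ext j
        rw [mulVec_diagonal]
        by_cases hj : j = i
        · rw [hj, hi, zero_mul, Pi.zero_apply]
        · simp [e, hj]
      rw [this, mulVec_zero]
    · rw [hdot]
      simp [e]
    · have h2 : vecMulVec (U *ᵥ e) (U *ᵥ e) = U * diagonal e * Uᵀ := by
        have h3 : diagonal e = vecMulVec e e := by
          ext j k
          rw [vecMulVec_apply, diagonal_apply]
          by_cases hj : j = i
          · subst hj
            by_cases hk : j = k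
            · subst hk; simp [e]
            · simp [e, hk, Ne.symm hk]
          · simp [e, hj]
        rw [h3, mul_vecMulVec, vecMulVec_mul, vecMul_transpose]
      rw [h2, ← add_mul, ← mul_add, diagonal_add, hdet]
      refine Finset.prod_ne_zero_iff.2 fun j _ => ?_
      by_cases hj : j = i
      · rw [hj, hi]
        simp [e]
      · simp only [e, Pi.single_eq_of_ne hj, add_zero]
        intro h0
        have h3 := (hzero s j h0).2
        have h4 : s * ((j : ℕ) - (i : ℕ) : ℝ) = 0 := by linear_combination h3 - hsi
        rcases mul_eq_zero.1 h4 with h5 | h5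
        · rw [h5] at h3
          simp at h3
        · exact hj (Fin.ext (by exact_mod_cast sub_eq_zero.1 h5))
    · change (U *ᵥ e) ⬝ᵥ ((U * diagonal c * Uᵀ) *ᵥ (U *ᵥ e)) ≠ 0
      rw [← mulVec_mulVec, hUe, ← mulVec_mulVec, hdot]
      have : e ⬝ᵥ (diagonal c *ᵥ e) = c i := by
        simp [e]
      rw [this]
      simp only [c, if_pos hneg]
      have : (0 : ℝ) ≤ (i : ℕ) := Nat.cast_nonneg _
      exact mul_ne_zero (neg_ne_zero.2 hneg.ne) (by linarith)

end

/-! ### Approximation of paths by transverse paths -/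

section

open Matrix

attribute [local instance] Matrix.linftyOpNormedRing Matrix.linftyOpNormedAlgebra

variable {n : ℕ}

theorem IsTransversePath.cast {x y x' y' : Lambda n} {p : Path x y} (hp : IsTransversePath p)
    (hx : x' = x) (hy : y' = y) : IsTransversePath (p.cast hx hy) := by
  subst hx hy
  exact hp

/-- Both ends are moved into the cone of positive definite matrices, which is convex and free of
crossings: A, A + C, B + D, B. -/
theorem exists_isTransversePath_chart (a : ℝ) (A B : symmMatrix n) (hA : A.1.det ≠ 0)
    (hB : B.1.det ≠ 0) :
    ∃ P : Path A B, IsTransversePath (P.map (continuous_chart a)) := by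
  obtain ⟨C, hC, hC'⟩ := exists_posDef_direction A hA
  obtain ⟨D, hD, hD'⟩ := exists_posDef_direction B hB
  have hAC := hC.det_pos.ne'
  have hBD := hD.det_pos.ne'
  have hpos : ∀ s ∈ Set.Icc (0 : ℝ) 1, ((A + C) + s • ((B + D) - (A + C))).1.det ≠ 0 := by
    intro s hs
    have h1 : ((A + C) + s • ((B + D) - (A + C))).1 = (1 - s) • (A + C).1 + s • (B + D).1 := by
      simp only [Submodule.coe_add, Submodule.coe_smul, Submodule.coe_sub]
      module
    rw [h1]
    rcases hs.1.eq_or_lt with h0 | h0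
    · rw [← h0, sub_zero, one_smul, zero_smul, add_zero]
      exact hAC
    · exact ((hD.smul h0).posSemidef_add (hC.posSemidef.smul (sub_nonneg.2 hs.2))).det_pos.ne'
  have hE : B + D = (A + C) + ((B + D) - (A + C)) := by abel
  have h1 := isTransversePath_segmentPath a A C hA hAC hC'
  have h2 := isTransversePath_segmentPath a (A + C) ((B + D) - (A + C)) hAC (hE ▸ hBD)
    fun s hs h => absurd h (hpos s hs)
  have h3 := (isTransversePath_segmentPath a B D hB hBD hD').symm
  have h2' : IsTransversePath (((segmentPath (A + C) ((B + D) - (A + C))).cast rfl hE).map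
    (continuous_chart a)) := h2.cast rfl (congrArg (chart a) hE)
  refine ⟨((segmentPath A C).trans ((segmentPath (A + C) ((B + D) - (A + C))).cast rfl hE)).trans
    (segmentPath B D).symm, ?_⟩
  rw [Path.map_trans, Path.map_trans]
  exact (h1.trans h2').trans h3

/-- The coordinates of a chart fill a vector space, where any two paths with the same ends are
homotopic. So any transverse path in the chart may replace q. -/
theorem exists_isTransversePath_of_det_ne_zero (a : ℝ) {x y : Lambda n} (q : Path x y)
    (hq : ∀ t, (param a • 1 + star (param a) • souriau (q t)).det ≠ 0) (hx : x ∉ maslovCycle n)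
    (hy : y ∉ maslovCycle n) : ∃ p : Path x y, IsTransversePath p ∧ p.Homotopic q := by
  have hx1 : chart a (coord a x) = x := chart_coord a (by simpa using hq 0)
  have hy1 : chart a (coord a y) = y := chart_coord a (by simpa using hq 1)
  generalize coord a x = A at hx1
  generalize coord a y = B at hy1
  subst hx1 hy1
  rw [chart_mem_maslovCycle_iff] at hx hy
  obtain ⟨P, hP⟩ := exists_isTransversePath_chart a A B hx hy
  let Q : Path A B :=
    { toFun := fun t => coord a (q t)
      continuous_toFun := continuous_iff_continuousAt.2 fun t =>
        (continuousAt_coord a (hq t)).comp q.continuous.continuousAt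
      source' := by rw [q.source, coord_chart]
      target' := by rw [q.target, coord_chart] }
  have hQ : Q.map (continuous_chart a) = q := by
    ext t
    exact chart_coord a (hq t)
  refine ⟨_, hP, ?_⟩
  rw [← hQ]
  have : ContractibleSpace (symmMatrix n) := RealTopologicalVectorSpace.contractibleSpace
  exact (SimplyConnectedSpace.paths_homotopic P Q).map ⟨chart a, continuous_chart a⟩

/-- A path that avoids the Maslov cycle at rational times is homotopic to a transverse path. -/
theorem exists_isTransversePath_homotopic {x y : Lambda n} (p : Path x y)
    (hp : ∀ t : unitInterval, (∃ r : ℚ, (r : ℝ) = t) → p t ∉ maslovCycle n) :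
    ∃ q : Path x y, IsTransversePath q ∧ q.Homotopic p := by
  let U : ℝ → Set unitInterval := fun a =>
    {t | (param a • 1 + star (param a) • souriau (p t)).det ≠ 0}
  have hU : ∀ a, IsOpen (U a) := by
    intro a
    have : Continuous fun t => (param a • 1 + star (param a) • souriau (p t)).det := by
      have h : Continuous fun t => souriau (p t) := continuous_souriau.comp p.continuous
      have h' : Continuous fun t => param a • 1 + star (param a) • souriau (p t) := by fun_prop
      exact h'.matrix_det
    exact isOpen_ne_fun this continuous_const
  obtain ⟨ε, hε, hball⟩ := lebesgue_number_lemma_of_metric isCompact_univ hU fun t _ =>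
    Set.mem_iUnion.2 (exists_det_chart_domain_ne_zero (p t))
  obtain ⟨N, hN⟩ := exists_nat_one_div_lt hε
  -- Steps below the Lebesgue number keep each piece in one chart. The division points are rational,
  -- so the path is off the cycle there and the chart lemma applies.
  let t : ℕ → unitInterval := fun k => Set.projIcc 0 1 zero_le_one ((k : ℝ) / (N + 1))
  have hN0 : (0 : ℝ) < N + 1 := by positivity
  have ht : ∀ k ≤ N + 1, (t k : ℝ) = k / (N + 1) := by
    intro k hk
    have : (k : ℝ) ≤ N + 1 := by exact_mod_cast hk
    exact congrArg Subtype.val (Set.projIcc_of_mem _ ⟨by positivity, (div_le_one hN0).2 this⟩)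
  have ht' : ∀ k ≤ N + 1, p (t k) ∉ maslovCycle n := fun k hk =>
    hp _ ⟨k / (N + 1), by rw [ht k hk]; push_cast; rfl⟩
  have ht0 : t 0 = 0 := by ext; rw [ht 0 (by simp)]; simp
  have ht1 : t (N + 1) = 1 := by ext; rw [ht _ le_rfl]; push_cast; rw [div_self hN0.ne']
  have hstep : ∀ k < N + 1, ∃ q : Path (p (t k)) (p (t (k + 1))),
      IsTransversePath q ∧ q.Homotopic (p.subpath (t k) (t (k + 1))) := by
    intro k hk
    obtain ⟨a, ha⟩ := hball (t k) (Set.mem_univ _)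
    refine exists_isTransversePath_of_det_ne_zero a _ (fun s => ?_) (ht' k hk.le) (ht' _ hk)
    have hle : t k ≤ t (k + 1) := by
      refine Set.monotone_projIcc _ ?_
      gcongr
      simp
    have hs : p.subpath (t k) (t (k + 1)) s ∈ p '' Set.Icc (t k) (t (k + 1)) := by
      rw [← Path.range_subpath_of_le p _ _ hle]
      exact Set.mem_range_self s
    obtain ⟨r, hr, hrs⟩ := hs
    rw [← hrs]
    refine ha ?_
    rw [Metric.mem_ball, Subtype.dist_eq, Real.dist_eq,
      abs_of_nonneg (sub_nonneg.2 (Subtype.coe_le_coe.2 hr.1))]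
    have h1 : (r : ℝ) ≤ t (k + 1) := hr.2
    rw [ht _ hk] at h1
    rw [ht _ hk.le]
    push_cast at h1
    rw [add_div] at h1
    linarith
  have hind : ∀ k ≤ N + 1, ∃ q : Path (p (t 0)) (p (t k)),
      IsTransversePath q ∧ q.Homotopic (p.subpath (t 0) (t k)) := by
    intro k
    induction k with
    | zero =>
      intro _
      refine ⟨Path.refl _, isTransversePath_refl (ht' 0 (by simp)), ?_⟩
      rw [Path.subpath_self]
    | succ k ih =>
      intro hk
      obtain ⟨q, hq, hq'⟩ := ih (by omega)
      obtain ⟨r, hr, hr'⟩ := hstep k (by omega)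
      exact ⟨q.trans r, hq.trans hr, (hq'.hcomp hr').trans
        ⟨Path.Homotopy.subpathTransSubpath p _ _ _⟩⟩
  obtain ⟨q, hq, hq'⟩ := hind (N + 1) le_rfl
  have h0 : x = p (t 0) := by rw [ht0, p.source]
  have h1 : y = p (t (N + 1)) := by rw [ht1, p.target]
  refine ⟨q.cast h0 h1, hq.cast h0 h1, ?_⟩
  have h2 := hq'.pathCast h0 h1
  have h3 : (p.subpath (t 0) (t (N + 1))).cast h0 h1 = p := by
    ext s
    have := congrArg (fun f : Path (p 0) (p 1) => f s) p.subpath_zero_one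
    rw [Path.cast_coe, ht0, ht1]
    exact this
  rwa [h3] at h2

end

/-! ### Existence of transverse representatives -/

section

open Matrix

attribute [local instance] Matrix.linftyOpNormedRing Matrix.linftyOpNormedAlgebra

variable {n : ℕ}

theorem exists_det_one_add_smul_polynomial (S : Matrix (Fin n) (Fin n) ℂ) :
    ∃ p : Polynomial ℂ, p ≠ 0 ∧ ∀ z : ℂ, p.eval z = (1 + z • S).det := by
  let p : Polynomial ℂ :=
    ((1 : Matrix (Fin n) (Fin n) ℂ).map Polynomial.C +
      (Polynomial.X : Polynomial ℂ) • S.map Polynomial.C).det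
  have hp : ∀ z : ℂ, p.eval z = (1 + z • S).det := by
    intro z
    rw [← Polynomial.coe_evalRingHom, RingHom.map_det]
    congr 1
    ext i j
    by_cases hij : i = j <;> simp [one_apply, hij] <;> ring
  refine ⟨p, fun h0 => ?_, hp⟩
  have := hp 0
  simp [h0] at this

/-- A bad τ makes e^{2iτ} a root of the nonzero polynomial det(1 + zS). On (0, 1), which is shorter
than the period π, distinct τ give distinct roots. -/
theorem countable_setOf_unitaryAct_phase_mem (l : Lambda n) :
    {τ : ℝ | τ ∈ Set.Ioo 0 1 ∧ unitaryAct (phase n τ) l ∈ maslovCycle n}.Countable := by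
  obtain ⟨p, hp, hpe⟩ := exists_det_one_add_smul_polynomial (souriau l)
  have hfin : {z : ℂ | Polynomial.IsRoot p z}.Finite := Polynomial.finite_setOfPred_isRoot hp
  have hinj : Set.InjOn (fun τ : ℝ => Complex.exp (2 * τ * Complex.I)) (Set.Ioo 0 1) := by
    intro s hs t ht h
    obtain ⟨k, hk⟩ := Complex.exp_eq_exp_iff_exists_int.1 h
    have h1 : s = t + k * Real.pi := by
      have h2 : ((s : ℂ) - (t + k * Real.pi)) * (2 * Complex.I) = 0 := by
        linear_combination hk
      have h3 := (mul_eq_zero.1 h2).resolve_right (by simp)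
      exact_mod_cast sub_eq_zero.1 h3
    have hpi := Real.pi_gt_three
    have hk0 : k = 0 := by
      have h4 : (k : ℝ) < 1 := by
        by_contra! h
        nlinarith [hs.2, ht.1]
      have h5 : (-1 : ℝ) < k := by
        by_contra! h
        nlinarith [hs.1, ht.2]
      have h6 : k < 1 := by exact_mod_cast h4
      have h7 : -1 < k := by exact_mod_cast h5
      omega
    simpa [hk0] using h1
  refine (Set.Finite.of_finite_image (hfin.subset ?_)
    (hinj.mono fun τ (hτ : τ ∈ Set.Ioo 0 1 ∧ _) => hτ.1)).countable
  rintro _ ⟨τ, ⟨-, hτ⟩, rfl⟩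
  rw [mem_maslovCycle_iff, souriau_phase] at hτ
  exact (hpe _).trans hτ

theorem exists_rotation_notMem {ι : Type*} [Countable ι] (l : ι → Lambda n) :
    ∃ τ : ℝ, ∀ i, unitaryAct (phase n τ) (l i) ∉ maslovCycle n := by
  have hc := Set.countable_iUnion fun i => countable_setOf_unitaryAct_phase_mem (l i)
  obtain ⟨τ, hτ, hτ'⟩ := (hc.dense_compl ℝ).exists_mem_open isOpen_Ioo
    (Set.nonempty_Ioo.2 (zero_lt_one' ℝ))
  exact ⟨τ, fun i hi => hτ (Set.mem_iUnion.2 ⟨i, hτ', hi⟩)⟩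

theorem continuous_unitaryAct_phase :
    Continuous fun x : ℝ × Lambda n => unitaryAct (phase n x.1) x.2 := by
  refine continuous_of_souriau ?_
  simp only [souriau_phase]
  have h : Continuous fun x : ℝ × Lambda n => souriau x.2 := continuous_souriau.comp continuous_snd
  have h' : Continuous fun x : ℝ × Lambda n => Complex.exp (2 * (x.1 : ℂ) * Complex.I) := by
    fun_prop
  exact h'.smul h

/-- A closed curve rotated by `e^{iτ}`. -/
def rotate (τ : ℝ) (γ : C(UnitAddCircle, Lambda n)) : C(UnitAddCircle, Lambda n) where
  toFun θ := unitaryAct (phase n τ) (γ θ)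
  continuous_toFun := by
    have h : Continuous fun θ => ((τ, γ θ) : ℝ × Lambda n) := by fun_prop
    have h' := continuous_unitaryAct_phase.comp h
    exact h'

theorem homotopic_rotate (τ : ℝ) (γ : C(UnitAddCircle, Lambda n)) :
    γ.Homotopic (rotate τ γ) := by
  have h : Continuous fun x : unitInterval × UnitAddCircle =>
    (((x.1 : ℝ) * τ, γ x.2) : ℝ × Lambda n) := by fun_prop
  have h' := continuous_unitaryAct_phase.comp h
  exact ⟨{
     toFun := fun x => unitaryAct (phase n (x.1 * τ)) (γ x.2)
     continuous_toFun := h'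
     map_zero_left := fun θ => by simp [unitaryAct_phase_zero]
     map_one_left := fun θ => by simp [rotate] }⟩

/-- The closed curve traced by a path with equal end points. -/
def loopOfPath {X : Type*} [TopologicalSpace X] {x : X} (p : Path x x) : C(UnitAddCircle, X) where
  toFun := AddCircle.liftIco 1 0 p.extend
  continuous_toFun := AddCircle.liftIco_zero_continuous (by simp) p.continuous_extend.continuousOn

theorem loopOfPath_coe {X : Type*} [TopologicalSpace X] {x : X} (p : Path x x) {t : ℝ}
    (ht : t ∈ Set.Icc (0 : ℝ) 1) : loopOfPath p t = p.extend t := by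
  rcases ht.2.eq_or_lt with h | h
  · have h0 : ((1 : ℝ) : UnitAddCircle) = ((0 : ℝ) : UnitAddCircle) := by simp
    rw [h, h0, Path.extend_one]
    exact (AddCircle.liftIco_zero_coe_apply ⟨le_rfl, zero_lt_one⟩).trans p.extend_zero
  · exact AddCircle.liftIco_zero_coe_apply (f := p.extend) ⟨ht.1, h⟩

/-- The path that runs once around a closed curve. -/
def pathOfLoop {X : Type*} [TopologicalSpace X] (γ : C(UnitAddCircle, X)) :
    Path (γ (0 : ℝ)) (γ (0 : ℝ)) where
  toFun t := γ ((t : ℝ) : UnitAddCircle)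
  continuous_toFun := by fun_prop
  source' := rfl
  target' := by
    have h0 : ((1 : ℝ) : UnitAddCircle) = ((0 : ℝ) : UnitAddCircle) := by simp
    rw [Set.Icc.coe_one, h0]

theorem exists_coe_eq (θ : UnitAddCircle) : ∃ t ∈ Set.Ico (0 : ℝ) 1, (t : UnitAddCircle) = θ := by
  have h := AddCircle.coe_image_Ico_eq (1 : ℝ) 0
  rw [zero_add] at h
  exact (h ▸ Set.mem_univ θ : θ ∈ ((↑) : ℝ → UnitAddCircle) '' Set.Ico (0 : ℝ) 1)

theorem loopOfPath_pathOfLoop {X : Type*} [TopologicalSpace X] (γ : C(UnitAddCircle, X)) :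
    loopOfPath (pathOfLoop γ) = γ := by
  ext θ
  obtain ⟨t, ht, rfl⟩ := exists_coe_eq θ
  have ht' := Set.Ico_subset_Icc_self ht
  rw [loopOfPath_coe _ ht', Path.extend_apply _ ht']
  rfl

/-- The homotopy is read as a closed curve in the space of maps from the unit interval to X. Gluing
its ends is then a statement about one curve, and evaluation returns the homotopy of loops. -/
theorem homotopic_loopOfPath {X : Type*} [TopologicalSpace X] {x : X} {p q : Path x x}
    (h : p.Homotopic q) : (loopOfPath p).Homotopic (loopOfPath q) := by
  obtain ⟨H⟩ := h
  let F : ℝ → C(unitInterval, X) := fun t =>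
    ⟨fun s => H (s, Set.projIcc 0 1 zero_le_one t), by fun_prop⟩
  have hF : Continuous F := by
    refine ContinuousMap.continuous_of_continuous_uncurry _ ?_
    change Continuous fun y : ℝ × unitInterval => H (y.2, Set.projIcc 0 1 zero_le_one y.1)
    exact H.continuous.comp (continuous_snd.prodMk (continuous_projIcc.comp continuous_fst))
  let G : UnitAddCircle → C(unitInterval, X) := AddCircle.liftIco 1 0 F
  have hG : Continuous G := AddCircle.liftIco_zero_continuous (by
    ext s
    simp [F]) hF.continuousOn
  have hGt : ∀ t ∈ Set.Ico (0 : ℝ) 1, G t = F t := fun t ht =>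
    AddCircle.liftIco_zero_coe_apply ht
  refine ⟨{
    toFun := fun y => G y.2 y.1
    continuous_toFun := ?_
    map_zero_left := ?_
    map_one_left := ?_ }⟩
  · exact continuous_eval.comp ((hG.comp continuous_snd).prodMk continuous_fst)
  · intro θ
    obtain ⟨t, ht, rfl⟩ := exists_coe_eq θ
    have ht' := Set.Ico_subset_Icc_self ht
    change G t 0 = _
    rw [hGt t ht, loopOfPath_coe _ ht', Path.extend_apply _ ht']
    simp [F, Set.projIcc_of_mem _ ht']
  · intro θ
    obtain ⟨t, ht, rfl⟩ := exists_coe_eq θ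
    have ht' := Set.Ico_subset_Icc_self ht
    change G t 1 = _
    rw [hGt t ht, loopOfPath_coe _ ht', Path.extend_apply _ ht']
    simp [F, Set.projIcc_of_mem _ ht']

/-- Only t = 0 is delicate: times just below 0 correspond to times just below 1, and the path is
constant near both ends, so the loop is smooth across the base point. -/
theorem IsTransversePath.loopOfPath_eventuallyEq {x : Lambda n} {p : Path x x}
    (hp : IsTransversePath p) {t : ℝ} (ht : t ∈ Set.Ico (0 : ℝ) 1) :
    p.extend =ᶠ[𝓝 t] fun s => loopOfPath p (s : UnitAddCircle) := by
  rcases ht.1.eq_or_lt with h | h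
  · subst h
    have hc : Continuous fun s : ℝ => s + 1 := by fun_prop
    filter_upwards [hp.source, (hc.tendsto' 0 1 (by simp)).eventually hp.target,
      Ioo_mem_nhds (show (-1 : ℝ) < 0 by norm_num) zero_lt_one] with s h0 h1 hs
    rcases le_total 0 s with h | h
    · rw [loopOfPath_coe p ⟨h, hs.2.le⟩]
    · have h2 : (s : UnitAddCircle) = ((s + 1 : ℝ) : UnitAddCircle) := by simp
      rw [h0, h2, loopOfPath_coe p ⟨by linarith [hs.1], by linarith⟩, h1]
  · filter_upwards [Ioo_mem_nhds h ht.2] with s hs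
    rw [loopOfPath_coe p ⟨hs.1.le, hs.2.le⟩]

theorem IsTransversePath.isSmoothLoop {x : Lambda n} {p : Path x x} (hp : IsTransversePath p) :
    IsSmoothLoop (loopOfPath p) := by
  refine contDiff_iff_contDiffAt.2 fun t => ?_
  have h0 : ∀ t ∈ Set.Ico (0 : ℝ) 1,
      ContDiffAt ℝ ∞ (fun s : ℝ => proj (loopOfPath p (s : UnitAddCircle))) t := fun t ht =>
    hp.contDiff.contDiffAt.congr_of_eventuallyEq
      ((hp.loopOfPath_eventuallyEq ht).mono fun s hs => by simp only [hs])
  have h1 := h0 (Int.fract t) ⟨Int.fract_nonneg t, Int.fract_lt_one t⟩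
  have h2 : ContDiffAt ℝ ∞ (fun s : ℝ => s - ⌊t⌋) t := contDiffAt_id.sub contDiffAt_const
  have h3 := ContDiffAt.comp t (f := fun s : ℝ => s - ⌊t⌋) h1 h2
  refine h3.congr_of_eventuallyEq (Filter.Eventually.of_forall fun s => ?_)
  have h4 : ((s - ⌊t⌋ : ℝ) : UnitAddCircle) = (s : UnitAddCircle) := by
    have h5 : ((⌊t⌋ : ℝ) : UnitAddCircle) = 0 :=
      (AddCircle.coe_eq_zero_iff (1 : ℝ)).2 ⟨⌊t⌋, by simp⟩
    rw [AddCircle.coe_sub, h5, sub_zero]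
  simp only [Function.comp_apply, h4]

theorem IsTransversePath.isTransverse {x : Lambda n} {p : Path x x} (hp : IsTransversePath p) :
    IsTransverse (loopOfPath p) := by
  intro θ hθ
  obtain ⟨t, ht, rfl⟩ := exists_coe_eq θ
  have h := (hp.transverseAt t).congr (hp.loopOfPath_eventuallyEq ht)
  rw [← (hasDerivAt_velocity hp.isSmoothLoop t).1.deriv]
  exact h hθ

/-- Only countably many subspaces, the values at rational times, have to be rotated off the cycle,
and the rotation is itself a homotopy. No general transversality theorem is used. -/
theorem exists_isTransverseRep (γ : C(UnitAddCircle, Lambda n)) : ∃ δ, IsTransverseRep γ δ := by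
  obtain ⟨τ, hτ⟩ := exists_rotation_notMem fun r : ℚ => γ ((r : ℝ) : UnitAddCircle)
  obtain ⟨q, hq, hq'⟩ := exists_isTransversePath_homotopic (pathOfLoop (rotate τ γ))
    fun t ⟨r, hr⟩ => by
      change unitaryAct (phase n τ) (γ ((t : ℝ) : UnitAddCircle)) ∉ _
      rw [← hr]
      exact hτ r
  have h := homotopic_loopOfPath hq'.symm
  rw [loopOfPath_pathOfLoop] at h
  exact ⟨loopOfPath q, (homotopic_rotate τ γ).trans h, hq.isSmoothLoop, hq.isTransverse⟩

theorem Ind_eq_maslov (γ : C(UnitAddCircle, Lambda n)) : Ind γ = maslov γ := by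
  rw [Ind, dif_pos (exists_isTransverseRep γ)]
  have h := (exists_isTransverseRep γ).choose_spec
  rw [h.2.2.signedCount_eq_maslov h.2.1, maslov_eq_of_homotopic h.1]

end

end LagrangianGr

end

theorem mainTheorem3 (n : ℕ) (γ : C(UnitAddCircle, LagrangianGr.Lambda n)) :
    (∃ δ : C(UnitAddCircle, LagrangianGr.Lambda n), LagrangianGr.IsTransverseRep γ δ) ∧
    (∀ δ : C(UnitAddCircle, LagrangianGr.Lambda n), LagrangianGr.IsTransverseRep γ δ →
      (LagrangianGr.crossings δ).Finite ∧
        LagrangianGr.signedCount δ = LagrangianGr.Ind γ) ∧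
    LagrangianGr.Ind γ = LagrangianGr.maslov γ := by
  refine ⟨LagrangianGr.exists_isTransverseRep γ, fun δ hδ => ⟨hδ.2.2.finite_crossings hδ.2.1, ?_⟩,
    LagrangianGr.Ind_eq_maslov γ⟩
  rw [LagrangianGr.Ind_eq_maslov, hδ.2.2.signedCount_eq_maslov hδ.2.1,
    LagrangianGr.maslov_eq_of_homotopic hδ.1]
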